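/- Let $q$ be a power of a prime $p>3$. Let $\Phi\subset\mathbb R^3$ be the root system of type $G_2$ with simple roots $\alpha_1=e_1-e_2$ (short), $\alpha_2=-2e_1+e_2+e_3$ (long) and positive roots $\Phi^+=\{\alpha_1,\dots,\alpha_6\}$, where $\alpha_3=\alpha_1+\alpha_2$, $\alpha_4=2\alpha_1+\alpha_2$, $\alpha_5=3\alpha_1+\alpha_2$, $\alpha_6=3\alpha_1+2\alpha_2$. Let $UG_2=UG_2(q)$ be the subgroup generated by the elements $x_\alpha(t)=\exp(t\,\mathrm{ad}\,e_\alpha)$ ($\alpha\in\Phi^+$, $t\in\mathbb F_q$) of the Chevalley group of type $G_2$ over $\mathbb F_q$ (with respect to a fixed Chevalley basis), let $X_\alpha=\langle x_\alpha(t)\mid t\in\mathbb F_q\rangle$, and for $S\subseteq\Phi^+$ let $P(S)=\langle X_\alpha\mid\alpha\in S\rangle$. The set $S$ is a closed pattern if $\alpha,\beta\in S$ and $\alpha+\beta\in\Phi^+$ imply $\alpha+\beta\in S$, and a subset $N\subseteq S$ is normal in $S$, $N\unlhd S$, if $\alpha\in S$, $\beta\in N$ and $\alpha+\beta\in\Phi^+$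 imply $\alpha+\beta\in N$. For $\alpha\in\Phi^+$ let $h(\alpha)=\{\gamma\in\Phi^+\mid\alpha-\gamma\in\Phi^+\cup\{0\}\}$. Let $n_0(\alpha)=\{\alpha\}$, $n_i(\alpha)=\{\beta+\gamma\mid\beta\in n_{i-1}(\alpha),\gamma\in\Phi^+\}\cap\Phi^+$, $k_0(\alpha)=\bigcup_{i\ge1}n_i(\alpha)$, $k_i(\alpha)=k_{i-1}(\alpha)\cup(\{\beta\in\Phi^+\mid\text{for all }\gamma\in\Phi^+:\ \beta+\gamma\notin\Phi^+\text{ or }\beta+\gamma\in k_{i-1}(\alpha)\}\setminus\{\alpha\})$ for $i\ge1$, and $k(\alpha)=\bigcup_{i\ge0}k_i(\alpha)$. Choose the arms $a(\alpha_1)=a(\alpha_2)=\emptyset$, $a(\alpha_3)=a(\alpha_4)=a(\alpha_5)=\{\alpha_1\}$, $a(\alpha_6)=\{\alpha_2,\alpha_3\}$, and put $\ell(\alpha)=h(\alpha)\setminus(\{\alpha\}\cup a(\alpha))$, $s(\alpha)=\Phi^+\setminus a(\alpha)$, $S_\alpha=P(s(\alpha))$. $\mathrm{Irr}(G)$ denotes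 the set of complex irreducible characters of a finite group $G$, and $\mathrm{Irr}(G)^*=\mathrm{Irr}(G)\setminus\{\mathbf 1_G\}$. For $\chi\in\mathrm{Irr}(UG_2)$ let $\mathrm{rs}(\chi)=\{\beta\in\Phi^+\mid X_\beta\subseteq Z(\chi),\ X_\beta\not\subseteq\mathrm{Ker}(\chi)\}$, where $Z(\chi)=\{g\mid|\chi(g)|=\chi(1)\}$ and $\mathrm{Ker}(\chi)=\{g\mid\chi(g)=\chi(1)\}$. Let $\mathrm{Irr}(UG_2)_\alpha=\{\chi\in\mathrm{Irr}(UG_2)\mid\mathrm{rs}(\chi)=\{\alpha\}\}$; the midafis for $\alpha$ are the elements of $\mathrm{Irr}(UG_2)_\alpha$ of minimal degree in this set. Then the following hold for every $\alpha\in\Phi^+$. (1) $s(\alpha)$ is a closed pattern, $\{\alpha\}\cup\ell(\alpha)\cup k(\alpha)\unlhd\Phi^+$, the groups $P(\{\alpha\}\cup\ell(\alpha)\cup k(\alpha))\cap S_\alpha$ and $P(s(\alpha)\setminus\{\alpha\})$ are normal in $S_\alpha$, and the natural map $X_\alpha\to S_\alpha/P(s(\alpha)\setminus\{\alpha\})$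 is an isomorphism. Let $\overline T_\alpha$ be the quotient of $S_\alpha$ by the first of these two normal subgroups, and identify $X_\alpha$ with the quotient by the second. (2) The map $$\Psi_\alpha:\mathrm{Irr}(\overline T_\alpha)\times\mathrm{Irr}(X_\alpha)^*\to\mathrm{Irr}(UG_2)_\alpha,\qquad(\mu,\lambda)\mapsto\bigl(\mathrm{infl}_{\overline T_\alpha}^{S_\alpha}\mu\cdot\mathrm{infl}_{X_\alpha}^{S_\alpha}\lambda\bigr)^{UG_2}$$ (the product of the two inflations, induced from $S_\alpha$ to $UG_2$) is well defined and a bijection. (3) The number of midafis for $\alpha=\alpha_1,\dots,\alpha_6$ is, respectively, $q-1,\ q-1,\ q-1,\ q(q-1),\ q^2(q-1),\ q(q-1)$, and every midafi for $\alpha$ has degree, respectively, $1,\ 1,\ q,\ q,\ q,\ q^2$. -/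

import Mathlib

namespace UG2

open scoped Nat

/-! ### The root system

The positive roots are indexed by `Fin 6`: the index `i` stands for the root `α_{i+1}`.
All roots lie in the integral lattice of `ℝ³`. -/

/-- The positive roots `α₁ = e₁ - e₂`, `α₂ = -2e₁ + e₂ + e₃`, `α₃ = α₁ + α₂`, `α₄ = 2α₁ + α₂`,
`α₅ = 3α₁ + α₂`, `α₆ = 3α₁ + 2α₂` in the coordinates `e₁, e₂, e₃`. -/
def posRoot : Fin 6 → Fin 3 → ℤ :=
  ![![1, -1, 0], ![-2, 1, 1], ![-1, 0, 1], ![0, -1, 1], ![1, -2, 1], ![-1, -1, 2]]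

/-- The simple roots are `α₁` and `α₂`. -/
def simpleIdx : Fin 2 → Fin 6 := ![0, 1]

/-- Coefficients of the positive roots with respect to `α₁, α₂`. -/
def simpleCoeff : Fin 6 → Fin 2 → ℤ :=
  ![![1, 0], ![0, 1], ![1, 1], ![2, 1], ![3, 1], ![3, 2]]

theorem posRoot_eq : ∀ i, posRoot i =
    simpleCoeff i 0 • posRoot (simpleIdx 0) + simpleCoeff i 1 • posRoot (simpleIdx 1) := by
  decide

/-- The Euclidean inner product. -/
def dot (v w : Fin 3 → ℤ) : ℤ := v 0 * w 0 + v 1 * w 1 + v 2 * w 2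

/-- The squared length of the root `α_{i+1}`. -/
def sqLen (i : Fin 6) : ℤ := dot (posRoot i) (posRoot i)

/-! ### The Lie algebra of type `G₂` in a Chevalley basis -/

/-- The Cartan integer `2 (r, s) / (r, r)` for a simple root `r` and a positive root `s`. -/
def cartanInt (i : Fin 2) (j : Fin 6) : ℤ :=
  2 * dot (posRoot (simpleIdx i)) (posRoot j) / sqLen (simpleIdx i)

/-- The coefficients of the coroot `2 r / (r, r)` of a positive root `r` with respect to the two
simple coroots. -/
def corootCoeff (j : Fin 6) (i : Fin 2) : ℤ :=
  simpleCoeff j i * sqLen (simpleIdx i) / sqLen j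

/-- The constants `N_{r,s}` in `[e_r, e_s] = N_{r,s} e_{r+s}` for positive roots `r`, `s`. The
signs on the extraspecial pairs `(α₁, α₂)`, `(α₁, α₃)`, `(α₁, α₄)`, `(α₂, α₅)` are chosen to be
positive. -/
def posConst : Fin 6 → Fin 6 → ℤ :=
  ![![0, 1, 2, 3, 0, 0],
    ![-1, 0, 0, 0, 1, 0],
    ![-2, 0, 0, -3, 0, 0],
    ![-3, 0, 3, 0, 0, 0],
    ![0, -1, 0, 0, 0, 0],
    ![0, 0, 0, 0, 0, 0]]

/-- Index set of the Chevalley basis: `h i` for the two simple coroots, `e i` for the root vector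
of `α_{i+1}`, and `f i` for the root vector of `-α_{i+1}`. -/
abbrev Idx := Fin 2 ⊕ Fin 6 ⊕ Fin 6

abbrev Idx.h (i : Fin 2) : Idx := .inl i
abbrev Idx.e (i : Fin 6) : Idx := .inr (.inl i)
abbrev Idx.f (i : Fin 6) : Idx := .inr (.inr i)

/-- The coefficients of `[e_r, e_{-s}]` for positive roots `r = α_{i+1}`, `s = α_{j+1}`. It is the
coroot `h_r` if `r = s`, and otherwise `N_{r,-s} e_{r-s}` if `r - s` is a root, where `N_{r,-s}` is
computed from `posConst` by the rules `N_{-a,-b} = -N_{a,b}` and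
`N_{a,b} / (c, c) = N_{b,c} / (a, a) = N_{c,a} / (b, b)` for roots with `a + b + c = 0`. -/
def mixedConst (i j : Fin 6) : Idx → ℤ
  | .inl l => if i = j then corootCoeff i l else 0
  | .inr (.inl k) =>
      if posRoot i = posRoot j + posRoot k then -(sqLen k * posConst j k) / sqLen i else 0
  | .inr (.inr k) =>
      if posRoot j = posRoot i + posRoot k then sqLen k * posConst k i / sqLen j else 0

/-- The structure constants: `structConst x y z` is the coefficient of the basis vector `z` in
the bracket of the basis vectors `x` and `y`. -/
def structConst : Idx → Idx → Idx → ℤ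
  | .inl i, .inr (.inl j), .inr (.inl k) => if j = k then cartanInt i j else 0
  | .inl i, .inr (.inr j), .inr (.inr k) => if j = k then -cartanInt i j else 0
  | .inr (.inl j), .inl i, .inr (.inl k) => if j = k then -cartanInt i j else 0
  | .inr (.inr j), .inl i, .inr (.inr k) => if j = k then cartanInt i j else 0
  | .inr (.inl i), .inr (.inl j), .inr (.inl k) =>
      if posRoot i + posRoot j = posRoot k then posConst i j else 0
  | .inr (.inr i), .inr (.inr j), .inr (.inr k) =>
      if posRoot i + posRoot j = posRoot k then -posConst i j else 0
  | .inr (.inl i), .inr (.inr j), x => mixedConst i j x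
  | .inr (.inr j), .inr (.inl i), x => -mixedConst i j x
  | _, _, _ => 0

/-- An injective integral encoding of the root of a basis vector (zero for `h i`). -/
def weight : Idx → ℤ
  | .inl _ => 0
  | .inr (.inl i) => 10 * simpleCoeff i 0 + simpleCoeff i 1
  | .inr (.inr i) => -(10 * simpleCoeff i 0 + simpleCoeff i 1)

theorem structConst_antisymm : ∀ x y z, structConst x y z = -structConst y x z := by
  decide +kernel

theorem structConst_self (x z : Idx) : structConst x x z = 0 := by
  have := structConst_antisymm x x z
  omega

theorem structConst_eq_zero : ∀ x y z, weight x + weight y ≠ weight z → structConst x y z = 0 := by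
  decide +kernel

/-- The left-hand side of the Jacobi identity for basis vectors. -/
def jacobiSum (x y z w : Idx) : ℤ :=
  ∑ m, (structConst x y m * structConst m z w + structConst y z m * structConst m x w +
    structConst z x m * structConst m y w)

def code : Idx → ℕ
  | .inl i => i
  | .inr (.inl i) => 2 + i
  | .inr (.inr i) => 8 + i

theorem code_injective : Function.Injective code := by
  unfold Function.Injective
  decide +kernel

theorem jacobiSum_aux : ∀ x y z w, weight x + weight y + weight z = weight w →
    code x < code y → code y < code z → jacobiSum x y z w = 0 := by
  decide +kernel

theorem jacobiSum_cyc (x y z w : Idx) : jacobiSum x y z w = jacobiSum y z x w := by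
  unfold jacobiSum
  exact Finset.sum_congr rfl fun m _ => by ring

theorem jacobiSum_swap (x y z w : Idx) : jacobiSum x y z w = -jacobiSum y x z w := by
  unfold jacobiSum
  rw [← Finset.sum_neg_distrib]
  refine Finset.sum_congr rfl fun m _ => ?_
  rw [structConst_antisymm x y m, structConst_antisymm y z m, structConst_antisymm z x m]
  ring

theorem jacobiSum_eq_zero (x y z w : Idx) : jacobiSum x y z w = 0 := by
  by_cases hw : weight x + weight y + weight z = weight w
  · have key : ∀ x y z, weight x + weight y + weight z = weight w → code x ≤ code y →
        code y ≤ code z → jacobiSum x y z w = 0 := by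
      intro x y z hw hxy hyz
      rcases hxy.lt_or_eq with h1 | h1
      · rcases hyz.lt_or_eq with h2 | h2
        · exact jacobiSum_aux x y z w hw h1 h2
        · obtain rfl := code_injective h2
          have h3 := jacobiSum_swap y y x w
          have h4 := jacobiSum_cyc x y y w
          omega
      · obtain rfl := code_injective h1
        have := jacobiSum_swap x x z w
        omega
    have c1 := jacobiSum_cyc x y z w
    have c2 := jacobiSum_cyc y z x w
    have s1 := jacobiSum_swap x y z w
    have d1 := jacobiSum_cyc y x z w
    have d2 := jacobiSum_cyc x z y w
    rcases le_total (code x) (code y) with h1 | h1 <;>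
    rcases le_total (code y) (code z) with h2 | h2 <;>
    rcases le_total (code x) (code z) with h3 | h3
    · exact key x y z hw h1 h2
    · exact key x y z hw h1 h2
    · have := key x z y (by omega) h3 h2
      omega
    · have := key z x y (by omega) h3 h1
      omega
    · have := key y x z (by omega) h1 h3
      omega
    · have := key y z x (by omega) h2 h3
      omega
    · have := key z y x (by omega) h2 h1
      omega
    · have := key z y x (by omega) h2 h1
      omega
  · refine Finset.sum_eq_zero fun m _ => ?_
    have aux : ∀ a b c, weight a + weight b + weight c ≠ weight w →
        structConst a b m * structConst m c w = 0 := by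
      intro a b c h
      by_cases h' : weight a + weight b = weight m
      · rw [structConst_eq_zero m c w (by omega), mul_zero]
      · rw [structConst_eq_zero a b m h', zero_mul]
    rw [aux x y z hw, aux y z x (by omega), aux z x y (by omega)]
    rfl

/-- The Lie algebra of type `G₂` over `F`, obtained from the integral form spanned by the Chevalley
basis. -/
def Alg (F : Type*) := Idx → F

section Algebra

variable (F : Type*) [Field F]

noncomputable instance : AddCommGroup (Alg F) := inferInstanceAs (AddCommGroup (Idx → F))

noncomputable instance : Module F (Alg F) := inferInstanceAs (Module F (Idx → F))

noncomputable instance : FiniteDimensional F (Alg F) :=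
  inferInstanceAs (FiniteDimensional F (Idx → F))

/-- The Chevalley basis. -/
noncomputable def chevalleyBasis : Module.Basis Idx F (Alg F) := Pi.basisFun F Idx

/-- The bracket, extended bilinearly from the basis. -/
noncomputable def bracketMap : Alg F →ₗ[F] Alg F →ₗ[F] Alg F :=
  (chevalleyBasis F).constr F fun x => (chevalleyBasis F).constr F fun y =>
    ∑ z, (structConst x y z : F) • chevalleyBasis F z

theorem bracketMap_basis (x y : Idx) :
    bracketMap F (chevalleyBasis F x) (chevalleyBasis F y) =
      ∑ z, (structConst x y z : F) • chevalleyBasis F z := by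
  rw [bracketMap, Module.Basis.constr_basis, Module.Basis.constr_basis]

theorem bracketMap_antisymm (v w : Alg F) : bracketMap F v w = -bracketMap F w v := by
  have : bracketMap F = -(bracketMap F).flip := by
    refine (chevalleyBasis F).ext fun x => (chevalleyBasis F).ext fun y => ?_
    simp only [LinearMap.neg_apply, LinearMap.flip_apply, bracketMap_basis]
    rw [← Finset.sum_neg_distrib]
    refine Finset.sum_congr rfl fun z _ => ?_
    rw [structConst_antisymm x y z, Int.cast_neg, neg_smul]
  exact LinearMap.congr_fun (LinearMap.congr_fun this v) w

theorem bracketMap_self (v : Alg F) : bracketMap F v v = 0 := by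
  rw [← (chevalleyBasis F).sum_repr v]
  generalize ((chevalleyBasis F).repr v) = c
  simp only [map_sum, map_smul, LinearMap.sum_apply, LinearMap.smul_apply, Finset.smul_sum]
  rw [← Finset.sum_product', Finset.univ_product_univ]
  refine Finset.sum_involution (fun a _ => a.swap) ?_ ?_ ?_ ?_
  · rintro ⟨x, y⟩ -
    simp only [Prod.swap]
    rw [bracketMap_antisymm F (chevalleyBasis F y), smul_neg, smul_neg, smul_comm,
      neg_add_cancel]
  · rintro ⟨x, y⟩ - h heq
    obtain rfl : y = x := congrArg Prod.fst heq
    apply h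
    simp [bracketMap_basis, structConst_self]
  · simp
  · simp

theorem basis_induction (P : Alg F → Prop) (hb : ∀ x, P (chevalleyBasis F x))
    (hadd : ∀ a b, P a → P b → P (a + b)) (hsmul : ∀ (c : F) a, P a → P (c • a)) (v : Alg F) :
    P v := by
  have h0 : P 0 := by
    have := hsmul 0 _ (hb (.h 0))
    rwa [zero_smul] at this
  refine Submodule.span_induction (p := fun v _ => P v) ?_ h0 (fun a b _ _ => hadd a b)
    (fun c a _ => hsmul c a) ((chevalleyBasis F).mem_span v)
  rintro _ ⟨x, rfl⟩
  exact hb x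

theorem bracketMap_jacobi (u v w : Alg F) :
    bracketMap F u (bracketMap F v w) =
      bracketMap F (bracketMap F u v) w + bracketMap F v (bracketMap F u w) := by
  have basis : ∀ x y z : Idx,
      bracketMap F (bracketMap F (chevalleyBasis F x) (chevalleyBasis F y)) (chevalleyBasis F z) +
      bracketMap F (bracketMap F (chevalleyBasis F y) (chevalleyBasis F z)) (chevalleyBasis F x) +
      bracketMap F (bracketMap F (chevalleyBasis F z) (chevalleyBasis F x)) (chevalleyBasis F y)
        = 0 := by
    intro x y z
    simp only [bracketMap_basis, map_sum, map_smul, LinearMap.sum_apply, LinearMap.smul_apply,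
      Finset.smul_sum, smul_smul]
    rw [← Finset.sum_add_distrib, ← Finset.sum_add_distrib]
    simp only [← Finset.sum_add_distrib, ← add_smul]
    rw [Finset.sum_comm]
    refine Finset.sum_eq_zero fun t _ => ?_
    rw [← Finset.sum_smul]
    have := congrArg (Int.cast : ℤ → F) (jacobiSum_eq_zero x y z t)
    simp only [jacobiSum] at this
    push_cast at this
    rw [this, zero_smul]
  let T : Alg F → Alg F → Alg F → Alg F := fun u v w => bracketMap F (bracketMap F u v) w +
      bracketMap F (bracketMap F v w) u + bracketMap F (bracketMap F w u) v
  have cyc : ∀ u v w, T u v w = T v w u := fun u v w => by simp only [T]; abel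
  have add : ∀ a b v w, T (a + b) v w = T a v w + T b v w := fun a b v w => by
    simp only [T, map_add, LinearMap.add_apply]; abel
  have smul : ∀ (c : F) a v w, T (c • a) v w = c • T a v w := fun c a v w => by
    simp only [T, map_smul, LinearMap.smul_apply, smul_add]
  have ext : ∀ v w, (∀ x, T (chevalleyBasis F x) v w = 0) → ∀ u, T u v w = 0 := fun v w h u =>
    basis_induction F (fun u => T u v w = 0) h
      (fun a b ha hb => by rw [add, ha, hb, add_zero])
      (fun c a ha => by rw [smul, ha, smul_zero]) u
  have tri : ∀ u v w, T u v w = 0 := fun u v w =>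
    ext v w (fun x => by
      rw [cyc]
      refine ext w _ (fun y => ?_) v
      rw [cyc]
      refine ext _ _ (fun z => ?_) w
      rw [cyc]
      exact basis x y z) u
  have h := tri u v w
  simp only [T] at h
  rw [bracketMap_antisymm F (bracketMap F v w) u, bracketMap_antisymm F w u] at h
  simp only [map_neg, LinearMap.neg_apply] at h
  rw [bracketMap_antisymm F (bracketMap F u w) v] at h
  rw [neg_neg] at h
  rw [← sub_eq_zero, ← neg_eq_zero, ← h]
  abel

noncomputable instance : LieRing (Alg F) where
  bracket v w := bracketMap F v w
  add_lie u v w := by simp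
  lie_add u v w := by simp
  lie_self v := bracketMap_self F v
  leibniz_lie u v w := bracketMap_jacobi F u v w

noncomputable instance : LieAlgebra F (Alg F) where
  lie_smul c v w := (bracketMap F v).map_smul c w

theorem lie_chevalleyBasis (x y : Idx) :
    ⁅chevalleyBasis F x, chevalleyBasis F y⁆ =
      ∑ z, (structConst x y z : F) • chevalleyBasis F z :=
  bracketMap_basis F x y

/-! ### The root subgroups and the group `UG₂(q)` -/

/-- `exp (t · ad e_r)` for the positive root `r = α_{i+1}`, acting on the Lie algebra. The
exponential series stops after the cubic term since `(ad e_r)⁴ = 0`. -/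
noncomputable def rootExp (i : Fin 6) (t : F) : Module.End F (Alg F) :=
  ∑ k ∈ Finset.range 4, (t ^ k * (k ! : F)⁻¹) • LieAlgebra.ad F (Alg F) (chevalleyBasis F (.e i)) ^ k

theorem ad_pow_mem (i : Fin 6) (y : Idx) (k : ℕ) :
    (LieAlgebra.ad F (Alg F) (chevalleyBasis F (.e i)) ^ k) (chevalleyBasis F y) ∈
      Submodule.span F (chevalleyBasis F '' {z | weight z = weight y + k * weight (.e i)}) := by
  induction k with
  | zero => exact Submodule.subset_span ⟨y, by simp, by simp⟩
  | succ k ih =>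
    rw [pow_succ', Module.End.mul_apply]
    refine Submodule.span_induction (p := fun v _ => LieAlgebra.ad F (Alg F)
      (chevalleyBasis F (.e i)) v ∈ _) ?_ (by simp) (fun a b _ _ ha hb => ?_)
      (fun c a _ ha => ?_) ih
    · rintro _ ⟨z, hz, rfl⟩
      rw [LieAlgebra.ad_apply, lie_chevalleyBasis]
      refine Submodule.sum_mem _ fun w _ => ?_
      by_cases hw : weight (.e i) + weight z = weight w
      · refine Submodule.smul_mem _ _ (Submodule.subset_span ⟨w, ?_, rfl⟩)
        simp only [Set.mem_ofPred_eq] at hz ⊢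
        push_cast
        linarith
      · rw [structConst_eq_zero _ _ _ hw]
        simp
    · rw [map_add]
      exact Submodule.add_mem _ ha hb
    · rw [map_smul]
      exact Submodule.smul_mem _ _ ha

theorem weight_ne : ∀ (i : Fin 6) (y z : Idx), weight z ≠ weight y + 4 * weight (.e i) := by
  decide +kernel

theorem ad_pow_four (i : Fin 6) :
    LieAlgebra.ad F (Alg F) (chevalleyBasis F (.e i)) ^ 4 = 0 := by
  refine (chevalleyBasis F).ext fun y => ?_
  have h := ad_pow_mem F i y 4
  have h' : {z | weight z = weight y + (4 : ℕ) * weight (.e i)} = ∅ := by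
    ext z
    simpa using weight_ne i y z
  rw [h'] at h
  simpa using h

theorem rootExp_add (h : (6 : F) ≠ 0) (i : Fin 6) (s t : F) :
    rootExp F i s * rootExp F i t = rootExp F i (s + t) := by
  have h2 : (2 : F) ≠ 0 := fun h' => h (by linear_combination 3 * h')
  have h3 : (3 : F) ≠ 0 := fun h' => h (by linear_combination 2 * h')
  unfold rootExp
  have h4 := ad_pow_four F i
  generalize LieAlgebra.ad F (Alg F) (chevalleyBasis F (.e i)) = N at h4
  have h5 : N ^ 5 = 0 := by rw [pow_succ, h4, zero_mul]
  have h6 : N ^ 6 = 0 := by rw [pow_succ, h5, zero_mul]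
  simp only [Finset.sum_range_succ, Finset.sum_range_zero, zero_add, mul_add, add_mul,
    smul_mul_smul_comm, ← pow_add, Nat.reduceAdd, h4, h5, h6, smul_zero, add_zero,
    Nat.factorial]
  norm_num
  match_scalars <;> field_simp <;> ring

/-- In characteristic greater than `3`, `exp (t · ad e_r)` is invertible. -/
theorem isUnit_rootExp (h : (6 : F) ≠ 0) (i : Fin 6) (t : F) : IsUnit (rootExp F i t) := by
  have h0 : rootExp F i 0 = 1 := by simp [rootExp, Finset.sum_range_succ]
  exact ⟨⟨rootExp F i t, rootExp F i (-t), by rw [rootExp_add F h, add_neg_cancel, h0],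
    by rw [rootExp_add F h, neg_add_cancel, h0]⟩, rfl⟩

/-- The elements `x_r(t) = exp (t · ad e_r)`, `t ∈ F`, of the Chevalley group of type `G₂` over
`F`, for the positive root `r = α_{i+1}`. -/
noncomputable def rootElements (i : Fin 6) : Set (Module.End F (Alg F))ˣ :=
  {u | ∃ t : F, (u : Module.End F (Alg F)) = rootExp F i t}

/-- The group `UG₂(F)`, generated by all `x_r(t)` for positive roots `r`. -/
noncomputable def U : Subgroup (Module.End F (Alg F))ˣ := Subgroup.closure (⋃ i, rootElements F i)

/-- The root subgroup `X_r = ⟨x_r(t) | t ∈ F⟩` of `UG₂(F)`. -/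
noncomputable def rootSubgroup (i : Fin 6) : Subgroup (U F) :=
  Subgroup.closure {u | (u : (Module.End F (Alg F))ˣ) ∈ rootElements F i}

/-- The subgroup `P(S)` generated by the root subgroups of the roots in `S`. -/
noncomputable def P (S : Set (Fin 6)) : Subgroup (U F) := ⨆ i ∈ S, rootSubgroup F i

end Algebra

/-! ### Patterns of positive roots -/

/-- Closed patterns. -/
def IsClosedPattern (S : Set (Fin 6)) : Prop :=
  ∀ i ∈ S, ∀ j ∈ S, ∀ k, posRoot i + posRoot j = posRoot k → k ∈ S

/-- `N ⊴ S`: `N ⊆ S`, and `S` normalizes `N`. -/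
def IsNormalPattern (N S : Set (Fin 6)) : Prop :=
  N ⊆ S ∧ ∀ i ∈ S, ∀ j ∈ N, ∀ k, posRoot i + posRoot j = posRoot k → k ∈ N

/-- The root center of the quotient pattern group `UG₂ / P(N)`. -/
def rootCenter (N : Set (Fin 6)) : Set (Fin 6) :=
  {i | ∀ j k, posRoot i + posRoot j = posRoot k → k ∈ N} \ N

/-- The sets `n_m(α)`. -/
def nSeq (α : Fin 6) : ℕ → Set (Fin 6)
  | 0 => {α}
  | m + 1 => {k | ∃ i ∈ nSeq α m, ∃ j, posRoot i + posRoot j = posRoot k}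

/-- The sets `k_m(α)`, starting from `k_0(α) = n(α) = ⋃_{m ≥ 1} n_m(α)`. -/
def kSeq (α : Fin 6) : ℕ → Set (Fin 6)
  | 0 => ⋃ m : ℕ, nSeq α (m + 1)
  | m + 1 => (rootCenter (kSeq α m) \ {α}) ∪ kSeq α m

/-- `k(α) = ⋃_m k_m(α)`. -/
def kSet (α : Fin 6) : Set (Fin 6) := ⋃ m, kSeq α m

/-- The hook `h(α)`. -/
def hook (α : Fin 6) : Set (Fin 6) :=
  {γ | posRoot α - posRoot γ = 0 ∨ ∃ β, posRoot α - posRoot γ = posRoot β}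

/-- The arms `a(α₁) = a(α₂) = ∅`, `a(α₃) = a(α₄) = a(α₅) = {α₁}`, `a(α₆) = {α₂, α₃}`. -/
def arm : Fin 6 → Set (Fin 6) := ![∅, ∅, {0}, {0}, {0}, {1, 2}]

/-- The leg `ℓ(α)`, so that `h(α)` is the disjoint union of `{α}`, `a(α)` and `ℓ(α)`. -/
def leg (α : Fin 6) : Set (Fin 6) := hook α \ ({α} ∪ arm α)

/-- The source `s(α)`. -/
def source (α : Fin 6) : Set (Fin 6) := (arm α)ᶜ

/-! ### Characters of finite groups -/

/-- The set of complex irreducible characters. -/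
def Irr (G : Type*) [Group G] : Set (G → ℂ) :=
  {χ | ∃ (n : ℕ) (ρ : Representation ℂ G (Fin n → ℂ)), ρ.IsIrreducible ∧ ρ.character = χ}

/-- `Ker(χ)`. -/
def charKer {G : Type*} [Group G] (χ : G → ℂ) : Set G := {g | χ g = χ 1}

/-- `Z(χ)`. -/
def charCenter {G : Type*} [Group G] (χ : G → ℂ) : Set G := {g | (‖χ g‖ : ℂ) = χ 1}

open Classical in
/-- The character of the finite group `G` induced by the character `ψ` of the subgroup `H`. -/
noncomputable def induced {G : Type*} [Group G] (H : Subgroup G) (ψ : H → ℂ) (g : G) : ℂ :=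
  (Nat.card H : ℂ)⁻¹ * ∑ᶠ x : G, if h : x⁻¹ * g * x ∈ H then ψ ⟨x⁻¹ * g * x, h⟩ else 0

/-! ### Single root characters of `UG₂(q)` -/

section Characters

variable (F : Type*) [Field F]

/-- The root kernel `rk(χ)`. -/
noncomputable def rootKernel (χ : U F → ℂ) : Set (Fin 6) := {i | (rootSubgroup F i : Set (U F)) ⊆ charKer χ}

/-- The root center `rz(χ)`. -/
noncomputable def rootCenterChar (χ : U F → ℂ) : Set (Fin 6) :=
  {i | (rootSubgroup F i : Set (U F)) ⊆ charCenter χ}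

/-- The central root support `rs(χ)`. -/
noncomputable def rootSupport (χ : U F → ℂ) : Set (Fin 6) := rootCenterChar F χ \ rootKernel F χ

/-- `Irr(UG₂)_α`, the single root characters lying over `α`. -/
noncomputable def singleRoot (α : Fin 6) : Set (U F → ℂ) := {χ ∈ Irr (U F) | rootSupport F χ = {α}}

/-- The midafis for `α`: the single root characters over `α` of minimal degree. -/
noncomputable def midafi (α : Fin 6) : Set (U F → ℂ) :=
  {χ ∈ singleRoot F α | ∀ ψ ∈ singleRoot F α, (χ 1).re ≤ (ψ 1).re}

/-- The source group `S_α = P(s(α))`. -/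
noncomputable abbrev S (α : Fin 6) : Subgroup (U F) := P F (source α)

/-- `P({α} ∪ ℓ(α) ∪ k(α))` as a subgroup of `S_α`. -/
noncomputable def kerT (α : Fin 6) : Subgroup (S F α) := (P F ({α} ∪ leg α ∪ kSet α)).subgroupOf (S F α)

/-- `P(s(α) \ {α})` as a subgroup of `S_α`. -/
noncomputable def kerX (α : Fin 6) : Subgroup (S F α) := (P F (source α \ {α})).subgroupOf (S F α)

/-- The quotient pattern group `T̄_α`. -/
abbrev TBar (α : Fin 6) : Type _ := S F α ⧸ kerT F α

theorem mem_source (α : Fin 6) : α ∈ source α := by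
  fin_cases α <;> simp [source, arm]

theorem rootSubgroup_le (α : Fin 6) : rootSubgroup F α ≤ S F α :=
  le_iSup₂_of_le α (mem_source α) le_rfl

/-- The natural homomorphism `X_α → S_α / P(s(α) \ {α})`. -/
noncomputable def toQuot (α : Fin 6) [(kerX F α).Normal] : rootSubgroup F α →* S F α ⧸ kerX F α :=
  (QuotientGroup.mk' (kerX F α)).comp (Subgroup.inclusion (rootSubgroup_le F α))

/-- The projection `S_α → S_α / P(s(α) \ {α}) ≅ X_α` along which characters of `X_α` are
inflated. -/
noncomputable def projX (α : Fin 6) [(kerX F α).Normal] (h : Function.Bijective (toQuot F α)) :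
    S F α →* rootSubgroup F α :=
  (MulEquiv.ofBijective (toQuot F α) h).symm.toMonoidHom.comp (QuotientGroup.mk' (kerX F α))

/-- The map `Ψ_α`: the product of the inflations of `μ` and `λ` to `S_α`, induced to `UG₂`. -/
noncomputable def Psi (α : Fin 6) [(kerT F α).Normal] [(kerX F α).Normal]
    (h : Function.Bijective (toQuot F α)) (x : (TBar F α → ℂ) × (rootSubgroup F α → ℂ)) :
    U F → ℂ :=
  induced (S F α) fun s => x.1 (QuotientGroup.mk' (kerT F α) s) * x.2 (projX F α h s)

end Characters

/-- The numbers of midafis for `α₁, …, α₆`. -/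
def midafiCount (q : ℕ) : Fin 6 → ℕ :=
  ![q - 1, q - 1, q - 1, q * (q - 1), q ^ 2 * (q - 1), q * (q - 1)]

/-- The degrees of the midafis for `α₁, …, α₆`. -/
def midafiDegree (q : ℕ) : Fin 6 → ℕ := ![1, 1, q, q, q, q ^ 2]

end UG2

/-!
A coordinate model of the group. In characteristic greater than three every element of `UG₂` is
`exp (m₀ ad e_{α₁})` times the exponential of an element of the span of `e_{α₂}, …, e_{α₆}`,
which is nilpotent of class two. The Baker–Campbell–Hausdorff formula (`expFour_mul_expFour`)
and the conjugation action of `exp (s ad e_{α₁})` (`exp_mul_eq_mul_exp`) turn the product into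
polynomials in six coordinates. This defines the group `Model F`, and `modelEquiv` identifies it
with `UG₂`. The operators determine their coordinates because their values on toral elements do
(`modelEnd_injective`). Pattern subgroups are the coordinate subspaces attached to closed
patterns (`P_eq_map`), so that orders, commutators and conjugates can be read off.

A reduction lemma. Let `X = X_α`, `S = S_α`, `Y = P(ℓ(α) ∪ k(α))` and `K = P(k(α))`. Modulo the
normal subgroup `K` the group `X` is central and `S / Y` is abelian. Conjugation by an element
outside `S` multiplies some `y ∈ Y` by an arbitrary prescribed element of `X`, up to a factor in
`Y`. Every element of `Y` outside `K` is conjugate modulo `K` to its product with any element of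
`X`. These facts (`IsReduction`, proved in `Model.isReduction`) suffice for
`IsReduction.bijOn_induced`: induction is a bijection from the linear characters of `S` trivial
on `Y` and nontrivial on `X` onto the irreducible characters trivial on `K` and nontrivial on
`X`. The property of elements outside `S` makes distinct conjugates of the eigenspace projector
`e_ψ` orthogonal, whence `e_ψ` has rank one and the character is induced by Schur's lemma. The
property of elements of `Y` makes the character vanish on `Y \ K`, so that `Y` has a nonzero
fixed vector, and an eigenvector for the abelian group `S / Y` among the fixed vectors of `Y`
gives `ψ`.

Single root characters. For an irreducible representation with kernel `N` the group `X_β` acts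
by scalars if and only if `[X_β, UG₂] ⊆ N`, and by `Model.forall_comm_gen_mem_iff` this holds if
and only if `N` contains the root subgroups of all roots higher than `β`, where the roots are
ordered as listed and the two simple roots are not compared. Hence `rs(χ) = {α}` means that `χ`
is trivial on `P(k(α))` and nontrivial on `X_α` (`singleRoot_eq`), which is the target of the
reduction lemma.

The source of the reduction lemma is the domain of `Ψ_α`: `S_α` retracts onto `X_α`, and `P({α}
∪ ℓ(α) ∪ k(α)) = X_α Y`, so a linear character of `S_α` trivial on `Y` is uniquely the product
of a linear character of the abelian group `T̄_α` and one of `X_α` (`bijOn_linearChars`). All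
single root characters over `α` therefore have degree `|UG₂ : S_α|`, all of them are midafis,
and their number is `|T̄_α| (q - 1)`.
-/

namespace UG2

/-! ### Complex representations of finite groups -/

section Representations

open Module

variable {G : Type*} [Group G] {V : Type*} [AddCommGroup V] [Module ℂ V]

/-- An operator of finite order whose trace has the largest possible absolute value is a scalar:
its eigenvalues are roots of unity, so they all coincide, and it is diagonalizable. -/
theorem eq_smul_one_of_norm_trace [FiniteDimensional ℂ V] (T : End ℂ V) {m : ℕ} (hm : 0 < m)
    (hT : T ^ m = 1) (h : ‖LinearMap.trace ℂ V T‖ = finrank ℂ V) :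
    ∃ c : ℂ, T = c • 1 ∧ LinearMap.trace ℂ V T = c * finrank ℂ V := by
  rcases subsingleton_or_nontrivial V with hV | hV
  · refine ⟨0, LinearMap.ext fun v => Subsingleton.elim _ _, ?_⟩
    have : finrank ℂ V = 0 := finrank_zero_of_subsingleton
    rw [this] at h ⊢
    simpa using h
  have hn : 0 < finrank ℂ V := finrank_pos
  have hn' : (finrank ℂ V : ℂ) ≠ 0 := by exact_mod_cast hn.ne'
  set n := finrank ℂ V with hn_def
  have hsplit : T.charpoly.Splits := IsAlgClosed.splits _
  have htr := End.trace_eq_sum_roots_charpoly_of_splits hsplit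
  have hcard : T.charpoly.roots.card = n := by
    rw [← hsplit.natDegree_eq_card_roots, LinearMap.charpoly_natDegree]
  have hroot : ∀ r ∈ T.charpoly.roots, ‖r‖ = 1 := by
    intro r hr
    have h1 : T.HasEigenvalue r :=
      (End.hasEigenvalue_iff_isRoot_charpoly T r).2 (Polynomial.isRoot_of_mem_roots hr)
    obtain ⟨v, hv⟩ := h1.exists_hasEigenvector
    have h2 := hv.pow_apply m
    rw [hT, End.one_apply] at h2
    have h3 : (r ^ m - 1) • v = 0 := by rw [sub_smul, one_smul, ← h2, sub_self]
    have h4 : r ^ m = 1 := sub_eq_zero.1 ((smul_eq_zero.1 h3).resolve_right hv.2)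
    exact Complex.norm_eq_one_of_pow_eq_one h4 hm.ne'
  set c : ℂ := LinearMap.trace ℂ V T / n with hc
  have hcn : ‖c‖ = 1 := by
    rw [hc, norm_div, h, Complex.norm_natCast, div_self (by exact_mod_cast hn.ne')]
  have htc : LinearMap.trace ℂ V T = c * n := by rw [hc]; field_simp
  have hcc : starRingEnd ℂ c * c = 1 := by
    rw [mul_comm, Complex.mul_conj, Complex.normSq_eq_norm_sq, hcn]; simp
  -- The real parts of `conj c * r` over the eigenvalues `r` are at most `1` and sum to `n`.
  have hre : ∀ r ∈ T.charpoly.roots, (starRingEnd ℂ c * r).re ≤ 1 := by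
    intro r hr
    refine (Complex.re_le_norm _).trans ?_
    rw [norm_mul, hroot r hr, RCLike.norm_conj, hcn, one_mul]
  have hsum : (T.charpoly.roots.map fun r => 1 - (starRingEnd ℂ c * r).re).sum = 0 := by
    have h5 : (T.charpoly.roots.map fun r => (starRingEnd ℂ c * r).re).sum = n := by
      have h6 : (T.charpoly.roots.map fun r => (starRingEnd ℂ c * r).re).sum =
          (starRingEnd ℂ c * T.charpoly.roots.sum).re := by
        have h6' := Multiset.sum_map_mul_left (s := T.charpoly.roots) (a := starRingEnd ℂ c)
          (f := fun r => r)
        rw [Multiset.map_id'] at h6'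
        rw [← h6', ← Complex.coe_reAddGroupHom, map_multiset_sum, Multiset.map_map]
        rfl
      rw [h6, ← htr, htc, ← mul_assoc, hcc, one_mul, Complex.natCast_re]
    rw [Multiset.sum_map_sub, h5]
    simp [hcard]
  have heq : ∀ r ∈ T.charpoly.roots, r = c := by
    intro r hr
    have h7 : 1 - (starRingEnd ℂ c * r).re = 0 := by
      have h8 := (Multiset.all_zero_of_le_zero_le_of_sum_eq_zero (s := T.charpoly.roots.map
        fun r => 1 - (starRingEnd ℂ c * r).re) (fun x hx => by
          obtain ⟨y, hy, rfl⟩ := Multiset.mem_map.1 hx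
          linarith [hre y hy]) hsum)
      exact h8 _ (Multiset.mem_map_of_mem _ hr)
    have h9 : ‖starRingEnd ℂ c * r‖ = 1 := by
      rw [norm_mul, hroot r hr, RCLike.norm_conj, hcn, one_mul]
    have h10 : starRingEnd ℂ c * r = 1 := by
      have h11 : (starRingEnd ℂ c * r).re = 1 := by linarith
      have h12 := Complex.sq_norm_sub_sq_re (starRingEnd ℂ c * r)
      rw [h9, h11] at h12
      refine Complex.ext (by simpa using h11) ?_
      have h13 : (starRingEnd ℂ c * r).im ^ 2 = 0 := by rw [← h12]; norm_num
      simpa using h13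
    calc r = (starRingEnd ℂ c * c) * r := by rw [hcc, one_mul]
      _ = c * (starRingEnd ℂ c * r) := by ring
      _ = c := by rw [h10, mul_one]
  refine ⟨c, ?_, htc⟩
  have hpoly : T.charpoly = (Polynomial.X - Polynomial.C c) ^ n := by
    have := hsplit.eq_prod_roots_of_monic (LinearMap.charpoly_monic T)
    rw [this, Multiset.eq_replicate.2 ⟨hcard, heq⟩]
    simp
  have hnil : IsNilpotent (T - algebraMap ℂ (End ℂ V) c) := by
    refine ⟨n, ?_⟩
    have := LinearMap.aeval_self_charpoly T
    rw [hpoly] at this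
    simpa using this
  have hss : T.IsSemisimple := by
    refine End.isSemisimple_of_squarefree_aeval_eq_zero (p := Polynomial.X ^ m - 1) ?_ ?_
    · exact ((Polynomial.separable_X_pow_sub_C (1 : ℂ) (by exact_mod_cast hm.ne')
        one_ne_zero).squarefree)
    · simp [hT]
  have := End.eq_zero_of_isNilpotent_isSemisimple hnil
    (End.isSemisimple_sub_algebraMap_iff.2 hss)
  rw [sub_eq_zero] at this
  rw [this, Algebra.algebraMap_eq_smul_one]

/-- The center of a character consists of the elements acting as scalars. -/
theorem mem_charCenter_character_iff [Finite G] [FiniteDimensional ℂ V]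
    (ρ : Representation ℂ G V) (g : G) :
    g ∈ charCenter ρ.character ↔ ∃ c : ℂ, ρ g = c • 1 := by
  have hpow : ρ g ^ Nat.card G = 1 := by rw [← map_pow, pow_card_eq_one', map_one]
  constructor
  · intro h
    have h1 : ((‖ρ.character g‖ : ℝ) : ℂ) = (finrank ℂ V : ℂ) := by
      rw [← Representation.char_one ρ]; exact h
    obtain ⟨c, hc, -⟩ := eq_smul_one_of_norm_trace (ρ g) Nat.card_pos hpow (by exact_mod_cast h1)
    exact ⟨c, hc⟩
  · rintro ⟨c, hc⟩
    change ((‖ρ.character g‖ : ℝ) : ℂ) = ρ.character 1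
    rw [Representation.char_one, Representation.character, hc, map_smul, LinearMap.trace_one,
      smul_eq_mul, norm_mul]
    rcases subsingleton_or_nontrivial V with hV | hV
    · simp [finrank_zero_of_subsingleton]
    · rw [hc, smul_pow, one_pow] at hpow
      obtain ⟨v, hv⟩ := exists_ne (0 : V)
      have h3 := LinearMap.congr_fun hpow v
      rw [LinearMap.smul_apply, End.one_apply] at h3
      have h4 : (c ^ Nat.card G - 1) • v = 0 := by rw [sub_smul, one_smul, h3, sub_self]
      have h5 := sub_eq_zero.1 ((smul_eq_zero.1 h4).resolve_right hv)
      rw [Complex.norm_eq_one_of_pow_eq_one h5 Nat.card_pos.ne']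
      simp

/-- The kernel of a character is the kernel of the representation. -/
theorem mem_charKer_character_iff [Finite G] [FiniteDimensional ℂ V]
    (ρ : Representation ℂ G V) (g : G) : g ∈ charKer ρ.character ↔ ρ g = 1 := by
  have hpow : ρ g ^ Nat.card G = 1 := by rw [← map_pow, pow_card_eq_one', map_one]
  constructor
  · intro h
    have h1 : LinearMap.trace ℂ V (ρ g) = finrank ℂ V := by
      rw [← Representation.char_one ρ]; exact h
    obtain ⟨c, hc, htr⟩ := eq_smul_one_of_norm_trace (ρ g) Nat.card_pos hpow
      (by rw [h1, Complex.norm_natCast])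
    rcases subsingleton_or_nontrivial V with hV | hV
    · exact LinearMap.ext fun v => Subsingleton.elim _ _
    · have hn : (finrank ℂ V : ℂ) ≠ 0 := by exact_mod_cast (finrank_pos (R := ℂ) (M := V)).ne'
      rw [h1] at htr
      have hc1 : c = 1 := mul_right_cancel₀ hn (by rw [← htr, one_mul])
      rw [hc, hc1, one_smul]
  · intro h
    change ρ.character g = ρ.character 1
    rw [Representation.character, Representation.character, h, map_one ρ]

/-- **Schur's lemma**. -/
theorem exists_eq_smul_one_of_commute [FiniteDimensional ℂ V] (ρ : Representation ℂ G V)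
    (hρ : ρ.IsIrreducible) (T : End ℂ V) (hT : ∀ g, T * ρ g = ρ g * T) : ∃ c : ℂ, T = c • 1 := by
  let f : Representation.IntertwiningMap ρ ρ := ⟨T, hT⟩
  obtain ⟨c, hc⟩ :=
    (Representation.IsIrreducible.algebraMap_intertwiningMap_bijective_of_isAlgClosed (ρ := ρ)).2 f
  refine ⟨c, LinearMap.ext fun v => ?_⟩
  exact (DFunLike.congr_fun hc v).symm

/-- An element acts as a scalar on an irreducible representation if and only if it is central
modulo the kernel. -/
theorem exists_eq_smul_one_iff [FiniteDimensional ℂ V] (ρ : Representation ℂ G V)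
    (hρ : ρ.IsIrreducible) (x : G) :
    (∃ c : ℂ, ρ x = c • 1) ↔ ∀ g, x * g * x⁻¹ * g⁻¹ ∈ ρ.ker := by
  have key : ∀ g, x * g * x⁻¹ * g⁻¹ ∈ ρ.ker ↔ ρ x * ρ g = ρ g * ρ x := by
    intro g
    rw [← map_mul, ← map_mul, MonoidHom.mem_ker]
    constructor
    · intro h
      have : x * g = (x * g * x⁻¹ * g⁻¹) * (g * x) := by group
      rw [this, map_mul, h, one_mul]
    · intro h
      have : x * g * x⁻¹ * g⁻¹ = (x * g) * (g * x)⁻¹ := by group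
      rw [this, map_mul, h, ← map_mul, mul_inv_cancel, map_one]
  simp only [key]
  constructor
  · rintro ⟨c, hc⟩ g
    rw [hc, smul_mul_assoc, mul_smul_comm, one_mul, mul_one]
  · intro h
    exact exists_eq_smul_one_of_commute ρ hρ _ h

/-- A vector spanning an invariant line gives a linear character. -/
theorem exists_hom_of_eigenvector (ρ : Representation ℂ G V) {v : V} (hv : v ≠ 0)
    (h : ∀ g, ∃ c : ℂ, ρ g v = c • v) : ∃ ψ : G →* ℂˣ, ∀ g, ρ g v = (ψ g : ℂ) • v := by
  choose c hc using h
  have inj : ∀ a b : ℂ, a • v = b • v → a = b := fun a b hab => smul_left_injective ℂ hv hab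
  let f : G →* ℂ :=
    { toFun := c
      map_one' := inj _ _ (by rw [← hc, map_one, End.one_apply, one_smul])
      map_mul' := fun a b => inj _ _ (by
        rw [← hc, map_mul, End.mul_apply, hc b, map_smul, hc a, smul_smul, mul_comm]) }
  exact ⟨f.toHomUnits, fun g => hc g⟩

/-- Commuting operators have a common eigenvector. -/
theorem exists_common_eigenvector (n : ℕ) : ∀ (V : Type _) [AddCommGroup V] [Module ℂ V]
    [FiniteDimensional ℂ V] [Nontrivial V] (ρ : Representation ℂ G V), finrank ℂ V = n →
    (∀ s t, ρ s * ρ t = ρ t * ρ s) → ∃ v : V, v ≠ 0 ∧ ∀ g, ∃ c : ℂ, ρ g v = c • v := by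
  induction n using Nat.strong_induction_on with
  | _ n ih =>
    intro V _ _ _ _ ρ hn hcomm
    by_cases hs : ∀ s, ∃ c : ℂ, ρ s = c • 1
    · obtain ⟨v, hv⟩ := exists_ne (0 : V)
      refine ⟨v, hv, fun g => ?_⟩
      obtain ⟨c, hc⟩ := hs g
      exact ⟨c, by rw [hc, LinearMap.smul_apply, End.one_apply]⟩
    · push Not at hs
      obtain ⟨s, hs⟩ := hs
      obtain ⟨μ, hμ⟩ := End.exists_eigenvalue (ρ s)
      let E := End.eigenspace (ρ s) μ
      have hE : E ≠ ⊤ := by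
        intro h
        apply hs μ
        refine LinearMap.ext fun v => ?_
        have : v ∈ E := by rw [h]; trivial
        exact End.mem_eigenspace_iff.1 this
      have hinv : ∀ g, ∀ v ∈ E, ρ g v ∈ E := by
        intro g v hv
        rw [End.mem_eigenspace_iff] at hv ⊢
        rw [← End.mul_apply, hcomm, End.mul_apply, hv, map_smul]
      have : Nontrivial E := (Submodule.nontrivial_iff_ne_bot).2 hμ
      obtain ⟨v, hv, h⟩ := ih (finrank ℂ E) (by rw [← hn]; exact Submodule.finrank_lt hE) E
        (ρ.subrepresentation E hinv) rfl (by
          intro a b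
          refine LinearMap.ext fun v => Subtype.ext ?_
          exact LinearMap.congr_fun (hcomm a b) v)
      refine ⟨v, by simpa using hv, fun g => ?_⟩
      obtain ⟨c, hc⟩ := h g
      exact ⟨c, congrArg Subtype.val hc⟩

end Representations

/-! ### Eigenvectors of linear characters of subgroups -/

section Monomial

open Module

variable {G : Type*} [Group G] {V : Type*} [AddCommGroup V] [Module ℂ V]

/-- Transport of a representation with an eigenvector to a space of column vectors. -/
theorem exists_eigenvector_fin [FiniteDimensional ℂ V] (S : Subgroup G) (ψ : S →* ℂˣ)
    (ρ : Representation ℂ G V) (v : V) (hv : v ≠ 0) (h : ∀ s : S, ρ s v = (ψ s : ℂ) • v) :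
    ∃ (ρ : Representation ℂ G (Fin (finrank ℂ V) → ℂ)) (v : Fin (finrank ℂ V) → ℂ),
      v ≠ 0 ∧ ∀ s : S, ρ s v = (ψ s : ℂ) • v := by
  let e := (finBasis ℂ V).equivFun
  refine ⟨(e.conjAlgEquiv ℂ : End ℂ V →* End ℂ _).comp ρ, e v, by simpa using hv, fun s => ?_⟩
  change e (ρ s (e.symm (e v))) = _
  rw [e.symm_apply_apply, h, map_smul]

/-- A linear character `ψ` of a subgroup of a finite group `G` occurs in the restriction of some
irreducible representation of `G`. -/
theorem exists_irreducible_eigenvector [Finite G] (S : Subgroup G) (ψ : S →* ℂˣ) :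
    ∃ (n : ℕ) (ρ : Representation ℂ G (Fin n → ℂ)), ρ.IsIrreducible ∧
      ∃ v, v ≠ 0 ∧ ∀ s : S, ρ s v = (ψ s : ℂ) • v := by
  classical
  let Q : ℕ → Prop := fun n => ∃ (ρ : Representation ℂ G (Fin n → ℂ)) (v : Fin n → ℂ),
      v ≠ 0 ∧ ∀ s : S, ρ s v = (ψ s : ℂ) • v
  have h0 : ∃ n, Q n := by
    have : Fintype G := Fintype.ofFinite G
    let ρ : Representation ℂ G (G → ℂ) :=
      { toFun := fun g => LinearMap.funLeft ℂ ℂ (fun x => g⁻¹ * x)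
        map_one' := by ext; simp [LinearMap.funLeft]
        map_mul' := fun a b => by
          refine LinearMap.ext fun f => funext fun x => ?_
          simp [LinearMap.funLeft, mul_assoc] }
    -- In the left regular representation the function `ψ⁻¹` on `S`, extended by zero, is an
    -- eigenvector.
    refine ⟨_, exists_eigenvector_fin S ψ ρ
      (fun x => if h : x ∈ S then ((ψ ⟨x, h⟩)⁻¹ : ℂˣ) else 0) ?_ ?_⟩
    · intro h
      have := congrFun h 1
      simp [S.one_mem] at this
    · intro s
      funext x
      change (if h : (s : G)⁻¹ * x ∈ S then (((ψ ⟨_, h⟩)⁻¹ : ℂˣ) : ℂ) else 0) =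
        (ψ s : ℂ) * (if h : x ∈ S then (((ψ ⟨x, h⟩)⁻¹ : ℂˣ) : ℂ) else 0)
      by_cases hx : x ∈ S
      · have hx' : (s : G)⁻¹ * x ∈ S := S.mul_mem (S.inv_mem s.2) hx
        rw [dif_pos hx, dif_pos hx']
        have : (⟨(s : G)⁻¹ * x, hx'⟩ : S) = s⁻¹ * ⟨x, hx⟩ := rfl
        rw [this, map_mul, map_inv, mul_inv, inv_inv, Units.val_mul]
      · have hx' : (s : G)⁻¹ * x ∉ S := fun h => hx ((S.mul_mem_cancel_left (S.inv_mem s.2)).1 h)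
        rw [dif_neg hx, dif_neg hx', mul_zero]
  -- A representation of minimal dimension containing an eigenvector is irreducible.
  obtain ⟨ρ, v, hv, h⟩ := Nat.find_spec h0
  refine ⟨Nat.find h0, ρ, ?_, v, hv, h⟩
  have hmin : ∀ m, Q m → Nat.find h0 ≤ m := fun m hm => Nat.find_min' h0 hm
  have hdim : finrank ℂ (Fin (Nat.find h0) → ℂ) = Nat.find h0 := by simp
  refine { exists_pair_ne := ⟨⊥, ⊤, fun hbt => hv ?_⟩, eq_bot_or_eq_top := fun W => ?_ }
  · have : v ∈ (⊥ : Subrepresentation ρ) := by rw [hbt]; trivial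
    exact this
  · by_cases hvW : v ∈ W.toSubmodule
    · right
      have := hmin _ (exists_eigenvector_fin S ψ W.toRepresentation ⟨v, hvW⟩
        (fun h' => hv (congrArg Subtype.val h')) (fun s => Subtype.ext (h s)))
      apply Subrepresentation.toSubmodule_injective
      change W.toSubmodule = ⊤
      refine Submodule.eq_top_of_finrank_eq (le_antisymm (Submodule.finrank_le _) ?_)
      rw [hdim]
      exact this
    · left
      have := hmin _ (exists_eigenvector_fin S ψ (ρ.quotient W.toSubmodule W.apply_mem_toSubmodule)
        (W.toSubmodule.mkQ v) (fun h' => hvW ((Submodule.Quotient.mk_eq_zero _).1 h')) (fun s => by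
          change W.toSubmodule.mkQ (ρ s v) = _
          rw [h, map_smul]))
      have h2 := W.toSubmodule.finrank_quotient_add_finrank
      apply Subrepresentation.toSubmodule_injective
      change W.toSubmodule = ⊥
      rw [← Submodule.finrank_eq_zero (R := ℂ)]
      omega

/-- The projector `|S|⁻¹ ∑ ψ(s)⁻¹ s` onto the vectors on which the subgroup `S` acts by the
linear character `ψ`. -/
noncomputable def eigenProj (ρ : Representation ℂ G V) (S : Subgroup G) (ψ : S →* ℂˣ) :
    End ℂ V := (Nat.card S : ℂ)⁻¹ • ∑ᶠ s : S, (ψ s⁻¹ : ℂ) • ρ s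

section Projector

variable (ρ : Representation ℂ G V) (S : Subgroup G) (ψ : S →* ℂˣ)

theorem eigenProj_eq_sum [Fintype S] :
    eigenProj ρ S ψ = (Nat.card S : ℂ)⁻¹ • ∑ s : S, (ψ s⁻¹ : ℂ) • ρ s := by
  rw [eigenProj, finsum_eq_sum_of_fintype]

theorem apply_mul_eigenProj [Finite G] (s : S) :
    ρ s * eigenProj ρ S ψ = (ψ s : ℂ) • eigenProj ρ S ψ := by
  have : Fintype S := Fintype.ofFinite S
  rw [eigenProj_eq_sum, mul_smul_comm, smul_comm, Finset.mul_sum,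
    Finset.smul_sum (r := (ψ s : ℂ))]
  refine congrArg (fun T : End ℂ V => (Nat.card S : ℂ)⁻¹ • T)
    (Fintype.sum_equiv (Equiv.mulLeft s) _ _ fun t => ?_)
  rw [Equiv.coe_mulLeft, mul_smul_comm, ← map_mul, smul_smul, ← Units.val_mul, ← map_mul,
    mul_inv_rev]
  have h : ψ t⁻¹ = ψ (s * (t⁻¹ * s⁻¹)) := by
    rw [map_mul, map_mul, mul_left_comm, ← map_mul ψ s, mul_inv_cancel, map_one, mul_one]
  rw [h]
  rfl

theorem eigenProj_mul_apply [Finite G] (s : S) :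
    eigenProj ρ S ψ * ρ s = (ψ s : ℂ) • eigenProj ρ S ψ := by
  have : Fintype S := Fintype.ofFinite S
  rw [eigenProj_eq_sum, smul_mul_assoc, smul_comm, Finset.sum_mul,
    Finset.smul_sum (r := (ψ s : ℂ))]
  refine congrArg (fun T : End ℂ V => (Nat.card S : ℂ)⁻¹ • T)
    (Fintype.sum_equiv (Equiv.mulRight s) _ _ fun t => ?_)
  rw [Equiv.coe_mulRight, smul_mul_assoc, ← map_mul, smul_smul, ← Units.val_mul, ← map_mul,
    mul_inv_rev, mul_inv_cancel_left]
  rfl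

theorem eigenProj_apply_of_eigenvector [Finite G] {v : V} (h : ∀ s : S, ρ s v = (ψ s : ℂ) • v) :
    eigenProj ρ S ψ v = v := by
  have : Fintype S := Fintype.ofFinite S
  rw [eigenProj_eq_sum, LinearMap.smul_apply, LinearMap.sum_apply]
  have : ∀ s ∈ Finset.univ, ((ψ s⁻¹ : ℂ) • ρ (s : G)) v = v := by
    intro s _
    rw [LinearMap.smul_apply, h, smul_smul, ← Units.val_mul, ← map_mul, inv_mul_cancel, map_one,
      Units.val_one, one_smul]
  rw [Finset.sum_congr rfl this, Finset.sum_const, Finset.card_univ, ← Nat.card_eq_fintype_card,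
    ← Nat.cast_smul_eq_nsmul ℂ, smul_smul, inv_mul_cancel₀, one_smul]
  exact_mod_cast Nat.card_pos.ne'

theorem isIdempotentElem_eigenProj [Finite G] : IsIdempotentElem (eigenProj ρ S ψ) :=
  LinearMap.ext fun v => eigenProj_apply_of_eigenvector ρ S ψ fun s =>
    LinearMap.congr_fun (apply_mul_eigenProj ρ S ψ s) v

theorem trace_eigenProj [Fintype S] : LinearMap.trace ℂ V (eigenProj ρ S ψ) =
    (Nat.card S : ℂ)⁻¹ * ∑ s : S, (ψ s⁻¹ : ℂ) * ρ.character s := by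
  rw [eigenProj_eq_sum, map_smul, map_sum, smul_eq_mul]
  congr 1
  exact Finset.sum_congr rfl fun s _ => by rw [map_smul, smul_eq_mul]; rfl

theorem eigenProj_ne_zero [Finite G] {v : V} (hv : v ≠ 0) (h : ∀ s : S, ρ s v = (ψ s : ℂ) • v) :
    eigenProj ρ S ψ ≠ 0 := by
  intro h0
  have := eigenProj_apply_of_eigenvector ρ S ψ h
  rw [h0, LinearMap.zero_apply] at this
  exact hv this.symm

end Projector

end Monomial
/-! ### The reduction lemma -/

section Reduction

open Module

variable {G : Type*} [Group G]

/-- Subgroups `K ≤ Y ≤ S` and `X ≤ S` of `G` to which the reduction lemma applies. Modulo the normal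
subgroup `K` of `G` the subgroup `X` is central, `S / Y` is abelian, conjugation by an element
outside `S` moves some element of `Y` by an arbitrary element of `X`, and every element of `Y`
outside `K` is moved by an arbitrary element of `X`. -/
structure IsReduction (S X Y K : Subgroup G) : Prop where
  Y_le : Y ≤ S
  X_le : X ≤ S
  K_le : K ≤ Y
  normal : K.Normal
  comm : ∀ s ∈ S, ∀ t ∈ S, s * t * s⁻¹ * t⁻¹ ∈ Y
  central : ∀ x ∈ X, ∀ g, x * g * x⁻¹ * g⁻¹ ∈ K
  outer : ∀ g, g ∉ S → ∀ z ∈ X, ∃ y ∈ Y, ∃ y' ∈ Y, g * y * g⁻¹ = z * y'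
  inner : ∀ y ∈ Y, y ∉ K → ∀ z ∈ X, ∃ g, ∃ k ∈ K, g * y * g⁻¹ = z * y * k

/-- The linear characters of `S` that are trivial on `Y` and nontrivial on `X`. -/
def linearChars (S X Y : Subgroup G) : Set (S →* ℂˣ) :=
  {ψ | (∀ s : S, (s : G) ∈ Y → ψ s = 1) ∧ ∃ s : S, (s : G) ∈ X ∧ ψ s ≠ 1}

variable {V : Type*} [AddCommGroup V] [Module ℂ V] {S X Y K : Subgroup G}

/-- A normal subgroup fixing a nonzero vector of an irreducible representation acts trivially. -/
theorem apply_eq_one_of_normal (ρ : Representation ℂ G V) (hρ : ρ.IsIrreducible) (hK : K.Normal)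
    {v : V} (hv : v ≠ 0) (h : ∀ k ∈ K, ρ k v = v) : ∀ k ∈ K, ρ k = 1 := by
  let W : Subrepresentation ρ :=
    { toSubmodule := ⨅ k ∈ K, LinearMap.eqLocus (ρ k) 1
      apply_mem_toSubmodule := fun g w hw => by
        simp only [Submodule.mem_iInf, LinearMap.mem_eqLocus, End.one_apply] at hw ⊢
        intro k hk
        have := hw (g⁻¹ * k * g) (by simpa using hK.conj_mem k hk g⁻¹)
        rw [← End.mul_apply, ← map_mul]
        have h2 : k * g = g * (g⁻¹ * k * g) := by group
        rw [h2, map_mul, End.mul_apply, this] }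
  have hW : W = ⊤ := by
    refine (eq_bot_or_eq_top W).resolve_left fun h0 => hv ?_
    have : v ∈ W.toSubmodule := by
      simp only [W, Submodule.mem_iInf, LinearMap.mem_eqLocus, End.one_apply]
      exact h
    rw [h0] at this
    exact this
  intro k hk
  refine LinearMap.ext fun w => ?_
  have : w ∈ W.toSubmodule := by rw [hW]; trivial
  simp only [W, Submodule.mem_iInf, LinearMap.mem_eqLocus] at this
  exact this k hk

/-- The orbit of a nonzero vector spans an irreducible representation. -/
theorem span_orbit_eq_top (ρ : Representation ℂ G V) (hρ : ρ.IsIrreducible) {v : V} (hv : v ≠ 0) :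
    Submodule.span ℂ (Set.range fun g => ρ g v) = ⊤ := by
  let W : Subrepresentation ρ :=
    { toSubmodule := Submodule.span ℂ (Set.range fun g => ρ g v)
      apply_mem_toSubmodule := fun g w hw => by
        refine Submodule.span_induction (p := fun w _ => ρ g w ∈ _) ?_ (by simp)
          (fun a b _ _ ha hb => by rw [map_add]; exact Submodule.add_mem _ ha hb)
          (fun c a _ ha => by rw [map_smul]; exact Submodule.smul_mem _ _ ha) hw
        rintro _ ⟨x, rfl⟩
        refine Submodule.subset_span ⟨g * x, ?_⟩
        change ρ (g * x) v = ρ g (ρ x v)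
        rw [map_mul, End.mul_apply] }
  have hW : W = ⊤ := by
    refine (eq_bot_or_eq_top W).resolve_left fun h0 => hv ?_
    have : v ∈ W.toSubmodule := Submodule.subset_span ⟨1, by simp⟩
    rw [h0] at this
    exact this
  exact congrArg Subrepresentation.toSubmodule hW

namespace IsReduction

variable [Finite G] (h : IsReduction S X Y K) (ρ : Representation ℂ G V)
include h

/-- Elements outside the source send the `ψ`-eigenvectors to vectors without component of type
`ψ'`. -/
theorem eigenProj_mul_mul_eq_zero {ψ ψ' : S →* ℂˣ} (hψ : ψ ∈ linearChars S X Y)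
    (hψ' : ψ' ∈ linearChars S X Y) {g : G} (hg : g ∉ S) :
    eigenProj ρ S ψ' * ρ g * eigenProj ρ S ψ = 0 := by
  obtain ⟨z, hzX, hz⟩ := hψ'.2
  obtain ⟨y, hy, y', hy', hgy⟩ := h.outer g hg z hzX
  have h1 : ρ y * eigenProj ρ S ψ = eigenProj ρ S ψ := by
    have := apply_mul_eigenProj ρ S ψ ⟨y, h.Y_le hy⟩
    rwa [hψ.1 _ hy, Units.val_one, one_smul] at this
  have h2 : eigenProj ρ S ψ' * ρ (z * y') = (ψ' z : ℂ) • eigenProj ρ S ψ' := by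
    have := eigenProj_mul_apply ρ S ψ' (z * ⟨y', h.Y_le hy'⟩)
    rwa [map_mul, hψ'.1 ⟨y', _⟩ hy', mul_one] at this
  have h3 : (ψ' z : ℂ) • (eigenProj ρ S ψ' * ρ g * eigenProj ρ S ψ) =
      eigenProj ρ S ψ' * ρ g * eigenProj ρ S ψ := by
    calc (ψ' z : ℂ) • (eigenProj ρ S ψ' * ρ g * eigenProj ρ S ψ)
        = eigenProj ρ S ψ' * ρ (z * y') * ρ g * eigenProj ρ S ψ := by
          rw [h2, smul_mul_assoc, smul_mul_assoc]
      _ = eigenProj ρ S ψ' * ρ g * (ρ y * eigenProj ρ S ψ) := by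
          rw [← hgy]
          simp only [map_mul, mul_assoc]
          rw [← mul_assoc (ρ g⁻¹), ← map_mul, inv_mul_cancel, map_one, one_mul]
      _ = _ := by rw [h1]
  have h4 : ((ψ' z : ℂ) - 1) • (eigenProj ρ S ψ' * ρ g * eigenProj ρ S ψ) = 0 := by
    rw [sub_smul, h3, one_smul, sub_self]
  refine (smul_eq_zero.1 h4).resolve_left fun h5 => hz (Units.ext ?_)
  rw [Units.val_one]
  exact sub_eq_zero.1 h5

/-- The linear character `ψ` occurs at most once in an irreducible representation. -/
theorem trace_eigenProj_eq_one [FiniteDimensional ℂ V] (hρ : ρ.IsIrreducible) {ψ : S →* ℂˣ}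
    (hψ : ψ ∈ linearChars S X Y) (he : eigenProj ρ S ψ ≠ 0) :
    LinearMap.trace ℂ V (eigenProj ρ S ψ) = 1 := by
  set e := eigenProj ρ S ψ with he_def
  have hidem : e * e = e := isIdempotentElem_eigenProj ρ S ψ
  obtain ⟨w, hw⟩ : ∃ w, e w ≠ 0 := by
    by_contra! h0
    exact he (LinearMap.ext h0)
  have hev : e (e w) = e w := LinearMap.congr_fun hidem w
  have hrange : LinearMap.range e = Submodule.span ℂ {e w} := by
    apply le_antisymm
    · rw [LinearMap.range_eq_map, ← span_orbit_eq_top ρ hρ hw, Submodule.map_span,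
        Submodule.span_le]
      rintro _ ⟨_, ⟨g, rfl⟩, rfl⟩
      change e (ρ g (e w)) ∈ _
      by_cases hg : g ∈ S
      · have h1 := LinearMap.congr_fun (apply_mul_eigenProj ρ S ψ ⟨g, hg⟩) w
        rw [End.mul_apply, LinearMap.smul_apply, ← he_def] at h1
        change ρ g (e w) = _ at h1
        rw [h1, map_smul, hev]
        exact Submodule.smul_mem _ _ (Submodule.mem_span_singleton_self _)
      · have h1 := LinearMap.congr_fun (h.eigenProj_mul_mul_eq_zero ρ hψ hψ hg) w
        rw [← he_def] at h1
        change e (ρ g (e w)) = 0 at h1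
        rw [h1]
        exact Submodule.zero_mem _
    · rw [Submodule.span_singleton_le_iff_mem]
      exact ⟨w, rfl⟩
  rw [(LinearMap.IsIdempotentElem.isProj_range e hidem).trace, hrange, finrank_span_singleton hw,
    Nat.cast_one]

/-- The character of an irreducible representation containing `ψ` is induced from `ψ`: by Schur's
lemma the sum of all conjugates of the projector `eigenProj ρ S ψ` is a scalar. -/
theorem character_eq_induced [FiniteDimensional ℂ V] (hρ : ρ.IsIrreducible) {ψ : S →* ℂˣ}
    (hψ : ψ ∈ linearChars S X Y) (he : eigenProj ρ S ψ ≠ 0) :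
    ρ.character = induced S fun s => (ψ s : ℂ) := by
  classical
  have : Fintype G := Fintype.ofFinite G
  have htr := h.trace_eigenProj_eq_one ρ hρ hψ he
  set e := eigenProj ρ S ψ with he_def
  have hidem : e * e = e := isIdempotentElem_eigenProj ρ S ψ
  have hege : ∀ g, e * ρ g * e = if hg : g ∈ S then (ψ ⟨g, hg⟩ : ℂ) • e else 0 := by
    intro g
    split_ifs with hg
    · have h1 := apply_mul_eigenProj ρ S ψ ⟨g, hg⟩
      rw [← he_def] at h1
      change ρ g * e = _ at h1
      rw [mul_assoc, h1, mul_smul_comm, hidem]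
    · exact h.eigenProj_mul_mul_eq_zero ρ hψ hψ hg
  obtain ⟨c, hc⟩ := exists_eq_smul_one_of_commute ρ hρ (∑ x : G, ρ x * e * ρ x⁻¹) (fun g => by
    rw [Finset.sum_mul, Finset.mul_sum]
    refine (Fintype.sum_equiv (Equiv.mulLeft g) _ _ fun x => ?_).symm
    simp only [Equiv.coe_mulLeft, mul_inv_rev, map_mul, mul_assoc]
    rw [← map_mul ρ g⁻¹, inv_mul_cancel, map_one, mul_one])
  have hcS : c = Nat.card S := by
    have h1 : e * (∑ x : G, ρ x * e * ρ x⁻¹) * e = c • e := by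
      rw [hc, mul_smul_comm, smul_mul_assoc, mul_one, hidem]
    have h2 : e * (∑ x : G, ρ x * e * ρ x⁻¹) * e = (Nat.card S : ℂ) • e := by
      rw [Finset.mul_sum, Finset.sum_mul]
      have h3 : ∀ x ∈ (Finset.univ : Finset G),
          e * (ρ x * e * ρ x⁻¹) * e = if x ∈ S then e else 0 := by
        intro x _
        have h4 : e * (ρ x * e * ρ x⁻¹) * e = (e * ρ x * e) * (e * ρ x⁻¹ * e) := by
          calc e * (ρ x * e * ρ x⁻¹) * e = e * ρ x * e * ρ x⁻¹ * e := by simp only [mul_assoc]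
            _ = e * ρ x * (e * e) * ρ x⁻¹ * e := by rw [hidem]
            _ = _ := by simp only [mul_assoc]
        rw [h4, hege, hege]
        by_cases hx : x ∈ S
        · rw [dif_pos hx, dif_pos (S.inv_mem hx), if_pos hx, smul_mul_smul_comm, hidem,
            ← Units.val_mul, ← map_mul]
          have : (⟨x, hx⟩ : S) * ⟨x⁻¹, S.inv_mem hx⟩ = 1 := Subtype.ext (mul_inv_cancel x)
          rw [this, map_one, Units.val_one, one_smul]
        · rw [dif_neg hx, if_neg hx, zero_mul]
      rw [Finset.sum_congr rfl h3, ← Finset.sum_filter, Finset.sum_const,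
        ← Nat.cast_smul_eq_nsmul ℂ, Nat.card_eq_fintype_card, Fintype.card_subtype]
    have h5 : (c - Nat.card S) • e = 0 := by rw [sub_smul, ← h1, ← h2, sub_self]
    exact sub_eq_zero.1 ((smul_eq_zero.1 h5).resolve_right he)
  have hS0 : (Nat.card S : ℂ) ≠ 0 := by exact_mod_cast Nat.card_pos.ne'
  funext g
  rw [induced, finsum_eq_sum_of_fintype]
  have h6 : (Nat.card S : ℂ) * ρ.character g =
      LinearMap.trace ℂ V (ρ g * ∑ x : G, ρ x * e * ρ x⁻¹) := by
    rw [hc, hcS, mul_smul_comm, mul_one, map_smul, smul_eq_mul]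
    rfl
  rw [eq_inv_mul_iff_mul_eq₀ hS0, h6, Finset.mul_sum, map_sum]
  refine Finset.sum_congr rfl fun x _ => ?_
  have h7 : LinearMap.trace ℂ V (ρ g * (ρ x * e * ρ x⁻¹)) =
      LinearMap.trace ℂ V (e * ρ (x⁻¹ * g * x) * e) := by
    calc LinearMap.trace ℂ V (ρ g * (ρ x * e * ρ x⁻¹))
        = LinearMap.trace ℂ V ((ρ g * ρ x * e) * (e * ρ x⁻¹)) := by
          rw [mul_assoc (ρ g * ρ x), ← mul_assoc e e, hidem]; simp only [mul_assoc]
      _ = LinearMap.trace ℂ V ((e * ρ x⁻¹) * (ρ g * ρ x * e)) := LinearMap.trace_mul_comm _ _ _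
      _ = _ := by simp only [map_mul, mul_assoc]
  rw [h7, hege]
  split_ifs with hx
  · rw [map_smul, htr, smul_eq_mul, mul_one]
  · rw [map_zero]

/-- A character induced from `ψ` is irreducible, with kernel containing `K` but not `X`. -/
theorem induced_mem {ψ : S →* ℂˣ} (hψ : ψ ∈ linearChars S X Y) :
    ∃ (n : ℕ) (ρ : Representation ℂ G (Fin n → ℂ)), ρ.IsIrreducible ∧
      ρ.character = (induced S fun s => (ψ s : ℂ)) ∧ eigenProj ρ S ψ ≠ 0 ∧
      (∀ k ∈ K, ρ k = 1) ∧ ∃ x ∈ X, ρ x ≠ 1 := by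
  obtain ⟨n, ρ, hρ, v, hv, hvS⟩ := exists_irreducible_eigenvector S ψ
  have he := eigenProj_ne_zero ρ S ψ hv hvS
  refine ⟨n, ρ, hρ, h.character_eq_induced ρ hρ hψ he, he, ?_, ?_⟩
  · refine apply_eq_one_of_normal ρ hρ h.normal hv fun k hk => ?_
    have := hvS ⟨k, h.Y_le (h.K_le hk)⟩
    rwa [hψ.1 _ (h.K_le hk), Units.val_one, one_smul] at this
  · obtain ⟨s, hsX, hs⟩ := hψ.2
    refine ⟨s, hsX, fun h1 => hs (Units.ext (smul_left_injective ℂ hv ?_))⟩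
    change (ψ s : ℂ) • v = ((1 : ℂˣ) : ℂ) • v
    rw [← hvS, h1, Units.val_one, one_smul, End.one_apply]

/-- A linear character is determined by its induced character: if `ψ` and `ψ'` occur in the same
irreducible representation, their eigenspaces are not orthogonal. -/
theorem induced_injOn :
    Set.InjOn (fun ψ : S →* ℂˣ => induced S fun s => (ψ s : ℂ)) (linearChars S X Y) := by
  intro ψ hψ ψ' hψ' heq
  have : Fintype S := Fintype.ofFinite S
  obtain ⟨n, ρ, hρ, hχ, he, -⟩ := h.induced_mem hψ
  obtain ⟨n', ρ', hρ', hχ', he', -⟩ := h.induced_mem hψ'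
  have htr := h.trace_eigenProj_eq_one ρ' hρ' hψ' he'
  -- The trace of the projector depends on the character only, so `ψ'` occurs in `ρ` as well.
  have hne : eigenProj ρ S ψ' ≠ 0 := by
    intro h0
    have h1 : ρ'.character = ρ.character := by rw [hχ, hχ']; exact heq.symm
    rw [trace_eigenProj, h1, ← trace_eigenProj, h0, map_zero] at htr
    exact zero_ne_one htr
  obtain ⟨w, hw⟩ : ∃ w, eigenProj ρ S ψ w ≠ 0 := by
    by_contra! h0
    exact he (LinearMap.ext h0)
  obtain ⟨g, hg⟩ : ∃ g, eigenProj ρ S ψ' (ρ g (eigenProj ρ S ψ w)) ≠ 0 := by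
    by_contra! h0
    refine hne (LinearMap.ext fun u => ?_)
    have hu : u ∈ Submodule.span ℂ (Set.range fun g => ρ g (eigenProj ρ S ψ w)) := by
      rw [span_orbit_eq_top ρ hρ hw]; trivial
    have hle : Submodule.span ℂ (Set.range fun g => ρ g (eigenProj ρ S ψ w)) ≤
        LinearMap.ker (eigenProj ρ S ψ') := by
      rw [Submodule.span_le]
      rintro _ ⟨g, rfl⟩
      exact h0 g
    exact hle hu
  have hgS : g ∈ S := by
    by_contra hgS
    exact hg (LinearMap.congr_fun (h.eigenProj_mul_mul_eq_zero ρ hψ hψ' hgS) w)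
  have hne2 : eigenProj ρ S ψ' * eigenProj ρ S ψ ≠ 0 := by
    intro h0
    apply hg
    have h1 := LinearMap.congr_fun (apply_mul_eigenProj ρ S ψ ⟨g, hgS⟩) w
    change ρ g (eigenProj ρ S ψ w) = _ at h1
    rw [h1, LinearMap.smul_apply, map_smul]
    have h2 := LinearMap.congr_fun h0 w
    change eigenProj ρ S ψ' (eigenProj ρ S ψ w) = 0 at h2
    rw [h2, smul_zero]
  refine MonoidHom.ext fun s => Units.ext ?_
  have h3 : eigenProj ρ S ψ' * ρ s * eigenProj ρ S ψ =
      (ψ s : ℂ) • (eigenProj ρ S ψ' * eigenProj ρ S ψ) := by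
    rw [mul_assoc, apply_mul_eigenProj, mul_smul_comm]
  rw [eigenProj_mul_apply, smul_mul_assoc] at h3
  exact (smul_left_injective ℂ hne2 h3).symm

/-- An irreducible representation trivial on `K` and not on `X` contains a linear character of `S`
trivial on `Y`: its character vanishes on `Y` outside `K`, so `Y` has a nonzero fixed vector, and
the abelian group `S / Y` acts on the space of all these vectors. -/
theorem exists_eigenProj_ne_zero [FiniteDimensional ℂ V] (hρ : ρ.IsIrreducible)
    (hK : ∀ k ∈ K, ρ k = 1) (hX : ∃ x ∈ X, ρ x ≠ 1) :
    ∃ ψ ∈ linearChars S X Y, eigenProj ρ S ψ ≠ 0 := by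
  classical
  have : Fintype Y := Fintype.ofFinite Y
  obtain ⟨x, hxX, hx⟩ := hX
  obtain ⟨c, hc⟩ := (exists_eq_smul_one_iff ρ hρ x).2 fun g => hK _ (h.central x hxX g)
  have hc1 : c ≠ 1 := fun h1 => hx (by rw [hc, h1, one_smul])
  have : Nontrivial V := by
    rw [← not_subsingleton_iff_nontrivial]
    intro hV
    exact hx (LinearMap.ext fun v => Subsingleton.elim _ _)
  have hvanish : ∀ y ∈ Y, y ∉ K → ρ.character y = 0 := by
    intro y hy hyK
    obtain ⟨g, k, hk, hg⟩ := h.inner y hy hyK x hxX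
    have h1 := Representation.char_conj ρ y g
    change LinearMap.trace ℂ V _ = ρ.character y at h1
    rw [hg, map_mul ρ, map_mul ρ, hK k hk, hc, mul_one, smul_mul_assoc, one_mul, map_smul,
      smul_eq_mul] at h1
    change c * ρ.character y = ρ.character y at h1
    have h2 : (1 - c) * ρ.character y = 0 := by rw [sub_mul, one_mul, h1, sub_self]
    exact (mul_eq_zero.1 h2).resolve_left (sub_ne_zero.2 hc1.symm)
  have hY0 : eigenProj ρ Y 1 ≠ 0 := by
    intro h0
    have h1 := trace_eigenProj ρ Y 1
    rw [h0, map_zero, eq_comm, mul_eq_zero] at h1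
    have h2 := h1.resolve_left (inv_ne_zero (by exact_mod_cast Nat.card_pos.ne'))
    have h3 : ∀ y ∈ (Finset.univ : Finset Y), (((1 : Y →* ℂˣ) y⁻¹ : ℂˣ) : ℂ) * ρ.character y =
        if (y : G) ∈ K then (finrank ℂ V : ℂ) else 0 := by
      intro y _
      rw [MonoidHom.one_apply, Units.val_one, one_mul]
      split_ifs with hy
      · rw [Representation.character, hK _ hy, LinearMap.trace_one]
      · exact hvanish _ y.2 hy
    rw [Finset.sum_congr rfl h3, ← Finset.sum_filter, Finset.sum_const, nsmul_eq_mul,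
      mul_eq_zero] at h2
    rcases h2 with h2 | h2
    · rw [Nat.cast_eq_zero, Finset.card_eq_zero] at h2
      have : (1 : Y) ∈ Finset.univ.filter fun y : Y => (y : G) ∈ K := by simp [K.one_mem]
      rw [h2] at this
      simp at this
    · exact (finrank_pos (R := ℂ) (M := V)).ne' (by exact_mod_cast h2)
  let W : Submodule ℂ V := ⨅ y ∈ Y, LinearMap.eqLocus (ρ y) 1
  have hW : ∀ w, w ∈ W ↔ ∀ y ∈ Y, ρ y w = w := by
    intro w
    simp only [W, Submodule.mem_iInf, LinearMap.mem_eqLocus, End.one_apply]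
  have hWnt : Nontrivial W := by
    obtain ⟨w, hw⟩ : ∃ w, eigenProj ρ Y 1 w ≠ 0 := by
      by_contra! h0
      exact hY0 (LinearMap.ext h0)
    refine ⟨⟨⟨eigenProj ρ Y 1 w, (hW _).2 fun y hy => ?_⟩, 0,
      fun h0 => hw (congrArg Subtype.val h0)⟩⟩
    have := LinearMap.congr_fun (apply_mul_eigenProj ρ Y 1 ⟨y, hy⟩) w
    rwa [MonoidHom.one_apply, Units.val_one, one_smul] at this
  have hinv : ∀ s : S, ∀ w ∈ W, ρ s w ∈ W := by
    intro s w hw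
    rw [hW] at hw ⊢
    intro y hy
    have h1 : (s : G)⁻¹ * y * s ∈ Y := by
      have := Y.mul_mem (h.comm _ (S.inv_mem s.2) y (h.Y_le hy)) hy
      simpa using this
    rw [← End.mul_apply, ← map_mul]
    have h2 : y * (s : G) = s * ((s : G)⁻¹ * y * s) := by group
    rw [h2, map_mul, End.mul_apply, hw _ h1]
  have hcomm : ∀ s t : S, ∀ w ∈ W, ρ s (ρ t w) = ρ t (ρ s w) := by
    intro s t w hw
    rw [← End.mul_apply, ← End.mul_apply, ← map_mul, ← map_mul]
    have h1 : (s : G) * t = (t * s) * ((s : G)⁻¹ * (t : G)⁻¹ * s * t) := by group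
    rw [h1, map_mul ρ (t * s : G), End.mul_apply]
    congr 1
    have h2 := h.comm _ (S.inv_mem s.2) _ (S.inv_mem t.2)
    simp only [inv_inv] at h2
    exact (hW w).1 hw _ h2
  obtain ⟨v, hv, hvS⟩ := exists_common_eigenvector (finrank ℂ W) W
    (Representation.subrepresentation (ρ.comp S.subtype) W hinv) rfl (fun s t =>
      LinearMap.ext fun w => Subtype.ext (hcomm s t w w.2))
  obtain ⟨ψ, hψ⟩ := exists_hom_of_eigenvector _ hv hvS
  have hv' : (v : V) ≠ 0 := by simpa using hv
  have hψ' : ∀ s : S, ρ s (v : V) = (ψ s : ℂ) • (v : V) := fun s => congrArg Subtype.val (hψ s)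
  refine ⟨ψ, ⟨fun s hs => ?_, ⟨x, h.X_le hxX⟩, hxX, fun h1 => hc1 ?_⟩,
    eigenProj_ne_zero ρ S ψ hv' hψ'⟩
  · refine Units.ext (smul_left_injective ℂ hv' ?_)
    change (ψ s : ℂ) • (v : V) = ((1 : ℂˣ) : ℂ) • (v : V)
    rw [← hψ', (hW _).1 v.2 _ hs, Units.val_one, one_smul]
  · have := hψ' ⟨x, h.X_le hxX⟩
    rw [h1, Units.val_one] at this
    change ρ x v = _ at this
    rw [hc] at this
    exact smul_left_injective ℂ hv' this

/-- **Reduction lemma**. Induction from `S` is a bijection from the linear characters of `S` that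
are trivial on `Y` and nontrivial on `X` onto the irreducible characters of `G` that are trivial on
`K` and nontrivial on `X`. -/
theorem bijOn_induced :
    Set.BijOn (fun ψ : S →* ℂˣ => induced S fun s => (ψ s : ℂ)) (linearChars S X Y)
      {χ ∈ Irr G | (K : Set G) ⊆ charKer χ ∧ ¬(X : Set G) ⊆ charKer χ} := by
  refine ⟨?_, h.induced_injOn, ?_⟩
  · intro ψ hψ
    obtain ⟨n, ρ, hρ, hχ, -, hK, x, hx, hx1⟩ := h.induced_mem hψ
    refine ⟨⟨n, ρ, hρ, hχ⟩, fun k hk => ?_, fun hX => hx1 ?_⟩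
    all_goals dsimp only at *
    · rw [← hχ, mem_charKer_character_iff]
      exact hK k hk
    · rw [← mem_charKer_character_iff, hχ]
      exact hX hx
  · rintro _ ⟨⟨n, ρ, hρ, rfl⟩, hK, hX⟩
    obtain ⟨x, hx, hx1⟩ := Set.not_subset.1 hX
    obtain ⟨ψ, hψ, he⟩ := h.exists_eigenProj_ne_zero ρ hρ
      (fun k hk => (mem_charKer_character_iff ρ k).1 (hK hk))
      ⟨x, hx, fun h1 => hx1 ((mem_charKer_character_iff ρ x).2 h1)⟩
    exact ⟨ψ, hψ, (h.character_eq_induced ρ hρ hψ he).symm⟩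

end IsReduction

end Reduction

/-! ### Exponentials in an associative algebra -/

section Exponentials

variable {F R : Type*} [Field F] [Ring R] [Algebra F R]

/-- The exponential series up to degree four. -/
noncomputable def expFour (F : Type*) {R : Type*} [Field F] [Ring R] [Algebra F R] (A : R) : R :=
  1 + A + (2⁻¹ : F) • A ^ 2 + (6⁻¹ : F) • A ^ 3 + (24⁻¹ : F) • A ^ 4

/-- The Baker–Campbell–Hausdorff formula in class two, for elements `A`, `B` of degree one and
`D = [A, B] / 2` of degree two such that all products of degree at least five vanish. -/
theorem expFour_mul_expFour (h : (6 : F) ≠ 0) (A B D : R) (hBA : B * A = A * B - 2 • D)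
    (hDA : D * A = A * D) (hDB : D * B = B * D)
    (hAB : ∀ i j, i < 5 → j < 5 → 5 ≤ i + j → A ^ i * B ^ j = 0)
    (hD3 : D ^ 3 = 0) (hAD : A * D ^ 2 = 0) (hBD : B * D ^ 2 = 0) (hTD : (A + B) ^ 3 * D = 0) :
    expFour F A * expFour F B = expFour F (A + B + D) := by
  have h2 : (2 : F) ≠ 0 := fun h' => h (by linear_combination 3 * h')
  have h3 : (3 : F) ≠ 0 := fun h' => h (by linear_combination 2 * h')
  have h24 : (24 : F) ≠ 0 := by
    have : (24 : F) = 6 * (2 * 2) := by norm_num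
    rw [this]
    exact mul_ne_zero h (mul_ne_zero h2 h2)
  have hT2 : (A + B) ^ 2 = A ^ 2 + 2 • (A * B) + B ^ 2 - 2 • D := by
    have : (A + B) ^ 2 = A ^ 2 + A * B + B * A + B ^ 2 := by noncomm_ring
    rw [this, hBA]
    noncomm_ring
  have hBBA : B ^ 2 * A = A * B ^ 2 - 4 • (B * D) := by
    rw [pow_two, mul_assoc, hBA, mul_sub, ← mul_assoc, hBA, mul_smul_comm, sub_mul, smul_mul_assoc,
      hDB, mul_assoc]
    module
  have hB3A : B ^ 3 * A = A * B ^ 3 - 6 • (B ^ 2 * D) := by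
    have : B ^ 3 * A = B * (B ^ 2 * A) := by noncomm_ring
    rw [this, hBBA, mul_sub, ← mul_assoc, hBA, sub_mul, mul_smul_comm, smul_mul_assoc]
    have h1 : D * B ^ 2 = B ^ 2 * D := by
      rw [pow_two, ← mul_assoc, hDB, mul_assoc, hDB, mul_assoc]
    rw [h1]
    noncomm_ring
  have hT3 : (A + B) ^ 3 = A ^ 3 + 3 • (A ^ 2 * B) + 3 • (A * B ^ 2) + B ^ 3 - 6 • (A * D) -
      6 • (B * D) := by
    have : (A + B) ^ 3 = (A + B) ^ 2 * (A + B) := by noncomm_ring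
    rw [this, hT2]
    have e1 : (A ^ 2 + 2 • (A * B) + B ^ 2 - 2 • D) * (A + B) = A ^ 3 + A ^ 2 * B +
        2 • (A * (B * A)) + 2 • (A * B ^ 2) + B ^ 2 * A + B ^ 3 - 2 • (D * A) - 2 • (D * B) := by
      noncomm_ring
    rw [e1, hBA, hBBA, hDA, hDB]
    noncomm_ring
  have hT4 : (A + B) ^ 4 = A ^ 4 + 4 • (A ^ 3 * B) + 6 • (A ^ 2 * B ^ 2) + 4 • (A * B ^ 3) + B ^ 4 -
      12 • (A ^ 2 * D) - 24 • (A * (B * D)) - 12 • (B ^ 2 * D) + 12 • D ^ 2 := by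
    have : (A + B) ^ 4 = (A + B) ^ 3 * (A + B) := by noncomm_ring
    rw [this, hT3]
    have e1 : (A ^ 3 + 3 • (A ^ 2 * B) + 3 • (A * B ^ 2) + B ^ 3 - 6 • (A * D) -
      6 • (B * D)) * (A + B) = A ^ 4 + A ^ 3 * B + 3 • (A ^ 2 * (B * A)) + 3 • (A ^ 2 * B ^ 2) +
      3 • (A * (B ^ 2 * A)) + 3 • (A * B ^ 3) + B ^ 3 * A + B ^ 4 - 6 • (A * (D * A)) -
      6 • (A * (D * B)) - 6 • (B * (D * A)) - 6 • (B * (D * B)) := by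
      noncomm_ring
    have e2 : B * (A * D) = A * (B * D) - 2 • D ^ 2 := by
      rw [← mul_assoc, hBA, sub_mul, mul_assoc]
      noncomm_ring
    rw [e1, hBA, hBBA, hB3A, hDA, hDB, e2]
    noncomm_ring
  have hTDc : Commute (A + B) D := by
    change (A + B) * D = D * (A + B)
    rw [add_mul, mul_add, hDA, hDB]
  have hTD2 : (A + B) * D ^ 2 = 0 := by rw [add_mul, hAD, hBD, add_zero]
  have hS2 : (A + B + D) ^ 2 = (A + B) ^ 2 + 2 • ((A + B) * D) + D ^ 2 := by
    rw [hTDc.add_sq]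
    noncomm_ring
  have hT2D2 : (A + B) ^ 2 * D ^ 2 = 0 := by rw [pow_two, mul_assoc, hTD2, mul_zero]
  have hS3 : (A + B + D) ^ 3 = (A + B) ^ 3 + 3 • ((A + B) ^ 2 * D) := by
    have : (A + B + D) ^ 3 = (A + B + D) ^ 2 * (A + B + D) := by noncomm_ring
    rw [this, hS2]
    have c := hTDc.eq
    have h1 : D ^ 2 * (A + B) = 0 := by rw [← hTDc.pow_right 2 |>.eq, hTD2]
    generalize A + B = T at *
    have e1 : (T ^ 2 + 2 • (T * D) + D ^ 2) * (T + D) = T ^ 3 + T ^ 2 * D + 2 • (T * (D * T)) +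
      2 • (T * D ^ 2) + D ^ 2 * T + D ^ 3 := by noncomm_ring
    rw [e1, ← c, hTD2, h1, hD3]
    noncomm_ring
  have hS4 : (A + B + D) ^ 4 = (A + B) ^ 4 := by
    have : (A + B + D) ^ 4 = (A + B + D) ^ 3 * (A + B + D) := by noncomm_ring
    rw [this, hS3]
    have c := hTDc.eq
    generalize A + B = T at *
    have e1 : (T ^ 3 + 3 • (T ^ 2 * D)) * (T + D) = T ^ 4 + T ^ 3 * D + 3 • (T ^ 2 * (D * T)) +
      3 • (T ^ 2 * D ^ 2) := by noncomm_ring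
    have e2 : T ^ 2 * (T * D) = T ^ 3 * D := by noncomm_ring
    rw [e1, ← c, e2, hTD, hT2D2]
    noncomm_ring
  have hT2D : (A + B) ^ 2 * D = A ^ 2 * D + 2 • (A * (B * D)) + B ^ 2 * D - 2 • D ^ 2 := by
    rw [hT2]
    noncomm_ring
  have z := fun i j hi hj hij => hAB i j hi hj hij
  have z14 := z 1 4 (by norm_num) (by norm_num) (by norm_num)
  have z23 := z 2 3 (by norm_num) (by norm_num) (by norm_num)
  have z24 := z 2 4 (by norm_num) (by norm_num) (by norm_num)
  have z32 := z 3 2 (by norm_num) (by norm_num) (by norm_num)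
  have z33 := z 3 3 (by norm_num) (by norm_num) (by norm_num)
  have z34 := z 3 4 (by norm_num) (by norm_num) (by norm_num)
  have z41 := z 4 1 (by norm_num) (by norm_num) (by norm_num)
  have z42 := z 4 2 (by norm_num) (by norm_num) (by norm_num)
  have z43 := z 4 3 (by norm_num) (by norm_num) (by norm_num)
  have z44 := z 4 4 (by norm_num) (by norm_num) (by norm_num)
  rw [pow_one] at z14 z41
  unfold expFour
  rw [hS4, hS3, hS2, hT4, hT2D, hT3, hT2]
  simp only [mul_add, add_mul, smul_mul_assoc, mul_smul_comm, one_mul, mul_one, z14, z23, z24, z32,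
    z33, z34, z41, z42, z43, z44, smul_zero, add_zero]
  match_scalars <;> field_simp <;> norm_num

/-- Conjugation by the exponential of a nilpotent element `N`. Here `A₁, 2 A₂, 6 A₃` are the
iterated commutators of `N` with `A`. -/
theorem exp_mul_eq_mul_exp (h : (6 : F) ≠ 0) (N A A₁ A₂ A₃ : R) (hN : N ^ 4 = 0)
    (h0 : N * A = A * N + A₁) (h1 : N * A₁ = A₁ * N + 2 • A₂) (h2 : N * A₂ = A₂ * N + 3 • A₃)
    (h3 : N * A₃ = A₃ * N) (hA₂ : A₂ * N ^ 3 = 0) (hA₃ : A₃ * N ^ 2 = 0) (s : F) :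
    (1 + s • N + (s ^ 2 * 2⁻¹) • N ^ 2 + (s ^ 3 * 6⁻¹) • N ^ 3) * A =
      (A + s • A₁ + s ^ 2 • A₂ + s ^ 3 • A₃) *
        (1 + s • N + (s ^ 2 * 2⁻¹) • N ^ 2 + (s ^ 3 * 6⁻¹) • N ^ 3) := by
  have h2' : (2 : F) ≠ 0 := fun h' => h (by linear_combination 3 * h')
  have hN2 : N ^ 2 * A = A * N ^ 2 + 2 • (A₁ * N) + 2 • A₂ := by
    rw [pow_two, mul_assoc, h0, mul_add, ← mul_assoc, h0, h1]
    noncomm_ring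
  have hN3 : N ^ 3 * A = A * N ^ 3 + 3 • (A₁ * N ^ 2) + 6 • (A₂ * N) + 6 • A₃ := by
    have e1 : N ^ 3 * A = N * (N ^ 2 * A) := by noncomm_ring
    rw [e1, hN2]
    have e2 : N * (A * N ^ 2 + 2 • (A₁ * N) + 2 • A₂) = (N * A) * N ^ 2 + 2 • (N * A₁ * N) +
      2 • (N * A₂) := by noncomm_ring
    rw [e2, h0, h1, h2]
    noncomm_ring
  have hN4 : 4 • (A₁ * N ^ 3) + 12 • (A₂ * N ^ 2) + 24 • (A₃ * N) = 0 := by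
    have e1 : N ^ 4 * A = N * (N ^ 3 * A) := by noncomm_ring
    rw [hN, zero_mul, hN3] at e1
    have e2 : N * (A * N ^ 3 + 3 • (A₁ * N ^ 2) + 6 • (A₂ * N) + 6 • A₃) = (N * A) * N ^ 3 +
      3 • (N * A₁ * N ^ 2) + 6 • (N * A₂ * N) + 6 • (N * A₃) := by noncomm_ring
    rw [e2, h0, h1, h2, h3] at e1
    have e3 : (A * N + A₁) * N ^ 3 + 3 • ((A₁ * N + 2 • A₂) * N ^ 2) +
      6 • ((A₂ * N + 3 • A₃) * N) + 6 • (A₃ * N) = A * N ^ 4 + (4 • (A₁ * N ^ 3) +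
      12 • (A₂ * N ^ 2) + 24 • (A₃ * N)) := by noncomm_ring
    rw [e3, hN, mul_zero, zero_add] at e1
    exact e1.symm
  have hN4' : (6⁻¹ : F) • (A₁ * N ^ 3) + (2⁻¹ : F) • (A₂ * N ^ 2) + A₃ * N = 0 := by
    have : (6⁻¹ : F) • (A₁ * N ^ 3) + (2⁻¹ : F) • (A₂ * N ^ 2) + A₃ * N =
        (24⁻¹ : F) • (4 • (A₁ * N ^ 3) + 12 • (A₂ * N ^ 2) + 24 • (A₃ * N)) := by
      have h24 : (24 : F) = 6 * (2 * 2) := by norm_num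
      have h6 : (6 : F) = 2 * 3 := by norm_num
      have h3' : (3 : F) ≠ 0 := fun h' => h (by linear_combination 2 * h')
      match_scalars <;> rw [h24, h6] <;> field_simp <;> norm_num
    rw [this, hN4, smul_zero]
  have hA₃' : A₃ * N ^ 3 = 0 := by
    have : A₃ * N ^ 3 = A₃ * N ^ 2 * N := by noncomm_ring
    rw [this, hA₃, zero_mul]
  have key : (A + s • A₁ + s ^ 2 • A₂ + s ^ 3 • A₃) *
        (1 + s • N + (s ^ 2 * 2⁻¹) • N ^ 2 + (s ^ 3 * 6⁻¹) • N ^ 3) -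
      (1 + s • N + (s ^ 2 * 2⁻¹) • N ^ 2 + (s ^ 3 * 6⁻¹) • N ^ 3) * A =
      s ^ 4 • ((6⁻¹ : F) • (A₁ * N ^ 3) + (2⁻¹ : F) • (A₂ * N ^ 2) + A₃ * N) := by
    simp only [mul_add, add_mul, smul_mul_assoc, mul_smul_comm, one_mul, mul_one, hN2, hN3, h0, hA₂,
      hA₃, hA₃', smul_zero, add_zero]
    match_scalars <;> field_simp <;> ring
  rw [hN4', smul_zero, sub_eq_zero] at key
  exact key.symm

end Exponentials

/-! ### Brackets and gradings of the Lie algebra -/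

section LieAlg

variable (F : Type*) [Field F]

local notation "b" => chevalleyBasis F
local notation "adj" => LieAlgebra.ad F (Alg F)

/-- The coefficient of the second simple root `α₂`, which grades the Lie algebra. -/
def longCoeff : Idx → ℤ
  | .inl _ => 0
  | .inr (.inl i) => simpleCoeff i 1
  | .inr (.inr i) => -simpleCoeff i 1

theorem structConst_eq_zero_of_longCoeff :
    ∀ x y z, longCoeff x + longCoeff y ≠ longCoeff z → structConst x y z = 0 := by
  decide +kernel

theorem lie_eq_smul (x y z : Idx) (c : ℤ) (h : ∀ w, structConst x y w = if w = z then c else 0) :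
    ⁅b x, b y⁆ = (c : F) • b z := by
  rw [lie_chevalleyBasis, Finset.sum_eq_single z]
  · rw [h, if_pos rfl]
  · intro w _ hw
    rw [h, if_neg hw, Int.cast_zero, zero_smul]
  · simp

theorem lie_eq_zero (x y : Idx) (h : ∀ w, structConst x y w = 0) : ⁅b x, b y⁆ = 0 := by
  rw [lie_chevalleyBasis]
  exact Finset.sum_eq_zero fun w _ => by rw [h, Int.cast_zero, zero_smul]

theorem chevalleyBasis_apply (x y : Idx) : b x y = if y = x then 1 else 0 := by
  change Pi.basisFun F Idx x y = _
  rw [Pi.basisFun_apply, Pi.single_apply]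

theorem add_apply (v w : Alg F) (x : Idx) : (v + w) x = v x + w x := rfl

theorem smul_apply (c : F) (v : Alg F) (x : Idx) : (c • v) x = c * v x := rfl

theorem sum_smul_chevalleyBasis (v : Alg F) : ∑ x, v x • b x = v := (b).sum_repr v

theorem lie_apply (v w : Alg F) (z : Idx) :
    ⁅v, w⁆ z = ∑ x, ∑ y, v x * w y * (structConst x y z : F) := by
  let p : Alg F →ₗ[F] F := LinearMap.proj (R := F) (φ := fun _ : Idx => F) z
  change p (bracketMap F v w) = _
  conv_lhs => rw [← sum_smul_chevalleyBasis F v, ← sum_smul_chevalleyBasis F w]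
  simp only [map_sum, map_smul, LinearMap.sum_apply, LinearMap.smul_apply, bracketMap_basis]
  have hp : ∀ t, p (b t) = if z = t then 1 else 0 := fun t => chevalleyBasis_apply F t z
  simp only [hp, smul_eq_mul]
  have hs : ∀ x y, ∑ t, (structConst x y t : F) * (if z = t then 1 else 0) = structConst x y z := by
    intro x y
    rw [Finset.sum_eq_single z]
    · rw [if_pos rfl, mul_one]
    · intro t _ ht
      rw [if_neg ht.symm, mul_zero]
    · simp
  simp only [hs]
  rw [Finset.sum_comm]
  refine Finset.sum_congr rfl fun y _ => ?_
  rw [Finset.mul_sum]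
  refine Finset.sum_congr rfl fun x _ => ?_
  ring

/-- The filtration of the Lie algebra by the grading `longCoeff`. -/
def filt (k : ℤ) : Submodule F (Alg F) where
  carrier := {v | ∀ z, longCoeff z < k → v z = 0}
  add_mem' {v w} hv hw z hz := by rw [add_apply, hv z hz, hw z hz, add_zero]
  zero_mem' _ _ := rfl
  smul_mem' c v hv z hz := by rw [smul_apply, hv z hz, mul_zero]

variable {F}

theorem lie_mem_filt {i j : ℤ} {v w : Alg F} (hv : v ∈ filt F i) (hw : w ∈ filt F j) :
    ⁅v, w⁆ ∈ filt F (i + j) := by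
  intro z hz
  rw [lie_apply]
  refine Finset.sum_eq_zero fun x _ => Finset.sum_eq_zero fun y _ => ?_
  by_cases h : longCoeff x + longCoeff y = longCoeff z
  · by_cases hx : longCoeff x < i
    · rw [hv x hx, zero_mul, zero_mul]
    · rw [hw y (by omega), mul_zero, zero_mul]
  · rw [structConst_eq_zero_of_longCoeff x y z h, Int.cast_zero, mul_zero]

theorem mem_filt_neg_two (v : Alg F) : v ∈ filt F (-2) := by
  intro z hz
  have : ∀ z, ¬longCoeff z < -2 := by decide
  exact absurd hz (this z)

theorem eq_zero_of_mem_filt {v : Alg F} (hv : v ∈ filt F 3) : v = 0 := by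
  have : ∀ z, longCoeff z < 3 := by decide
  exact funext fun z => hv z (this z)

/-- Operators raising the filtration by `k`. -/
def Raises (k : ℤ) (T : Module.End F (Alg F)) : Prop := ∀ j, ∀ v ∈ filt F j, T v ∈ filt F (j + k)

theorem Raises.mul {k l : ℤ} {T T' : Module.End F (Alg F)} (h : Raises k T) (h' : Raises l T') :
    Raises (k + l) (T * T') := fun j v hv => by
  have := h _ _ (h' j v hv)
  rwa [add_assoc, add_comm l k] at this

theorem Raises.pow {k : ℤ} {T : Module.End F (Alg F)} (h : Raises k T) (n : ℕ) :
    Raises (n * k) (T ^ n) := by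
  induction n with
  | zero => intro j v hv; simpa using hv
  | succ n ih =>
    rw [pow_succ]
    have := ih.mul h
    rwa [show ((n + 1 : ℕ) : ℤ) * k = n * k + k by push_cast; ring]

theorem Raises.add {k : ℤ} {T T' : Module.End F (Alg F)} (h : Raises k T) (h' : Raises k T') :
    Raises k (T + T') := fun j v hv => Submodule.add_mem _ (h j v hv) (h' j v hv)

theorem Raises.smul {k : ℤ} {T : Module.End F (Alg F)} (h : Raises k T) (c : F) :
    Raises k (c • T) := fun j v hv => Submodule.smul_mem _ c (h j v hv)

/-- The degrees run from `-2` to `2`. -/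
theorem Raises.eq_zero {k : ℤ} {T : Module.End F (Alg F)} (h : Raises k T) (hk : 5 ≤ k) :
    T = 0 := by
  refine LinearMap.ext fun v => eq_zero_of_mem_filt fun z hz => ?_
  exact h _ _ (mem_filt_neg_two v) z (by omega)

theorem raises_ad {k : ℤ} {v : Alg F} (hv : v ∈ filt F k) : Raises k (adj v) := fun j w hw => by
  rw [add_comm]
  exact lie_mem_filt hv hw

variable (F)

theorem ad_mul_pow_eq_zero (i j : Fin 6) (k : ℕ)
    (h : ∀ y z, weight z ≠ weight (.e i) + (weight y + k * weight (.e j))) :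
    adj (b (.e i)) * adj (b (.e j)) ^ k = 0 := by
  refine (b).ext fun y => ?_
  rw [Module.End.mul_apply, LinearMap.zero_apply]
  refine Submodule.span_induction (p := fun v _ => adj (b (.e i)) v = 0) ?_ (map_zero _)
    (fun u v _ _ hu hv => by rw [map_add, hu, hv, add_zero])
    (fun c v _ hv => by rw [map_smul, hv, smul_zero]) (ad_pow_mem F j y k)
  rintro _ ⟨z, hz, rfl⟩
  rw [LieAlgebra.ad_apply]
  refine lie_eq_zero F _ _ fun w => structConst_eq_zero _ _ _ fun hw => h y w ?_
  rw [← hw, hz]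

/-- The nilpotent subalgebra spanned by the root vectors of `α₂, …, α₆`. The coordinate of index
zero is ignored. -/
noncomputable def nilVec (m : Fin 6 → F) : Alg F :=
  m 1 • b (.e 1) + m 2 • b (.e 2) + m 3 • b (.e 3) + m 4 • b (.e 4) + m 5 • b (.e 5)

theorem lie_nilVec (m n : Fin 6 → F) : ⁅nilVec F m, nilVec F n⁆ =
    ((m 1 * n 4 - m 4 * n 1) - 3 * (m 2 * n 3 - m 3 * n 2)) • b (.e 5) := by
  have h11 := lie_eq_zero F (.e 1) (.e 1) (by decide)
  have h12 := lie_eq_zero F (.e 1) (.e 2) (by decide)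
  have h13 := lie_eq_zero F (.e 1) (.e 3) (by decide)
  have h14 := lie_eq_smul F (.e 1) (.e 4) (.e 5) 1 (by decide)
  have h15 := lie_eq_zero F (.e 1) (.e 5) (by decide)
  have h21 := lie_eq_zero F (.e 2) (.e 1) (by decide)
  have h22 := lie_eq_zero F (.e 2) (.e 2) (by decide)
  have h23 := lie_eq_smul F (.e 2) (.e 3) (.e 5) (-3) (by decide)
  have h24 := lie_eq_zero F (.e 2) (.e 4) (by decide)
  have h25 := lie_eq_zero F (.e 2) (.e 5) (by decide)
  have h31 := lie_eq_zero F (.e 3) (.e 1) (by decide)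
  have h32 := lie_eq_smul F (.e 3) (.e 2) (.e 5) 3 (by decide)
  have h33 := lie_eq_zero F (.e 3) (.e 3) (by decide)
  have h34 := lie_eq_zero F (.e 3) (.e 4) (by decide)
  have h35 := lie_eq_zero F (.e 3) (.e 5) (by decide)
  have h41 := lie_eq_smul F (.e 4) (.e 1) (.e 5) (-1) (by decide)
  have h42 := lie_eq_zero F (.e 4) (.e 2) (by decide)
  have h43 := lie_eq_zero F (.e 4) (.e 3) (by decide)
  have h44 := lie_eq_zero F (.e 4) (.e 4) (by decide)
  have h45 := lie_eq_zero F (.e 4) (.e 5) (by decide)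
  have h51 := lie_eq_zero F (.e 5) (.e 1) (by decide)
  have h52 := lie_eq_zero F (.e 5) (.e 2) (by decide)
  have h53 := lie_eq_zero F (.e 5) (.e 3) (by decide)
  have h54 := lie_eq_zero F (.e 5) (.e 4) (by decide)
  have h55 := lie_eq_zero F (.e 5) (.e 5) (by decide)
  simp only [nilVec, add_lie, lie_add, smul_lie, lie_smul, h11, h12, h13, h14, h15, h21, h22, h23,
    h24, h25, h31, h32, h33, h34, h35, h41, h42, h43, h44, h45, h51, h52, h53, h54, h55]
  push_cast
  module

theorem chevalleyBasis_mem_filt (x : Idx) : b x ∈ filt F (longCoeff x) := by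
  intro z hz
  rw [chevalleyBasis_apply, if_neg]
  rintro rfl
  exact lt_irrefl _ hz

theorem nilVec_mem_filt (m : Fin 6 → F) : nilVec F m ∈ filt F 1 := by
  have h : ∀ i : Fin 6, i ≠ 0 → b (.e i) ∈ filt F 1 := by
    intro i hi z hz
    have : ∀ i : Fin 6, i ≠ 0 → 1 ≤ longCoeff (.e i) := by decide
    exact chevalleyBasis_mem_filt F _ z (lt_of_lt_of_le hz (this i hi))
  refine Submodule.add_mem _ (Submodule.add_mem _ (Submodule.add_mem _ (Submodule.add_mem _ ?_ ?_)
    ?_) ?_) ?_ <;> exact Submodule.smul_mem _ _ (h _ (by decide))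

theorem lie_e_zero_nilVec (m : Fin 6 → F) : ⁅b (.e 0), nilVec F m⁆ =
    m 1 • b (.e 2) + (2 * m 2) • b (.e 3) + (3 * m 3) • b (.e 4) := by
  have h1 := lie_eq_smul F (.e 0) (.e 1) (.e 2) 1 (by decide)
  have h2 := lie_eq_smul F (.e 0) (.e 2) (.e 3) 2 (by decide)
  have h3 := lie_eq_smul F (.e 0) (.e 3) (.e 4) 3 (by decide)
  have h4 := lie_eq_zero F (.e 0) (.e 4) (by decide)
  have h5 := lie_eq_zero F (.e 0) (.e 5) (by decide)
  simp only [nilVec, lie_add, lie_smul, h1, h2, h3, h4, h5]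
  push_cast
  module

end LieAlg

/-! ### A coordinate model of `UG₂` -/

/-- Coordinates for `UG₂(F)`: the tuple `m` stands for the product of `exp (m 0 · ad e_{α₁})` and
the exponential of `ad (m 1 · e_{α₂} + ⋯ + m 5 · e_{α₆})`. -/
structure Model (F : Type*) where
  coord : Fin 6 → F

namespace Model

instance (F : Type*) : CoeFun (Model F) fun _ => Fin 6 → F := ⟨coord⟩

@[ext] theorem ext {F : Type*} {m n : Model F} (h0 : m 0 = n 0) (h1 : m 1 = n 1) (h2 : m 2 = n 2)
    (h3 : m 3 = n 3) (h4 : m 4 = n 4) (h5 : m 5 = n 5) : m = n := by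
  obtain ⟨m⟩ := m
  obtain ⟨n⟩ := n
  congr 1
  funext i
  fin_cases i <;> assumption

variable {F : Type*} [Field F]

instance : One (Model F) := ⟨⟨fun _ => 0⟩⟩

/-- The action of `exp (s · ad e_{α₁})` on the coordinates with respect to `e_{α₂}, …, e_{α₆}`. -/
def twist (s : F) (m : Fin 6 → F) : Fin 6 → F :=
  ![m 0, m 1, m 2 + s * m 1, m 3 + 2 * s * m 2 + s ^ 2 * m 1,
    m 4 + 3 * s * m 3 + 3 * s ^ 2 * m 2 + s ^ 3 * m 1, m 5]

/-- Multiplication in class two: `v * w = v + w + [v, w] / 2`. -/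
def bch (v w : Fin 6 → F) : Fin 6 → F :=
  ![v 0 + w 0, v 1 + w 1, v 2 + w 2, v 3 + w 3, v 4 + w 4,
    v 5 + w 5 + 2⁻¹ * ((v 1 * w 4 - v 4 * w 1) - 3 * (v 2 * w 3 - v 3 * w 2))]

instance : Mul (Model F) := ⟨fun m n => ⟨bch (twist (-n 0) m) n⟩⟩

instance : Inv (Model F) := ⟨fun m => ⟨fun i => -twist (m 0) m i⟩⟩

-- The parentheses around `rfl` keep `dsimp` from using these equations, so that the group
-- operations are unfolded only on demand.
theorem one_apply (i : Fin 6) : (1 : Model F) i = 0 := (rfl)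

theorem mul_zero_apply (m n : Model F) : (m * n) 0 = m 0 + n 0 := (rfl)
theorem mul_one_apply (m n : Model F) : (m * n) 1 = m 1 + n 1 := (rfl)
theorem mul_two_apply (m n : Model F) : (m * n) 2 = m 2 + -n 0 * m 1 + n 2 := (rfl)
theorem mul_three_apply (m n : Model F) :
    (m * n) 3 = m 3 + 2 * -n 0 * m 2 + (-n 0) ^ 2 * m 1 + n 3 := (rfl)
theorem mul_four_apply (m n : Model F) : (m * n) 4 =
    m 4 + 3 * -n 0 * m 3 + 3 * (-n 0) ^ 2 * m 2 + (-n 0) ^ 3 * m 1 + n 4 := (rfl)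
theorem mul_five_apply (m n : Model F) : (m * n) 5 = m 5 + n 5 + 2⁻¹ *
    ((m 1 * n 4 - (m 4 + 3 * -n 0 * m 3 + 3 * (-n 0) ^ 2 * m 2 + (-n 0) ^ 3 * m 1) * n 1) -
      3 * ((m 2 + -n 0 * m 1) * n 3 - (m 3 + 2 * -n 0 * m 2 + (-n 0) ^ 2 * m 1) * n 2)) := (rfl)

theorem inv_zero_apply (m : Model F) : m⁻¹ 0 = -m 0 := (rfl)
theorem inv_one_apply (m : Model F) : m⁻¹ 1 = -m 1 := (rfl)
theorem inv_two_apply (m : Model F) : m⁻¹ 2 = -(m 2 + m 0 * m 1) := (rfl)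
theorem inv_three_apply (m : Model F) :
    m⁻¹ 3 = -(m 3 + 2 * m 0 * m 2 + m 0 ^ 2 * m 1) := (rfl)
theorem inv_four_apply (m : Model F) :
    m⁻¹ 4 = -(m 4 + 3 * m 0 * m 3 + 3 * m 0 ^ 2 * m 2 + m 0 ^ 3 * m 1) := (rfl)
theorem inv_five_apply (m : Model F) : m⁻¹ 5 = -m 5 := (rfl)

instance : Group (Model F) :=
  Group.ofLeftAxioms
    (fun a b c => by
      ext <;> simp only [mul_zero_apply, mul_one_apply, mul_two_apply, mul_three_apply,
        mul_four_apply, mul_five_apply] <;> ring)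
    (fun a => by
      ext <;> simp only [mul_zero_apply, mul_one_apply, mul_two_apply, mul_three_apply,
        mul_four_apply, mul_five_apply, one_apply] <;> ring)
    (fun a => by
      ext <;> simp only [mul_zero_apply, mul_one_apply, mul_two_apply, mul_three_apply,
        mul_four_apply, mul_five_apply, one_apply, inv_zero_apply, inv_one_apply, inv_two_apply,
        inv_three_apply, inv_four_apply, inv_five_apply] <;> ring)

/-- The coordinates of `x_r(t)` for the positive root `r = α_{i+1}`. -/
def gen (i : Fin 6) (t : F) : Model F := ⟨fun j => if j = i then t else 0⟩

theorem gen_apply (i : Fin 6) (t : F) (j : Fin 6) : gen i t j = if j = i then t else 0 := (rfl)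

/-- Every element is a product of one element from each root subgroup. -/
theorem eq_prod_gen (m : Model F) :
    m = gen 0 (m 0) * gen 1 (m 1) * gen 2 (m 2) * gen 3 (m 3) * gen 4 (m 4) *
      gen 5 (m 5 - 2⁻¹ * (m 1 * m 4 - 3 * (m 2 * m 3))) := by
  have e1 : gen 0 (m 0) * gen 1 (m 1) = ⟨![m 0, m 1, 0, 0, 0, 0]⟩ := by
    ext <;> simp [mul_zero_apply, mul_one_apply, mul_two_apply, mul_three_apply,
        mul_four_apply, mul_five_apply, gen_apply]
  have e2 : (⟨![m 0, m 1, 0, 0, 0, 0]⟩ : Model F) * gen 2 (m 2) =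
      ⟨![m 0, m 1, m 2, 0, 0, 0]⟩ := by
    ext <;> simp [mul_zero_apply, mul_one_apply, mul_two_apply, mul_three_apply,
        mul_four_apply, mul_five_apply, gen_apply]
  have e3 : (⟨![m 0, m 1, m 2, 0, 0, 0]⟩ : Model F) * gen 3 (m 3) =
      ⟨![m 0, m 1, m 2, m 3, 0, -(2⁻¹ * (3 * (m 2 * m 3)))]⟩ := by
    ext <;> simp [mul_zero_apply, mul_one_apply, mul_two_apply, mul_three_apply,
        mul_four_apply, mul_five_apply, gen_apply]
  have e4 : (⟨![m 0, m 1, m 2, m 3, 0, -(2⁻¹ * (3 * (m 2 * m 3)))]⟩ : Model F) * gen 4 (m 4) =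
      ⟨![m 0, m 1, m 2, m 3, m 4, 2⁻¹ * (m 1 * m 4 - 3 * (m 2 * m 3))]⟩ := by
    ext <;> simp [mul_zero_apply, mul_one_apply, mul_two_apply, mul_three_apply,
        mul_four_apply, mul_five_apply, gen_apply]
    ring
  rw [e1, e2, e3, e4]
  ext <;> simp [mul_zero_apply, mul_one_apply, mul_two_apply, mul_three_apply,
        mul_four_apply, mul_five_apply, gen_apply]

end Model

section Iso

open Model

variable (F : Type*) [Field F]

local notation "b" => chevalleyBasis F
local notation "adj" => LieAlgebra.ad F (Alg F)

theorem alg_zero_apply (x : Idx) : (0 : Alg F) x = 0 := rfl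

theorem ad_lie (v w : Alg F) : adj ⁅v, w⁆ = adj v * adj w - adj w * adj v := by
  refine LinearMap.ext fun x => ?_
  simp only [LinearMap.sub_apply, Module.End.mul_apply, LieAlgebra.ad_apply]
  exact lie_lie v w x

theorem expFour_mul_nilVec (h : (6 : F) ≠ 0) (m n : Fin 6 → F) :
    expFour F (adj (nilVec F m)) * expFour F (adj (nilVec F n)) =
      expFour F (adj (nilVec F (bch m n))) := by
  have h2 : (2 : F) ≠ 0 := fun h' => h (by linear_combination 3 * h')
  set v := nilVec F m with hv
  set w := nilVec F n with hw
  have hcent : ∀ k, ⁅⁅v, w⁆, nilVec F k⁆ = 0 := by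
    intro k
    have h0 := lie_nilVec F (gen 5 ((m 1 * n 4 - m 4 * n 1) - 3 * (m 2 * n 3 - m 3 * n 2))) k
    have h1 : nilVec F (gen 5 ((m 1 * n 4 - m 4 * n 1) - 3 * (m 2 * n 3 - m 3 * n 2))) =
        ⁅v, w⁆ := by
      rw [hv, hw, lie_nilVec]
      simp [nilVec, gen_apply]
    rw [h1] at h0
    rw [h0]
    simp [gen_apply]
  have hvf := nilVec_mem_filt F m
  have hwf := nilVec_mem_filt F n
  rw [← hv] at hvf
  rw [← hw] at hwf
  have hA := raises_ad hvf
  have hB := raises_ad hwf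
  have hD : Raises 2 ((2⁻¹ : F) • adj ⁅v, w⁆) := (raises_ad (lie_mem_filt hvf hwf)).smul _
  have hcomm : ∀ k, (2⁻¹ : F) • adj ⁅v, w⁆ * adj (nilVec F k) =
      adj (nilVec F k) * (2⁻¹ : F) • adj ⁅v, w⁆ := by
    intro k
    have h1 := ad_lie F ⁅v, w⁆ (nilVec F k)
    rw [hcent, map_zero, eq_comm, sub_eq_zero] at h1
    rw [smul_mul_assoc, mul_smul_comm, h1]
  rw [expFour_mul_expFour h (adj v) (adj w) ((2⁻¹ : F) • adj ⁅v, w⁆) ?_ (hcomm m) (hcomm n) ?_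
    (hD.pow 3 |>.eq_zero (by norm_num)) ((hA.mul (hD.pow 2)).eq_zero (by norm_num))
    ((hB.mul (hD.pow 2)).eq_zero (by norm_num))
    ((((hA.add hB).pow 3).mul hD).eq_zero (by norm_num))]
  · congr 1
    rw [← map_smul, ← map_add, ← map_add, hv, hw, lie_nilVec]
    congr 1
    simp only [nilVec, bch]
    simp
    module
  · rw [ad_lie, ← Nat.cast_smul_eq_nsmul F, smul_smul]
    push_cast
    rw [mul_inv_cancel₀ h2, one_smul, sub_sub_cancel]
  · intro i j _ _ hij
    exact ((hA.pow i).mul (hB.pow j)).eq_zero (by omega)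

theorem rootExp_eq (i : Fin 6) (t : F) :
    rootExp F i t = 1 + t • adj (b (.e i)) + (t ^ 2 * 2⁻¹) • adj (b (.e i)) ^ 2 +
      (t ^ 3 * 6⁻¹) • adj (b (.e i)) ^ 3 := by
  simp [rootExp, Finset.sum_range_succ, Nat.factorial]

theorem rootExp_eq_expFour (i : Fin 6) (t : F) :
    rootExp F i t = expFour F (adj (t • b (.e i))) := by
  rw [rootExp_eq, expFour, map_smul]
  simp only [smul_pow, ad_pow_four, smul_zero, add_zero, smul_smul]
  simp only [mul_comm]

/-- Conjugation by `exp (s · ad e_{α₁})` acts on `ad e_{α₂}, …, ad e_{α₆}` by `twist s`. -/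
theorem rootExp_zero_mul_ad (h : (6 : F) ≠ 0) (s : F) (m : Fin 6 → F) :
    rootExp F 0 s * adj (nilVec F m) = adj (nilVec F (twist s m)) * rootExp F 0 s := by
  have h2 : (2 : F) ≠ 0 := fun h' => h (by linear_combination 3 * h')
  have hc : ∀ v w : Alg F, adj v * adj w = adj w * adj v + adj ⁅v, w⁆ := by
    intro v w
    rw [ad_lie]
    abel
  have h2' := lie_eq_smul F (.e 0) (.e 2) (.e 3) 2 (by decide)
  have h3' := lie_eq_smul F (.e 0) (.e 3) (.e 4) 3 (by decide)
  have h4' := lie_eq_zero F (.e 0) (.e 4) (by decide)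
  have z3 := ad_mul_pow_eq_zero F 3 0 3 (by decide +kernel)
  have z4 := ad_mul_pow_eq_zero F 4 0 2 (by decide +kernel)
  have z4' : adj (b (.e 4)) * adj (b (.e 0)) ^ 3 = 0 := by
    rw [pow_succ, ← mul_assoc, z4, zero_mul]
  have key := exp_mul_eq_mul_exp h (adj (b (.e 0))) (adj (nilVec F m))
    (adj (m 1 • b (.e 2) + (2 * m 2) • b (.e 3) + (3 * m 3) • b (.e 4)))
    (adj (m 1 • b (.e 3) + (3 * m 2) • b (.e 4))) (adj (m 1 • b (.e 4))) (ad_pow_four F 0)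
    (by rw [hc, lie_e_zero_nilVec])
    (by
      rw [hc, ← map_nsmul]
      congr 2
      simp only [lie_add, lie_smul, h2', h3', h4']
      push_cast
      module)
    (by
      rw [hc, ← map_nsmul]
      congr 2
      simp only [lie_add, lie_smul, h3', h4']
      push_cast
      module)
    (by rw [hc, lie_smul, h4', smul_zero, map_zero, add_zero])
    (by rw [map_add, map_smul, map_smul, add_mul, smul_mul_assoc, smul_mul_assoc, z3, z4',
      smul_zero, smul_zero, add_zero])
    (by rw [map_smul, smul_mul_assoc, z4, smul_zero]) s
  rw [← rootExp_eq] at key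
  rw [key, ← map_smul (adj), ← map_smul (adj), ← map_smul (adj), ← map_add (adj), ← map_add (adj),
    ← map_add (adj)]
  congr 2
  simp only [nilVec, twist]
  simp
  module

theorem rootExp_zero_param (i : Fin 6) : rootExp F i 0 = 1 := by
  simp [rootExp_eq]

theorem expFour_mul_rootExp_zero (h : (6 : F) ≠ 0) (s : F) (m : Fin 6 → F) :
    expFour F (adj (nilVec F m)) * rootExp F 0 s =
      rootExp F 0 s * expFour F (adj (nilVec F (twist (-s) m))) := by
  have h1 : rootExp F 0 s * rootExp F 0 (-s) = 1 := by
    rw [rootExp_add F h, add_neg_cancel, rootExp_zero_param]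
  have h2 : rootExp F 0 (-s) * rootExp F 0 s = 1 := by
    rw [rootExp_add F h, neg_add_cancel, rootExp_zero_param]
  have hA : adj (nilVec F m) * rootExp F 0 s =
      rootExp F 0 s * adj (nilVec F (twist (-s) m)) := by
    have := rootExp_zero_mul_ad F h (-s) m
    calc adj (nilVec F m) * rootExp F 0 s
        = rootExp F 0 s * (rootExp F 0 (-s) * adj (nilVec F m)) * rootExp F 0 s := by
          rw [← mul_assoc, h1, one_mul]
      _ = _ := by rw [this, mul_assoc, mul_assoc, h2, mul_one]
  have hpow : ∀ k : ℕ, adj (nilVec F m) ^ k * rootExp F 0 s =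
      rootExp F 0 s * adj (nilVec F (twist (-s) m)) ^ k := by
    intro k
    induction k with
    | zero => rw [pow_zero, pow_zero, one_mul, mul_one]
    | succ k ih => rw [pow_succ', mul_assoc, ih, ← mul_assoc, hA, mul_assoc, ← pow_succ']
  simp only [expFour, add_mul, mul_add, smul_mul_assoc, mul_smul_comm, one_mul, mul_one, hpow, hA]

/-- The operator with given coordinates. -/
noncomputable def modelEnd (h : (6 : F) ≠ 0) : Model F →* Module.End F (Alg F) where
  toFun m := rootExp F 0 (m 0) * expFour F (adj (nilVec F m))
  map_one' := by
    have h0 : nilVec F (1 : Model F) = 0 := by simp [nilVec, one_apply]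
    rw [one_apply, h0, rootExp_zero_param, map_zero]
    simp [expFour]
  map_mul' m n := by
    rw [mul_zero_apply, ← rootExp_add F h, mul_assoc, mul_assoc, ← mul_assoc (expFour F _),
      expFour_mul_rootExp_zero F h, mul_assoc, expFour_mul_nilVec F h]
    rfl

theorem modelEnd_apply (h : (6 : F) ≠ 0) (m : Model F) :
    modelEnd F h m = rootExp F 0 (m 0) * expFour F (adj (nilVec F m)) := rfl

theorem modelEnd_gen (h : (6 : F) ≠ 0) (i : Fin 6) (t : F) :
    modelEnd F h (gen i t) = rootExp F i t := by
  rw [modelEnd_apply]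
  fin_cases i <;> simp [nilVec, gen_apply, rootExp_eq_expFour, expFour]

/-- The operator determines its coordinates: those at `α₁, …, α₅` appear in the images of toral
elements in degrees at most one, and then the one at `α₆` in degree two. -/
theorem modelEnd_injective (h : (6 : F) ≠ 0) : Function.Injective (modelEnd F h) := by
  have h3 : (3 : F) ≠ 0 := fun h' => h (by linear_combination 2 * h')
  have h2 : (2 : F) ≠ 0 := fun h' => h (by linear_combination 3 * h')
  rw [injective_iff_map_eq_one]
  intro m hm
  rw [modelEnd_apply] at hm
  have hE : expFour F (adj (nilVec F m)) = rootExp F 0 (-m 0) := by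
    calc expFour F (adj (nilVec F m))
        = rootExp F 0 (-m 0) * (rootExp F 0 (m 0) * expFour F (adj (nilVec F m))) := by
          rw [← mul_assoc, rootExp_add F h, neg_add_cancel, rootExp_zero_param, one_mul]
      _ = _ := by rw [hm, mul_one]
  have hA := raises_ad (nilVec_mem_filt F m)
  have hfilt : ∀ x, longCoeff x = 0 → b x ∈ filt F 0 := by
    intro x hx
    have := chevalleyBasis_mem_filt F x
    rwa [hx] at this
  -- Only the terms of degree at most one contribute to the coordinates at roots `β` with
  -- `longCoeff β ≤ 1` of the image of a toral element.
  have hcoord : ∀ (j : Fin 2) (z : Idx), longCoeff z < 2 →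
      (expFour F (adj (nilVec F m)) (b (.h j))) z = b (.h j) z + ⁅nilVec F m, b (.h j)⁆ z := by
    intro j z hz
    have hk : ∀ k : ℕ, 2 ≤ k → ((adj (nilVec F m)) ^ k) (b (.h j)) z = 0 := by
      intro k hk
      have h1 := hA.pow k 0 _ (hfilt (.h j) rfl)
      exact h1 z (by omega)
    simp only [expFour, LinearMap.add_apply, LinearMap.smul_apply, add_apply, smul_apply,
      hk 2 le_rfl, hk 3 (by norm_num), hk 4 (by norm_num), mul_zero, add_zero]
    rfl
  have hlie : ∀ (j : Fin 2) (i : Fin 6),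
      ⁅b (.e i), b (.h j)⁆ = (-cartanInt j i : F) • b (.e i) := by
    intro j i
    have := lie_eq_smul F (.e i) (.h j) (.e i) (-cartanInt j i) (by
      revert i j; decide +kernel)
    rw [this]
    push_cast
    rfl
  have hnil : ∀ j : Fin 2, ⁅nilVec F m, b (.h j)⁆ = nilVec F fun i => -cartanInt j i * m i := by
    intro j
    simp only [nilVec, add_lie, smul_lie, hlie, smul_smul, mul_comm]
  have hval : ∀ (n : Fin 6 → F) (i : Fin 6), nilVec F n (.e i) = if i = 0 then 0 else n i := by
    intro n i
    simp only [nilVec, add_apply, smul_apply, chevalleyBasis_apply]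
    fin_cases i <;> simp
  have hb : ∀ (j : Fin 2) (i : Fin 6), b (.h j) (.e i) = 0 := by
    intro j i
    rw [chevalleyBasis_apply, if_neg (by simp)]
  have m0 : m 0 = 0 := by
    have h1 := hcoord 1 (.e 0) (by decide)
    rw [hE, hnil, hval, if_pos rfl, hb, rootExp_eq] at h1
    have h00 := lie_eq_zero F (.e 0) (.e 0) (by decide)
    have hc : cartanInt 1 0 = -1 := by decide
    simp only [LinearMap.add_apply, LinearMap.smul_apply, pow_succ, pow_zero, one_mul,
      Module.End.mul_apply, Module.End.one_apply, LieAlgebra.ad_apply, hlie, lie_smul, h00,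
      smul_zero, lie_zero, add_zero, add_apply, smul_apply, hb, hc, chevalleyBasis_apply,
      alg_zero_apply] at h1
    simpa using h1
  rw [m0, neg_zero, rootExp_zero_param] at hE
  have hcart : ∀ (j : Fin 2) (i : Fin 6), longCoeff (.e i) < 2 → i ≠ 0 →
      (cartanInt j i : F) * m i = 0 := by
    intro j i hi hi0
    have h1 := hcoord j (.e i) hi
    rw [hE, hnil, hval, if_neg hi0, hb, Module.End.one_apply, hb, zero_add] at h1
    rw [← neg_eq_zero, ← neg_mul]
    exact h1.symm
  have m1 : m 1 = 0 := by
    have h1 := hcart 1 1 (by decide) (by decide)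
    rw [show cartanInt 1 1 = 2 by decide] at h1
    exact (mul_eq_zero.1 h1).resolve_left (by exact_mod_cast h2)
  have m2 : m 2 = 0 := by
    have h1 := hcart 1 2 (by decide) (by decide)
    rwa [show cartanInt 1 2 = 1 by decide, Int.cast_one, one_mul] at h1
  have m3 : m 3 = 0 := by
    have h1 := hcart 0 3 (by decide) (by decide)
    rwa [show cartanInt 0 3 = 1 by decide, Int.cast_one, one_mul] at h1
  have m4 : m 4 = 0 := by
    have h1 := hcart 0 4 (by decide) (by decide)
    rw [show cartanInt 0 4 = 3 by decide] at h1
    exact (mul_eq_zero.1 h1).resolve_left (by exact_mod_cast h3)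
  have m5 : m 5 = 0 := by
    have h1 : nilVec F m = m 5 • b (.e 5) := by simp [nilVec, m1, m2, m3, m4]
    rw [h1, ← rootExp_eq_expFour] at hE
    have h5 := congrFun (LinearMap.congr_fun hE (b (.h 1))) (.e 5)
    have h55 := lie_eq_zero F (.e 5) (.e 5) (by decide)
    have hc : cartanInt 1 5 = 1 := by decide
    rw [rootExp_eq] at h5
    simp only [LinearMap.add_apply, LinearMap.smul_apply, pow_succ, pow_zero, one_mul,
      Module.End.mul_apply, Module.End.one_apply, LieAlgebra.ad_apply, hlie, lie_smul, h55,
      smul_zero, lie_zero, add_zero, add_apply, smul_apply, hb, hc, chevalleyBasis_apply,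
      alg_zero_apply] at h5
    simpa using h5
  ext
  exacts [m0, m1, m2, m3, m4, m5]

/-- The operator with given coordinates as an element of the general linear group. -/
noncomputable def modelUnit (h : (6 : F) ≠ 0) : Model F →* (Module.End F (Alg F))ˣ :=
  (modelEnd F h).toHomUnits

theorem coe_modelUnit (h : (6 : F) ≠ 0) (m : Model F) :
    (modelUnit F h m : Module.End F (Alg F)) = modelEnd F h m := rfl

theorem range_modelUnit (h : (6 : F) ≠ 0) : (modelUnit F h).range = U F := by
  have hgen : ∀ i t, modelUnit F h (gen i t) ∈ U F := fun i t =>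
    Subgroup.subset_closure (Set.mem_iUnion.2 ⟨i, t, modelEnd_gen F h i t⟩)
  apply le_antisymm
  · rintro _ ⟨m, rfl⟩
    rw [eq_prod_gen m]
    simp only [map_mul]
    exact Subgroup.mul_mem _ (Subgroup.mul_mem _ (Subgroup.mul_mem _ (Subgroup.mul_mem _
      (Subgroup.mul_mem _ (hgen _ _) (hgen _ _)) (hgen _ _)) (hgen _ _)) (hgen _ _)) (hgen _ _)
  · rw [U, Subgroup.closure_le]
    intro u hu
    obtain ⟨i, t, ht⟩ := Set.mem_iUnion.1 hu
    exact ⟨gen i t, Units.ext (by rw [coe_modelUnit, modelEnd_gen, ht])⟩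

/-- The isomorphism of the coordinate model with `UG₂(F)`. -/
noncomputable def modelEquiv (h : (6 : F) ≠ 0) : Model F ≃* U F :=
  (MonoidHom.ofInjective (f := modelUnit F h) (fun _ _ hmn =>
    modelEnd_injective F h (congrArg Units.val hmn))).trans
    (MulEquiv.subgroupCongr (range_modelUnit F h))

theorem coe_modelEquiv (h : (6 : F) ≠ 0) (m : Model F) :
    ((modelEquiv F h m : (Module.End F (Alg F))ˣ) : Module.End F (Alg F)) = modelEnd F h m := rfl

end Iso

/-! ### Pattern subgroups in coordinates -/

theorem forall_six {p : Fin 6 → Prop} : (∀ i, p i) ↔ p 0 ∧ p 1 ∧ p 2 ∧ p 3 ∧ p 4 ∧ p 5 := by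
  constructor
  · intro h
    exact ⟨h 0, h 1, h 2, h 3, h 4, h 5⟩
  · rintro ⟨h0, h1, h2, h3, h4, h5⟩ i
    fin_cases i <;> assumption

namespace Model

variable {F : Type*} [Field F]

/-- The elements whose coordinates vanish outside a closed pattern. -/
def patSub (F : Type*) [Field F] (T : Set (Fin 6)) (hT : IsClosedPattern T) :
    Subgroup (Model F) where
  carrier := {m | ∀ i, i ∉ T → m i = 0}
  one_mem' _ _ := rfl
  mul_mem' := by
    intro m n hm hn
    -- Each monomial in a coordinate of the product involves roots whose sum is the root of that
    -- coordinate, so it vanishes if that root is not in `T`.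
    have t2 := fun h0 h1 => hT 0 h0 1 h1 2 (by decide)
    have t3 := fun h0 h2 => hT 0 h0 2 h2 3 (by decide)
    have t4 := fun h0 h3 => hT 0 h0 3 h3 4 (by decide)
    have t5 := fun h1 h4 => hT 1 h1 4 h4 5 (by decide)
    have t5' := fun h2 h3 => hT 2 h2 3 h3 5 (by decide)
    have z : ∀ i j, (i ∈ T → j ∈ T → False) → ∀ x y : Model F, (∀ i, i ∉ T → x i = 0) →
        (∀ i, i ∉ T → y i = 0) → x i * y j = 0 := by
      intro i j hij x y hx hy
      by_cases hi : i ∈ T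
      · rw [hy j (hij hi), mul_zero]
      · rw [hx i hi, zero_mul]
    have z' : ∀ i j k, (i ∈ T → j ∈ T → k ∈ T → False) → n i * m j * n k = 0 := by
      intro i j k hijk
      by_cases hk : k ∈ T
      · rw [z i j (fun hi hj => hijk hi hj hk) n m hn hm, zero_mul]
      · rw [hn k hk, mul_zero]
    intro i hi
    revert i
    rw [forall_six]
    refine ⟨fun hi => ?_, fun hi => ?_, fun hi => ?_, fun hi => ?_, fun hi => ?_, fun hi => ?_⟩
    · rw [mul_zero_apply, hm 0 hi, hn 0 hi, add_zero]
    · rw [mul_one_apply, hm 1 hi, hn 1 hi, add_zero]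
    · have z01 := z 0 1 (fun h0 h1 => hi (t2 h0 h1)) n m hn hm
      rw [mul_two_apply]
      linear_combination hm 2 hi + hn 2 hi - z01
    · have z01 := z 0 1 (fun h0 h1 => hi (t3 h0 (t2 h0 h1))) n m hn hm
      have z02 := z 0 2 (fun h0 h2 => hi (t3 h0 h2)) n m hn hm
      rw [mul_three_apply]
      linear_combination hm 3 hi + hn 3 hi - 2 * z02 + n 0 * z01
    · have z01 := z 0 1 (fun h0 h1 => hi (t4 h0 (t3 h0 (t2 h0 h1)))) n m hn hm
      have z02 := z 0 2 (fun h0 h2 => hi (t4 h0 (t3 h0 h2))) n m hn hm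
      have z03 := z 0 3 (fun h0 h3 => hi (t4 h0 h3)) n m hn hm
      rw [mul_four_apply]
      linear_combination hm 4 hi + hn 4 hi - 3 * z03 + 3 * n 0 * z02 - n 0 ^ 2 * z01
    · have a1 := z 1 4 (fun h1 h4 => hi (t5 h1 h4)) m n hm hn
      have a2 := z 4 1 (fun h4 h1 => hi (t5 h1 h4)) m n hm hn
      have a3 := z' 0 3 1 (fun h0 h3 h1 => hi (t5 h1 (t4 h0 h3)))
      have a4 := z' 0 2 1 (fun h0 h2 h1 => hi (t5 h1 (t4 h0 (t3 h0 h2))))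
      have a5 := z' 0 1 1 (fun h0 h1 _ => hi (t5 h1 (t4 h0 (t3 h0 (t2 h0 h1)))))
      have a6 := z 2 3 (fun h2 h3 => hi (t5' h2 h3)) m n hm hn
      have a7 := z' 0 1 3 (fun h0 h1 h3 => hi (t5' (t2 h0 h1) h3))
      have a8 := z 3 2 (fun h3 h2 => hi (t5' h2 h3)) m n hm hn
      have a9 := z' 0 2 2 (fun h0 h2 _ => hi (t5' h2 (t3 h0 h2)))
      have a10 := z' 0 1 2 (fun h0 _ h2 => hi (t5' h2 (t3 h0 h2)))
      rw [mul_five_apply]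
      linear_combination hm 5 hi + hn 5 hi + 2⁻¹ * (a1 - a2 + 3 * a3 - 3 * n 0 * a4 +
        n 0 ^ 2 * a5 - 3 * a6 + 3 * a7 + 3 * a8 - 6 * a9 + 3 * n 0 * a10)
  inv_mem' := by
    intro m hm
    have t2 := fun h0 h1 => hT 0 h0 1 h1 2 (by decide)
    have t3 := fun h0 h2 => hT 0 h0 2 h2 3 (by decide)
    have t4 := fun h0 h3 => hT 0 h0 3 h3 4 (by decide)
    have z : ∀ i j, (i ∈ T → j ∈ T → False) → m i * m j = 0 := by
      intro i j hij
      by_cases hi : i ∈ T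
      · rw [hm j (hij hi), mul_zero]
      · rw [hm i hi, zero_mul]
    intro i hi
    revert i
    rw [forall_six]
    refine ⟨fun hi => ?_, fun hi => ?_, fun hi => ?_, fun hi => ?_, fun hi => ?_, fun hi => ?_⟩
    · rw [inv_zero_apply, hm 0 hi, neg_zero]
    · rw [inv_one_apply, hm 1 hi, neg_zero]
    · rw [inv_two_apply]
      linear_combination -hm 2 hi - z 0 1 (fun h0 h1 => hi (t2 h0 h1))
    · rw [inv_three_apply]
      linear_combination -hm 3 hi - 2 * z 0 2 (fun h0 h2 => hi (t3 h0 h2)) -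
        m 0 * z 0 1 (fun h0 h1 => hi (t3 h0 (t2 h0 h1)))
    · rw [inv_four_apply]
      linear_combination -hm 4 hi - 3 * z 0 3 (fun h0 h3 => hi (t4 h0 h3)) -
        3 * m 0 * z 0 2 (fun h0 h2 => hi (t4 h0 (t3 h0 h2))) -
        m 0 ^ 2 * z 0 1 (fun h0 h1 => hi (t4 h0 (t3 h0 (t2 h0 h1))))
    · rw [inv_five_apply, hm 5 hi, neg_zero]

theorem mem_patSub {T : Set (Fin 6)} {hT : IsClosedPattern T} {m : Model F} :
    m ∈ patSub F T hT ↔ ∀ i, i ∉ T → m i = 0 := Iff.rfl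

theorem gen_mem_patSub {T : Set (Fin 6)} {hT : IsClosedPattern T} {i : Fin 6} (hi : i ∈ T) (t : F) :
    gen i t ∈ patSub F T hT := by
  intro j hj
  rw [gen_apply, if_neg]
  rintro rfl
  exact hj hi

theorem gen_zero (i : Fin 6) : gen i (0 : F) = 1 := by
  ext <;> simp [gen_apply, one_apply]

/-- The pattern subgroup of a closed pattern is generated by the root subgroups it contains. -/
theorem patSub_le {T : Set (Fin 6)} {hT : IsClosedPattern T} {H : Subgroup (Model F)}
    (h : ∀ i ∈ T, ∀ t, gen i t ∈ H) : patSub F T hT ≤ H := by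
  intro m hm
  rw [mem_patSub] at hm
  have hmem : ∀ i t, (i ∉ T → t = 0) → gen i t ∈ H := by
    intro i t hi
    by_cases hiT : i ∈ T
    · exact h i hiT t
    · rw [hi hiT, gen_zero]
      exact H.one_mem
  rw [eq_prod_gen m]
  refine H.mul_mem (H.mul_mem (H.mul_mem (H.mul_mem (H.mul_mem (hmem 0 _ (hm 0)) (hmem 1 _ (hm 1)))
    (hmem 2 _ (hm 2))) (hmem 3 _ (hm 3))) (hmem 4 _ (hm 4))) (hmem 5 _ fun h5 => ?_)
  have h14 : m 1 * m 4 = 0 := by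
    by_contra hne
    refine h5 (hT 1 ?_ 4 ?_ 5 (by decide)) <;> by_contra hn <;> apply hne <;> rw [hm _ hn] <;> simp
  have h23 : m 2 * m 3 = 0 := by
    by_contra hne
    refine h5 (hT 2 ?_ 3 ?_ 5 (by decide)) <;> by_contra hn <;> apply hne <;> rw [hm _ hn] <;> simp
  rw [hm 5 h5, h14, h23]
  simp

theorem inv_gen (i : Fin 6) (t : F) : (gen i t)⁻¹ = gen i (-t) := by
  fin_cases i <;> ext <;> simp [gen_apply, inv_zero_apply, inv_one_apply, inv_two_apply,
    inv_three_apply, inv_four_apply, inv_five_apply]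

/-- Conjugation of an element of the normal subgroup `m 0 = 0`. -/
theorem conj_eq (h2 : (2 : F) ≠ 0) (g n : Model F) (hn : n 0 = 0) : g * n * g⁻¹ =
    ⟨![0, n 1, n 2 + g 0 * n 1, n 3 + 2 * g 0 * n 2 + g 0 ^ 2 * n 1,
      n 4 + 3 * g 0 * n 3 + 3 * g 0 ^ 2 * n 2 + g 0 ^ 3 * n 1,
      n 5 + (g 1 * n 4 - g 4 * n 1) - 3 * (g 2 * n 3 - g 3 * n 2)]⟩ := by
  rw [mul_inv_eq_iff_eq_mul]
  ext <;> simp only [mul_zero_apply, mul_one_apply, mul_two_apply, mul_three_apply,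
        mul_four_apply, mul_five_apply, hn, Matrix.cons_val]
  case h5 =>
    linear_combination ((g 1 * n 4 - g 4 * n 1) - 3 * (g 2 * n 3 - g 3 * n 2)) *
      inv_mul_cancel₀ h2
  all_goals ring

end Model

/-! ### The reduction data of the six positive roots -/

/-- The sources `s(α)`. -/
def srcTab : Fin 6 → Finset (Fin 6) :=
  ![{0, 1, 2, 3, 4, 5}, {0, 1, 2, 3, 4, 5}, {1, 2, 3, 4, 5}, {1, 2, 3, 4, 5}, {1, 2, 3, 4, 5},
    {0, 3, 4, 5}]

/-- The sets `k(α)`. -/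
def kTab : Fin 6 → Finset (Fin 6) :=
  ![{1, 2, 3, 4, 5}, {0, 2, 3, 4, 5}, {3, 4, 5}, {4, 5}, {5}, ∅]

/-- The sets `ℓ(α) ∪ k(α)`. -/
def legKTab : Fin 6 → Finset (Fin 6) :=
  ![{1, 2, 3, 4, 5}, {0, 2, 3, 4, 5}, {1, 3, 4, 5}, {2, 4, 5}, {3, 5}, {3, 4}]

theorem closed_srcTab (α : Fin 6) : IsClosedPattern (srcTab α) := by
  simp only [IsClosedPattern, Finset.mem_coe]
  revert α
  decide +kernel

theorem closed_kTab (α : Fin 6) : IsClosedPattern (kTab α) := by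
  simp only [IsClosedPattern, Finset.mem_coe]
  revert α
  decide +kernel

theorem closed_legKTab (α : Fin 6) : IsClosedPattern (legKTab α) := by
  simp only [IsClosedPattern, Finset.mem_coe]
  revert α
  decide +kernel

theorem closed_singleton (α : Fin 6) : IsClosedPattern {α} := by
  simp only [IsClosedPattern, Set.mem_singleton_iff, forall_eq]
  revert α
  decide +kernel

namespace Model

variable {F : Type*} [Field F]

theorem gen_add (i : Fin 6) (s t : F) : gen i s * gen i t = gen i (s + t) := by
  fin_cases i <;> ext <;> simp [gen_apply, mul_zero_apply, mul_one_apply, mul_two_apply,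
    mul_three_apply, mul_four_apply, mul_five_apply]

theorem mem_patSub_singleton {α : Fin 6} {x : Model F} :
    x ∈ patSub F {α} (closed_singleton α) ↔ x = gen α (x α) := by
  constructor
  · intro hx
    have : ∀ i, x i = (gen α (x α) : Model F) i := by
      intro i
      rw [gen_apply]
      split_ifs with hi
      · rw [hi]
      · exact hx i hi
    ext <;> exact this _
  · intro hx
    rw [hx]
    exact gen_mem_patSub (Set.mem_singleton α) (x α)

/-- The hypotheses of the reduction lemma in terms of coordinates. -/
theorem isReduction_of (α : Fin 6)
    (hadd : ∀ i, i ∉ legKTab α → ∀ s t : Model F, (∀ i, i ∉ srcTab α → s i = 0) →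
      (∀ i, i ∉ srcTab α → t i = 0) → (s * t) i = s i + t i)
    (hnorm : ∀ k : Model F, (∀ i, i ∉ kTab α → k i = 0) → ∀ g : Model F, ∀ i, i ∉ kTab α →
      (g * k * g⁻¹) i = 0)
    (hcent : ∀ (t : F) (g : Model F), ∀ i, i ∉ kTab α →
      (gen α t * (g * gen α (-t) * g⁻¹) : Model F) i = 0)
    (houter : ∀ g : Model F, (¬∀ i, i ∉ srcTab α → g i = 0) → ∀ c, ∃ y : Model F,
      (∀ i, i ∉ legKTab α → y i = 0) ∧
      ∀ i, i ∉ legKTab α → (gen α (-c) * (g * y * g⁻¹) : Model F) i = 0)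
    (hinner : ∀ y : Model F, (∀ i, i ∉ legKTab α → y i = 0) → (¬∀ i, i ∉ kTab α → y i = 0) →
      ∀ c, ∃ g : Model F, ∀ i, i ∉ kTab α → (y⁻¹ * (gen α (-c) * (g * y * g⁻¹)) : Model F) i = 0) :
    IsReduction (patSub F (srcTab α) (closed_srcTab α)) (patSub F {α} (closed_singleton α))
      (patSub F (legKTab α) (closed_legKTab α)) (patSub F (kTab α) (closed_kTab α)) where
  Y_le m hm i hi := hm i fun h => hi (by
    have : ∀ α, legKTab α ⊆ srcTab α := by decide
    exact this α h)
  X_le m hm i hi := hm i fun h => hi (by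
    have : ∀ α, α ∈ srcTab α := by decide
    rw [Set.mem_singleton_iff.1 h]
    exact this α)
  K_le m hm i hi := hm i fun h => hi (by
    have : ∀ α, kTab α ⊆ legKTab α := by decide
    exact this α h)
  normal := ⟨fun k hk g i hi => hnorm k hk g i hi⟩
  comm s hs t ht := by
    intro i hi
    have hinv : ∀ u ∈ patSub F (srcTab α) (closed_srcTab α), u⁻¹ i = -u i := by
      intro u hu
      have h1 := hadd i hi u u⁻¹ hu (Subgroup.inv_mem _ hu)
      rw [mul_inv_cancel, one_apply] at h1
      exact (neg_eq_of_add_eq_zero_right h1.symm).symm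
    have hs' := Subgroup.inv_mem _ hs
    have ht' := Subgroup.inv_mem _ ht
    have hst := Subgroup.mul_mem _ hs ht
    rw [hadd i hi _ _ (Subgroup.mul_mem _ hst hs') ht', hadd i hi _ _ hst hs', hadd i hi _ _ hs ht,
      hinv s hs, hinv t ht]
    ring
  central x hx g := by
    rw [mem_patSub_singleton.1 hx, inv_gen]
    intro i hi
    have := hcent (x α) g i hi
    simpa only [mul_assoc] using this
  outer g hg z hz := by
    obtain ⟨y, hy, hy'⟩ := houter g hg (z α)
    refine ⟨y, hy, gen α (-z α) * (g * y * g⁻¹), hy', ?_⟩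
    rw [← inv_gen, ← mem_patSub_singleton.1 hz, mul_inv_cancel_left]
  inner y hy hyK z hz := by
    obtain ⟨g, hg⟩ := hinner y hy hyK (z α)
    refine ⟨g, y⁻¹ * (gen α (-z α) * (g * y * g⁻¹)), hg, ?_⟩
    rw [← inv_gen, ← mem_patSub_singleton.1 hz]
    group

/-- Every coordinate of `S_α` outside `ℓ(α) ∪ k(α)` is additive. -/
theorem mul_apply_of_notMem_legKTab (α i : Fin 6) (hi : i ∉ legKTab α) (s t : Model F)
    (hs : ∀ i, i ∉ srcTab α → s i = 0) (ht : ∀ i, i ∉ srcTab α → t i = 0) :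
    (s * t) i = s i + t i := by
  revert i
  fin_cases α <;> simp [forall_six, srcTab] at hs ht <;>
    simp [forall_six, legKTab, mul_zero_apply, mul_one_apply, mul_two_apply, mul_three_apply,
      mul_four_apply, mul_five_apply, hs, ht]

/-- An element outside the source has a nonzero coordinate at some `γ ∈ a(α)`. It moves a suitable
element of `X_{α-γ}`, where `α - γ ∈ ℓ(α)`, by a prescribed element of `X_α`. -/
theorem exists_outer (h : (6 : F) ≠ 0) (α : Fin 6) (g : Model F)
    (hg : ¬∀ i, i ∉ srcTab α → g i = 0) (c : F) : ∃ y : Model F, (∀ i, i ∉ legKTab α → y i = 0) ∧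
      ∀ i, i ∉ legKTab α → (gen α (-c) * (g * y * g⁻¹) : Model F) i = 0 := by
  have h2 : (2 : F) ≠ 0 := fun h' => h (by linear_combination 3 * h')
  have h3 : (3 : F) ≠ 0 := fun h' => h (by linear_combination 2 * h')
  fin_cases α <;> simp [forall_six, srcTab] at hg
  · refine ⟨gen 1 (c / g 0), ?_⟩
    rw [conj_eq h2 _ _ (by simp [gen_apply])]
    simp [forall_six, legKTab, mul_zero_apply, mul_two_apply, gen_apply]
    field_simp
    ring
  · refine ⟨gen 2 (c / (2 * g 0)), ?_⟩
    rw [conj_eq h2 _ _ (by simp [gen_apply])]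
    simp [forall_six, legKTab, mul_zero_apply, mul_one_apply, mul_three_apply, gen_apply]
    field_simp
    ring
  · refine ⟨gen 3 (c / (3 * g 0)), ?_⟩
    rw [conj_eq h2 _ _ (by simp [gen_apply])]
    simp [forall_six, legKTab, mul_zero_apply, mul_one_apply, mul_two_apply, mul_four_apply,
      gen_apply]
    field_simp
    ring
  · by_cases h1 : g 1 = 0
    · have hg2 := hg h1
      refine ⟨gen 3 (-c / (3 * g 2)), ?_⟩
      rw [conj_eq h2 _ _ (by simp [gen_apply])]
      simp [forall_six, legKTab, mul_zero_apply, mul_one_apply, mul_two_apply, mul_five_apply,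
        gen_apply]
      field_simp
      ring
    · refine ⟨gen 4 (c / g 1), ?_⟩
      rw [conj_eq h2 _ _ (by simp [gen_apply])]
      simp [forall_six, legKTab, mul_zero_apply, mul_one_apply, mul_two_apply, mul_five_apply,
        gen_apply]
      field_simp
      ring

/-- An element with a nonzero coordinate at some `β ∈ ℓ(α)` is moved by a suitable element of
`X_{α-β}`, where `α - β ∈ a(α)`, by a prescribed element of `X_α`. -/
theorem exists_inner (h : (6 : F) ≠ 0) (α : Fin 6) (y : Model F)
    (hy : ∀ i, i ∉ legKTab α → y i = 0) (hyK : ¬∀ i, i ∉ kTab α → y i = 0) (c : F) :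
    ∃ g : Model F, ∀ i, i ∉ kTab α → (y⁻¹ * (gen α (-c) * (g * y * g⁻¹)) : Model F) i = 0 := by
  have h2 : (2 : F) ≠ 0 := fun h' => h (by linear_combination 3 * h')
  have h3 : (3 : F) ≠ 0 := fun h' => h (by linear_combination 2 * h')
  fin_cases α <;> simp [forall_six, legKTab] at hy <;> simp [forall_six, kTab, hy] at hyK
  · refine ⟨gen 0 (c / y 1), ?_⟩
    rw [conj_eq h2 _ _ hy.1]
    simp [forall_six, kTab, mul_zero_apply, mul_one_apply, inv_zero_apply, inv_one_apply,
      inv_two_apply, mul_two_apply, gen_apply, hy]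
    field_simp
    ring
  · refine ⟨gen 0 (c / (2 * y 2)), ?_⟩
    rw [conj_eq h2 _ _ hy.1]
    simp [forall_six, kTab, mul_zero_apply, mul_one_apply, inv_zero_apply, inv_one_apply,
      inv_two_apply, inv_three_apply, mul_two_apply, mul_three_apply, gen_apply, hy]
    field_simp
    ring
  · refine ⟨gen 0 (c / (3 * y 3)), ?_⟩
    rw [conj_eq h2 _ _ hy.1]
    simp [forall_six, kTab, mul_zero_apply, mul_one_apply, inv_zero_apply, inv_one_apply,
      inv_two_apply, inv_three_apply, inv_four_apply, mul_two_apply, mul_three_apply,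
      mul_four_apply, gen_apply, hy]
    field_simp
    ring
  · suffices hs : ∃ g : Model F, g * y * g⁻¹ = gen 5 c * y by
      obtain ⟨g, hg⟩ := hs
      refine ⟨g, fun i _ => ?_⟩
      change (y⁻¹ * (gen 5 (-c) * (g * y * g⁻¹)) : Model F) i = 0
      rw [hg, ← inv_gen, inv_mul_cancel_left, inv_mul_cancel, one_apply]
    obtain ⟨y0, y1, y2, y5⟩ := hy
    have hz : gen 5 c * y = ⟨![0, 0, 0, y 3, y 4, c]⟩ := by
      ext <;> simp [mul_zero_apply, mul_one_apply, mul_two_apply, mul_three_apply,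
        mul_four_apply, mul_five_apply, gen_apply, y0, y1, y2, y5]
    rw [hz]
    by_cases h4 : y 4 = 0
    · have hy3 : y 3 ≠ 0 := fun h0 => hyK h0 h4
      refine ⟨gen 2 (-c / (3 * y 3)), ?_⟩
      rw [conj_eq h2 _ _ y0]
      ext <;> simp [gen_apply, y1, y2, y5]
      field_simp
    · refine ⟨gen 1 (c / y 4), ?_⟩
      rw [conj_eq h2 _ _ y0]
      ext <;> simp [gen_apply, y1, y2, y5]
      field_simp

theorem isReduction (h : (6 : F) ≠ 0) (α : Fin 6) :
    IsReduction (patSub F (srcTab α) (closed_srcTab α)) (patSub F {α} (closed_singleton α))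
      (patSub F (legKTab α) (closed_legKTab α)) (patSub F (kTab α) (closed_kTab α)) := by
  have h2 : (2 : F) ≠ 0 := fun h' => h (by linear_combination 3 * h')
  refine isReduction_of α (fun i hi s t => mul_apply_of_notMem_legKTab α i hi s t) ?_ ?_
    (exists_outer h α) (exists_inner h α)
  · fin_cases α <;> simp +contextual [forall_six, kTab, mul_zero_apply, mul_one_apply,
      inv_zero_apply, inv_one_apply, conj_eq h2]
  · fin_cases α <;> simp +contextual [forall_six, kTab, mul_zero_apply, mul_one_apply,
      mul_two_apply, mul_three_apply, mul_four_apply, mul_five_apply,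
      inv_zero_apply, inv_one_apply, conj_eq h2, gen_apply]

end Model

/-! ### Root subgroups that are central modulo a normal subgroup -/

theorem closed_higher (j : Fin 6) : IsClosedPattern {k | j < k ∧ 1 < k} := by
  simp only [IsClosedPattern, Set.mem_ofPred_eq]
  revert j
  decide +kernel

namespace Model

variable {F : Type*} [Field F]

theorem eq_gen_two_mul (n : Model F) (h0 : n 0 = 0) (h1 : n 1 = 0) :
    n = gen 2 (n 2) * gen 3 (n 3) * gen 4 (n 4) * gen 5 (n 5 + 2⁻¹ * 3 * (n 2 * n 3)) := by
  have h := eq_prod_gen n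
  rw [h0, h1, gen_zero, gen_zero, one_mul, one_mul] at h
  have h5 : n 5 - 2⁻¹ * (0 * n 4 - 3 * (n 2 * n 3)) = n 5 + 2⁻¹ * 3 * (n 2 * n 3) := by ring
  rwa [h5] at h

/-- If a normal subgroup contains `X_{α₆}` and elements with an arbitrary coordinate at `α₄` and
no coordinates at lower roots, then it contains `X_{α₅}` and `X_{α₄}`. -/
theorem gen_mem_of_three (h : (6 : F) ≠ 0) (N : Subgroup (Model F)) [hN : N.Normal]
    (h5 : ∀ t, gen 5 t ∈ N)
    (h3 : ∀ t, ∃ n ∈ N, n 0 = 0 ∧ n 1 = 0 ∧ n 2 = 0 ∧ n 3 = t) :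
    (∀ t, gen 3 t ∈ N) ∧ ∀ t, gen 4 t ∈ N := by
  have hh2 : (2 : F) ≠ 0 := fun h' => h (by linear_combination 3 * h')
  have hh3 : (3 : F) ≠ 0 := fun h' => h (by linear_combination 2 * h')
  have h4 : ∀ t, gen 4 t ∈ N := by
    intro t
    obtain ⟨n, hn, n0, n1, n2, n3⟩ := h3 (t / 3)
    have hd := N.mul_mem (hN.conj_mem n hn (gen 0 1)) (N.inv_mem hn)
    rw [conj_eq hh2 _ _ n0] at hd
    set d := (⟨_⟩ : Model F) * n⁻¹ with hd_def
    have e := eq_gen_two_mul d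
      (by simp [hd_def, mul_zero_apply, inv_zero_apply, n0])
      (by simp [hd_def, mul_one_apply, inv_one_apply, n1])
    have d2 : d 2 = 0 := by
      simp [hd_def, mul_two_apply, inv_two_apply, inv_zero_apply, n0, n1, n2]
    have d3 : d 3 = 0 := by
      simp [hd_def, mul_three_apply, inv_three_apply, inv_zero_apply, n0, n1, n2]
    have d4 : d 4 = t := by
      simp [hd_def, mul_four_apply, inv_four_apply, inv_zero_apply, n0, n1, n2, n3, gen_apply]
      field_simp
    rw [d2, d3, d4, gen_zero, gen_zero, one_mul, one_mul] at e
    rw [e] at hd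
    exact (N.mul_mem_cancel_right (h5 _)).1 hd
  refine ⟨fun t => ?_, h4⟩
  obtain ⟨n, hn, n0, n1, n2, n3⟩ := h3 t
  have e := eq_gen_two_mul n n0 n1
  rw [n2, n3, gen_zero, one_mul] at e
  rw [e, N.mul_mem_cancel_right (h5 _), N.mul_mem_cancel_right (h4 _)] at hn
  exact hn

/-- The analogue of `gen_mem_of_three` for the root `α₃`: commutators with `X_{α₁}` produce the
elements needed there. -/
theorem gen_mem_of_two (h : (6 : F) ≠ 0) (N : Subgroup (Model F)) [hN : N.Normal]
    (h5 : ∀ t, gen 5 t ∈ N)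
    (h2 : ∀ t, ∃ n ∈ N, n 0 = 0 ∧ n 1 = 0 ∧ n 2 = t) :
    (∀ t, gen 2 t ∈ N) ∧ (∀ t, gen 3 t ∈ N) ∧ ∀ t, gen 4 t ∈ N := by
  have hh2 : (2 : F) ≠ 0 := fun h' => h (by linear_combination 3 * h')
  obtain ⟨h3, h4⟩ := gen_mem_of_three h N h5 fun t => by
    obtain ⟨n, hn, n0, n1, n2⟩ := h2 (t / 2)
    refine ⟨_, N.mul_mem (hN.conj_mem n hn (gen 0 1)) (N.inv_mem hn), ?_⟩
    rw [conj_eq hh2 _ _ n0]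
    simp [mul_zero_apply, mul_one_apply, mul_two_apply, mul_three_apply, inv_zero_apply,
      inv_one_apply, inv_two_apply, inv_three_apply, n0, n1, n2, gen_apply]
    field_simp
  refine ⟨fun t => ?_, h3, h4⟩
  obtain ⟨n, hn, n0, n1, n2⟩ := h2 t
  have e := eq_gen_two_mul n n0 n1
  rw [n2] at e
  rw [e, N.mul_mem_cancel_right (h5 _), N.mul_mem_cancel_right (h4 _),
    N.mul_mem_cancel_right (h3 _)] at hn
  exact hn

/-- The root subgroup of `α_{j+1}` is central modulo a normal subgroup `N` if and only if `N`
contains all root subgroups of higher roots, except that the two simple roots are not compared. -/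
theorem forall_comm_gen_mem_iff (h : (6 : F) ≠ 0) (N : Subgroup (Model F)) [hN : N.Normal]
    (j : Fin 6) : (∀ t g, gen j t * g * (gen j t)⁻¹ * g⁻¹ ∈ N) ↔
      ∀ k, j < k → 1 < k → ∀ t, gen k t ∈ N := by
  have hh2 : (2 : F) ≠ 0 := fun h' => h (by linear_combination 3 * h')
  have hh3 : (3 : F) ≠ 0 := fun h' => h (by linear_combination 2 * h')
  have hassoc : ∀ (t : F) (g : Model F), gen j t * g * (gen j t)⁻¹ * g⁻¹ =
      gen j t * (g * gen j (-t) * g⁻¹) := fun t g => by rw [inv_gen]; group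
  constructor
  · intro hc
    -- the commutators of `X_j` with `X_i` for `i ≠ 0`
    have hc' : ∀ i : Fin 6, i ≠ 0 → ∀ t s,
        (⟨![0, gen i s 1, gen i s 2 + gen j t 0 * gen i s 1,
          gen i s 3 + 2 * gen j t 0 * gen i s 2 + gen j t 0 ^ 2 * gen i s 1,
          gen i s 4 + 3 * gen j t 0 * gen i s 3 + 3 * gen j t 0 ^ 2 * gen i s 2 +
            gen j t 0 ^ 3 * gen i s 1,
          gen i s 5 + (gen j t 1 * gen i s 4 - gen j t 4 * gen i s 1) -
            3 * (gen j t 2 * gen i s 3 - gen j t 3 * gen i s 2)]⟩ : Model F) * gen i (-s) ∈ N := by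
      intro i hi t s
      have h1 := hc t (gen i s)
      rwa [conj_eq hh2 _ _ (by rw [gen_apply, if_neg (Ne.symm hi)]), inv_gen] at h1
    -- the commutators of `X_j` with `X_0`
    have hc0 : j ≠ 0 → ∀ t, ∃ n ∈ N, n = gen j t * (⟨![0, gen j (-t) 1,
        gen j (-t) 2 + gen j (-t) 1, gen j (-t) 3 + 2 * gen j (-t) 2 + gen j (-t) 1,
        gen j (-t) 4 + 3 * gen j (-t) 3 + 3 * gen j (-t) 2 + gen j (-t) 1, gen j (-t) 5]⟩ :
        Model F) := by
      intro hj t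
      refine ⟨_, hc t (gen 0 1), ?_⟩
      rw [hassoc, conj_eq hh2 _ _ (by rw [gen_apply, if_neg (Ne.symm hj)])]
      simp [gen_apply]
    -- For `i ≠ 0` with `α_{i+1} + α_{j+1} = α₆` these commutators fill `X_{α₆}`.
    have hfive : ∀ i : Fin 6, i ≠ 0 → ∀ c : F, c ≠ 0 →
        (∀ t, (⟨![0, gen i 1 1, gen i 1 2 + gen j t 0 * gen i 1 1,
          gen i 1 3 + 2 * gen j t 0 * gen i 1 2 + gen j t 0 ^ 2 * gen i 1 1,
          gen i 1 4 + 3 * gen j t 0 * gen i 1 3 + 3 * gen j t 0 ^ 2 * gen i 1 2 +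
            gen j t 0 ^ 3 * gen i 1 1,
          gen i 1 5 + (gen j t 1 * gen i 1 4 - gen j t 4 * gen i 1 1) -
            3 * (gen j t 2 * gen i 1 3 - gen j t 3 * gen i 1 2)]⟩ : Model F) * gen i (-1) =
          gen 5 (c * t)) → ∀ t, gen 5 t ∈ N := by
      intro i hi c hc0 heq t
      have h1 := hc' i hi (c⁻¹ * t) 1
      rwa [heq, mul_inv_cancel_left₀ hc0] at h1
    fin_cases j
    · have h4 : ∀ t, ∃ n ∈ N, n = gen 4 t * gen 5 0 := by
        intro t
        refine ⟨_, hc' 3 (by decide) (t / 3) 1, ?_⟩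
        ext <;> simp [mul_zero_apply, mul_one_apply, mul_two_apply, mul_three_apply,
          mul_four_apply, mul_five_apply, gen_apply]
        field_simp
      have h4' : ∀ t, gen 4 t ∈ N := by
        intro t
        obtain ⟨n, hn, e⟩ := h4 t
        rwa [e, gen_zero, mul_one] at hn
      have h5 : ∀ t, gen 5 t ∈ N := by
        intro t
        have h1 := N.mul_mem (hN.conj_mem _ (h4' 1) (gen 1 t)) (N.inv_mem (h4' 1))
        rw [conj_eq hh2 _ _ (by simp [gen_apply]), inv_gen] at h1
        convert h1 using 1
        ext <;> simp [mul_zero_apply, mul_one_apply, mul_two_apply, mul_three_apply,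
          mul_four_apply, mul_five_apply, gen_apply]
      obtain ⟨h2, h3, h4⟩ := gen_mem_of_two h N h5 fun t =>
        ⟨_, hc' 1 (by decide) t 1,
          by simp [mul_zero_apply, mul_one_apply, mul_two_apply, gen_apply]⟩
      rw [forall_six]
      simp [h2, h3, h4, h5]
    · have h5 := hfive 4 (by decide) 1 one_ne_zero (fun t => by
        ext <;> simp [mul_zero_apply, mul_one_apply, mul_two_apply, mul_three_apply,
          mul_four_apply, mul_five_apply, gen_apply])
      obtain ⟨h2, h3, h4⟩ := gen_mem_of_two h N h5 fun t => by
        obtain ⟨n, hn, e⟩ := hc0 (by decide) (-t)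
        refine ⟨n, hn, ?_⟩
        rw [e]
        simp [mul_zero_apply, mul_one_apply, mul_two_apply, gen_apply]
      rw [forall_six]
      simp [h2, h3, h4, h5]
    · have h5 := hfive 3 (by decide) (-3) (neg_ne_zero.2 hh3) (fun t => by
        ext <;> simp [mul_zero_apply, mul_one_apply, mul_two_apply, mul_three_apply,
          mul_four_apply, mul_five_apply, gen_apply])
      obtain ⟨h3, h4⟩ := gen_mem_of_three h N h5 fun t => by
        obtain ⟨n, hn, e⟩ := hc0 (by decide) (-t / 2)
        refine ⟨n, hn, ?_⟩
        rw [e]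
        simp [mul_zero_apply, mul_one_apply, mul_two_apply, mul_three_apply, gen_apply]
        field_simp
      rw [forall_six]
      simp [h3, h4, h5]
    · have h5 := hfive 2 (by decide) 3 hh3 (fun t => by
        ext <;> simp [mul_zero_apply, mul_one_apply, mul_two_apply, mul_three_apply,
          mul_four_apply, mul_five_apply, gen_apply])
      have h4 : ∀ t, gen 4 t ∈ N := by
        intro t
        obtain ⟨n, hn, e⟩ := hc0 (by decide) (-t / 3)
        convert hn using 1
        rw [e]
        ext <;> simp [mul_zero_apply, mul_one_apply, mul_two_apply, mul_three_apply,
          mul_four_apply, mul_five_apply, gen_apply]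
        field_simp
      rw [forall_six]
      simp [h4, h5]
    · have h5 := hfive 1 (by decide) (-1) (neg_ne_zero.2 one_ne_zero) (fun t => by
        ext <;> simp [mul_zero_apply, mul_one_apply, mul_two_apply, mul_three_apply,
          mul_four_apply, mul_five_apply, gen_apply])
      rw [forall_six]
      simp [h5]
    · rw [forall_six]
      simp
  · intro hk t g
    refine patSub_le (hT := closed_higher j) (fun k hk' => hk k hk'.1 hk'.2) ?_
    rw [mem_patSub, hassoc]
    fin_cases j
    · rw [← hassoc, forall_six]
      simp [mul_zero_apply, mul_one_apply, inv_zero_apply, inv_one_apply, gen_apply]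
    all_goals
      rw [conj_eq hh2 _ _ (by simp [gen_apply]), forall_six]
      simp [mul_zero_apply, mul_one_apply, mul_two_apply, mul_three_apply,
          mul_four_apply, mul_five_apply, gen_apply]

end Model

/-! ### The patterns attached to a positive root -/

theorem mem_arm {α i : Fin 6} :
    i ∈ arm α ↔ i ∈ (![∅, ∅, {0}, {0}, {0}, {1, 2}] : Fin 6 → Finset (Fin 6)) α := by
  fin_cases α <;> simp [arm]

theorem source_eq (α : Fin 6) : source α = srcTab α := by
  ext i
  rw [source, Set.mem_compl_iff, mem_arm, Finset.mem_coe]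
  revert α i
  decide

/-- The roots reached from `α` by adding positive roots. -/
def nTab : Fin 6 → Finset (Fin 6) :=
  ![{2, 3, 4, 5}, {2, 3, 4, 5}, {3, 4, 5}, {4, 5}, {5}, ∅]

theorem nSeq_subset (α : Fin 6) (m : ℕ) : nSeq α (m + 1) ⊆ nTab α := by
  have step : ∀ α i, i = α ∨ i ∈ nTab α → ∀ j k, posRoot i + posRoot j = posRoot k →
      k ∈ nTab α := by decide +kernel
  induction m with
  | zero =>
    rintro k ⟨i, rfl, j, hk⟩
    exact step i i (.inl rfl) j k hk
  | succ m ih =>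
    rintro k ⟨i, hi, j, hk⟩
    exact step α i (.inr (ih hi)) j k hk

theorem nTab_subset_kSeq_zero (α : Fin 6) : (nTab α : Set (Fin 6)) ⊆ kSeq α 0 := by
  have path : ∀ α, ∀ k ∈ nTab α, (∃ j, posRoot α + posRoot j = posRoot k) ∨
      ∃ i, (∃ j, posRoot α + posRoot j = posRoot i) ∧
        ((∃ j, posRoot i + posRoot j = posRoot k) ∨
          ∃ i', (∃ j, posRoot i + posRoot j = posRoot i') ∧
            ∃ j, posRoot i' + posRoot j = posRoot k) := by decide +kernel
  intro k hk
  rw [kSeq, Set.mem_iUnion]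
  obtain h | ⟨i, hi, h | ⟨i', hi', h⟩⟩ := path α k hk
  · exact ⟨0, α, rfl, h⟩
  · exact ⟨1, i, ⟨α, rfl, hi⟩, h⟩
  · exact ⟨2, i', ⟨i, ⟨α, rfl, hi⟩, hi'⟩, h⟩

theorem kSet_eq (α : Fin 6) : kSet α = kTab α := by
  refine subset_antisymm (Set.iUnion_subset fun m => ?_) fun i hi => ?_
  · have hn : ∀ α, nTab α ⊆ kTab α := by decide
    have step : ∀ α i, (∀ j k, posRoot i + posRoot j = posRoot k → k ∈ kTab α) → i ≠ α →
        i ∈ kTab α := by decide +kernel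
    induction m with
    | zero => exact Set.iUnion_subset fun m => (nSeq_subset α m).trans (by exact_mod_cast hn α)
    | succ m ih =>
      refine Set.union_subset (fun i hi => ?_) ih
      exact step α i (fun j k h => ih (hi.1.1 j k h)) hi.2
  · have step : ∀ α, ∀ i ∈ kTab α, i ≠ α ∧
        ∀ j k, posRoot i + posRoot j = posRoot k → k ∈ nTab α := by decide +kernel
    by_cases h0 : i ∈ kSeq α 0
    · exact Set.mem_iUnion.2 ⟨0, h0⟩
    · exact Set.mem_iUnion.2 ⟨1, .inl ⟨⟨fun j k h =>
        nTab_subset_kSeq_zero α ((step α i hi).2 j k h), h0⟩, (step α i hi).1⟩⟩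

theorem insert_leg_union_kSet_eq (α : Fin 6) :
    {α} ∪ leg α ∪ kSet α = (insert α (legKTab α) : Finset (Fin 6)) := by
  ext i
  rw [kSet_eq, Set.mem_union, Set.mem_union, leg, Set.mem_sdiff, Set.mem_union, mem_arm,
    Set.mem_singleton_iff, hook, Set.mem_ofPred_eq, Finset.mem_coe, Finset.mem_coe]
  revert α i
  decide +kernel

theorem isNormalPattern_insert_legKTab (α : Fin 6) :
    IsNormalPattern (insert α (legKTab α) : Finset (Fin 6)) Set.univ := by
  refine ⟨Set.subset_univ _, fun i _ => ?_⟩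
  simp only [Finset.mem_coe]
  revert α i
  decide +kernel

theorem closed_insert_legKTab (α : Fin 6) :
    IsClosedPattern (insert α (legKTab α) : Finset (Fin 6)) :=
  fun i _ => (isNormalPattern_insert_legKTab α).2 i trivial

theorem closed_srcTab_erase (α : Fin 6) :
    IsClosedPattern ((srcTab α).erase α : Finset (Fin 6)) := by
  simp only [IsClosedPattern, Finset.mem_coe]
  revert α
  decide +kernel

/-! ### Pattern subgroups of `UG₂` -/

section Transfer

open Model

variable {F : Type*} [Field F]

theorem mem_rootSubgroup (h : (6 : F) ≠ 0) {i : Fin 6} {u : U F} :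
    u ∈ rootSubgroup F i ↔ ∃ t, u = modelEquiv F h (gen i t) := by
  have hgen : ∀ (t : F) (u : U F), ((u : (Module.End F (Alg F))ˣ) : Module.End F (Alg F)) =
      rootExp F i t ↔ u = modelEquiv F h (gen i t) := by
    intro t u
    rw [← modelEnd_gen F h, ← coe_modelEquiv, Units.val_inj, Subtype.coe_inj]
  constructor
  · intro hu
    induction hu using Subgroup.closure_induction with
    | mem u hu =>
      obtain ⟨t, ht⟩ := hu
      exact ⟨t, (hgen t u).1 ht⟩
    | one => exact ⟨0, by rw [gen_zero, map_one]⟩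
    | mul u v _ _ hu hv =>
      obtain ⟨s, rfl⟩ := hu
      obtain ⟨t, rfl⟩ := hv
      exact ⟨s + t, by rw [← gen_add, map_mul]⟩
    | inv u _ hu =>
      obtain ⟨s, rfl⟩ := hu
      exact ⟨-s, by rw [← inv_gen, map_inv]⟩
  · rintro ⟨t, ht⟩
    exact Subgroup.subset_closure ⟨t, (hgen t u).2 ht⟩

theorem P_eq_map (h : (6 : F) ≠ 0) {T : Set (Fin 6)} (hT : IsClosedPattern T) :
    P F T = (patSub F T hT).map (modelEquiv F h).toMonoidHom := by
  refine le_antisymm (iSup₂_le fun i hi u hu => ?_) (Subgroup.map_le_iff_le_comap.2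
    (patSub_le fun i hi t => ?_))
  · obtain ⟨t, rfl⟩ := (mem_rootSubgroup h).1 hu
    exact ⟨_, gen_mem_patSub hi t, rfl⟩
  · exact le_iSup₂_of_le (f := fun i _ => rootSubgroup F i) i hi le_rfl
      ((mem_rootSubgroup h).2 ⟨t, rfl⟩)

theorem rootSubgroup_eq_map (h : (6 : F) ≠ 0) (i : Fin 6) : rootSubgroup F i =
    (patSub F {i} (closed_singleton i)).map (modelEquiv F h).toMonoidHom := by
  rw [← P_eq_map h, P, iSup_singleton]

theorem IsReduction.map {G H : Type*} [Group G] [Group H] {S X Y K : Subgroup G}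
    (hr : IsReduction S X Y K) (e : G ≃* H) :
    IsReduction (S.map e.toMonoidHom) (X.map e.toMonoidHom) (Y.map e.toMonoidHom)
      (K.map e.toMonoidHom) where
  Y_le := Subgroup.map_mono hr.Y_le
  X_le := Subgroup.map_mono hr.X_le
  K_le := Subgroup.map_mono hr.K_le
  normal := hr.normal.map _ e.surjective
  comm := by
    rintro _ ⟨s, hs, rfl⟩ _ ⟨t, ht, rfl⟩
    exact ⟨_, hr.comm s hs t ht, by simp⟩
  central := by
    rintro _ ⟨x, hx, rfl⟩ g
    obtain ⟨g, rfl⟩ := e.surjective g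
    exact ⟨_, hr.central x hx g, by simp⟩
  outer := by
    rintro g hg _ ⟨z, hz, rfl⟩
    obtain ⟨g, rfl⟩ := e.surjective g
    obtain ⟨y, hy, y', hy', e1⟩ := hr.outer g (fun hg' => hg ⟨g, hg', rfl⟩) z hz
    exact ⟨_, ⟨y, hy, rfl⟩, _, ⟨y', hy', rfl⟩, by simpa using congrArg e e1⟩
  inner := by
    rintro _ ⟨y, hy, rfl⟩ hyK _ ⟨z, hz, rfl⟩
    obtain ⟨g, k, hk, e1⟩ := hr.inner y hy (fun hy' => hyK ⟨y, hy', rfl⟩) z hz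
    exact ⟨e g, _, ⟨k, hk, rfl⟩, by simpa using congrArg e e1⟩

theorem isReduction_P (h : (6 : F) ≠ 0) (α : Fin 6) :
    IsReduction (S F α) (rootSubgroup F α) (P F (legKTab α)) (P F (kTab α)) := by
  rw [S, source_eq, P_eq_map h (closed_srcTab α), rootSubgroup_eq_map h,
    P_eq_map h (closed_legKTab α), P_eq_map h (closed_kTab α)]
  exact (Model.isReduction h α).map _

theorem mem_P_iff (h : (6 : F) ≠ 0) {T : Set (Fin 6)} (hT : IsClosedPattern T) (m : Model F) :
    modelEquiv F h m ∈ P F T ↔ ∀ i, i ∉ T → m i = 0 := by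
  rw [P_eq_map h hT]
  exact Subgroup.mem_map_iff_mem (modelEquiv F h).injective

theorem P_mono {T T' : Set (Fin 6)} (hT : T ⊆ T') : P F T ≤ P F T' :=
  biSup_mono hT

/-! ### Orders -/

theorem card_P [Fintype F] (h : (6 : F) ≠ 0) (T : Finset (Fin 6))
    (hT : IsClosedPattern (T : Set (Fin 6))) :
    Nat.card (P F T) = Fintype.card F ^ T.card := by
  let E : patSub F T hT ≃ (T → F) :=
    { toFun := fun m i => (m : Model F) i
      invFun := fun f => ⟨⟨fun i => if hi : i ∈ T then f ⟨i, hi⟩ else 0⟩, fun i hi => dif_neg hi⟩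
      left_inv := fun m => by
        have : ∀ i, (if i ∈ T then (m : Model F) i else 0) = (m : Model F) i := fun i => by
          split_ifs with hi
          · rfl
          · exact (m.2 i hi).symm
        exact Subtype.ext (Model.ext (this 0) (this 1) (this 2) (this 3) (this 4) (this 5))
      right_inv := fun f => funext fun i => dif_pos i.2 }
  rw [P_eq_map h hT,
    ← Nat.card_congr ((patSub F T hT).equivMapOfInjective _ (modelEquiv F h).injective).toEquiv,
    Nat.card_congr E, Nat.card_eq_fintype_card, Fintype.card_fun, Fintype.card_coe]

theorem card_rootSubgroup [Fintype F] (h : (6 : F) ≠ 0) (i : Fin 6) :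
    Nat.card (rootSubgroup F i) = Fintype.card F := by
  have h1 := card_P h {i} (by simpa using closed_singleton i)
  rw [Finset.coe_singleton, P, iSup_singleton] at h1
  rw [h1, Finset.card_singleton, pow_one]

theorem card_S [Fintype F] (h : (6 : F) ≠ 0) (α : Fin 6) :
    Nat.card (S F α) = Fintype.card F ^ (srcTab α).card := by
  rw [S, source_eq, card_P h _ (closed_srcTab α)]

theorem card_U [Fintype F] (h : (6 : F) ≠ 0) : Nat.card (U F) = Fintype.card F ^ 6 := by
  have h1 := card_P h Finset.univ fun _ _ _ _ k _ => Finset.mem_coe.2 (Finset.mem_univ k)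
  have h2 : P F ((Finset.univ : Finset (Fin 6)) : Set (Fin 6)) = ⊤ := by
    refine eq_top_iff.2 fun u _ => ?_
    obtain ⟨m, rfl⟩ := (modelEquiv F h).surjective u
    rw [mem_P_iff h fun _ _ _ _ k _ => Finset.mem_coe.2 (Finset.mem_univ k)]
    exact fun i hi => absurd (Finset.mem_coe.2 (Finset.mem_univ i)) hi
  rw [h2, Subgroup.card_top, Finset.card_univ, Fintype.card_fin] at h1
  exact h1

end Transfer

/-! ### Characters of commutative groups -/

section Commutative

open Module

variable {A : Type*} [Group A]

/-- A linear character as a complex function. -/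
def charOfHom (ψ : A →* ℂˣ) : A → ℂ := fun a => ψ a

theorem charOfHom_injective : Function.Injective (charOfHom (A := A)) := fun _ _ h =>
  MonoidHom.ext fun a => Units.ext (congrFun h a)

/-- An irreducible representation of a commutative group is one-dimensional. -/
theorem character_eq_of_commute {n : ℕ} (hA : ∀ a b : A, a * b = b * a)
    (ρ : Representation ℂ A (Fin n → ℂ)) (hρ : ρ.IsIrreducible) {v : Fin n → ℂ} (hv : v ≠ 0)
    {ψ : A →* ℂˣ} (hψ : ∀ a, ρ a v = (ψ a : ℂ) • v) : ρ.character = charOfHom ψ := by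
  have : IsMulCommutative A := ⟨⟨hA⟩⟩
  have hdim : finrank ℂ (Fin n → ℂ) = 1 :=
    Representation.IsIrreducible.finrank_eq_one_of_isMulCommutative ρ
  funext a
  obtain ⟨c, hc⟩ := (exists_eq_smul_one_iff ρ hρ a).2 fun g => by
    rw [hA a g, mul_inv_cancel_right, mul_inv_cancel]
    exact one_mem _
  have hcψ : c = ψ a := by
    refine smul_left_injective ℂ hv ?_
    change c • v = (ψ a : ℂ) • v
    rw [← hψ, hc, LinearMap.smul_apply, End.one_apply]
  rw [Representation.character, hc, map_smul, LinearMap.trace_one, hdim, hcψ, charOfHom]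
  simp

theorem irr_eq_range [Finite A] (hA : ∀ a b : A, a * b = b * a) :
    Irr A = Set.range (charOfHom (A := A)) := by
  ext χ
  constructor
  · rintro ⟨n, ρ, hρ, rfl⟩
    have : Nontrivial (Fin n → ℂ) := by
      by_contra hn
      rw [not_nontrivial_iff_subsingleton] at hn
      obtain ⟨W, W', hW⟩ := hρ.exists_pair_ne
      exact hW (SetLike.ext fun x => by
        rw [Subsingleton.elim x 0]
        exact iff_of_true W.toSubmodule.zero_mem W'.toSubmodule.zero_mem)
    obtain ⟨v, hv, hc⟩ := exists_common_eigenvector _ (Fin n → ℂ) ρ rfl fun s t => by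
      rw [← map_mul, hA, map_mul]
    obtain ⟨ψ, hψ⟩ := exists_hom_of_eigenvector ρ hv hc
    exact ⟨ψ, (character_eq_of_commute hA ρ hρ hv hψ).symm⟩
  · rintro ⟨ψ, rfl⟩
    obtain ⟨n, ρ, hρ, v, hv, h⟩ :=
      exists_irreducible_eigenvector ⊤ (ψ.comp (⊤ : Subgroup A).subtype)
    exact ⟨n, ρ, hρ, character_eq_of_commute hA ρ hρ hv fun a => h ⟨a, trivial⟩⟩

theorem card_linearCharacter [Finite A] (hA : ∀ a b : A, a * b = b * a) :
    Nat.card (A →* ℂˣ) = Nat.card A := by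
  let _ : CommGroup A := { (inferInstance : Group A) with mul_comm := hA }
  exact CommGroup.card_monoidHom_of_hasEnoughRootsOfUnity A ℂ

theorem ncard_irr [Finite A] (hA : ∀ a b : A, a * b = b * a) : (Irr A).ncard = Nat.card A := by
  rw [irr_eq_range hA, ← Nat.card_coe_set_eq, Nat.card_range_of_injective charOfHom_injective,
    card_linearCharacter hA]

theorem ncard_irr_diff_one [Finite A] (hA : ∀ a b : A, a * b = b * a) :
    (Irr A \ {1}).ncard = Nat.card A - 1 := by
  rw [Set.ncard_sdiff_singleton_of_mem, ncard_irr hA]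
  rw [irr_eq_range hA]
  exact ⟨1, rfl⟩

end Commutative

/-! ### Linear characters of the source group -/

section Split

variable {G : Type*} [Group G] {S X Y : Subgroup G} (π : S →* X) (Z : Subgroup S) [Z.Normal]

/-- If `π` is a retraction of `S` onto `X` and `Z = XY`, then the linear characters of `S` that are
trivial on `Y` are the products of a linear character of `S / Z` and one of `X`. -/
theorem bijOn_linearChars (hX : ∀ s : S, (s : G) ∈ X → s ∈ Z ∧ (π s : G) = s)
    (hY : ∀ s : S, (s : G) ∈ Y → s ∈ Z ∧ π s = 1) (hXS : X ≤ S)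
    (hZ : ∀ z ∈ Z, ∃ x y : S, (x : G) ∈ X ∧ (y : G) ∈ Y ∧ z = x * y) :
    Set.BijOn (fun x : (S ⧸ Z →* ℂˣ) × (X →* ℂˣ) =>
        x.1.comp (QuotientGroup.mk' Z) * x.2.comp π)
      (Set.univ ×ˢ {1}ᶜ) (linearChars S X Y) := by
  have hmk : ∀ s ∈ Z, QuotientGroup.mk' Z s = 1 := fun s hs => (QuotientGroup.eq_one_iff s).2 hs
  have hXval : ∀ (μ : S ⧸ Z →* ℂˣ) (l : X →* ℂˣ) (x : X),
      (μ.comp (QuotientGroup.mk' Z) * l.comp π) (Subgroup.inclusion hXS x) = l x := by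
    intro μ l x
    obtain ⟨h1, h2⟩ := hX (Subgroup.inclusion hXS x) x.2
    have h3 : π (Subgroup.inclusion hXS x) = x := Subtype.ext h2
    rw [MonoidHom.mul_apply, MonoidHom.comp_apply, MonoidHom.comp_apply, hmk _ h1, map_one, one_mul,
      h3]
  refine ⟨?_, ?_, ?_⟩
  · rintro ⟨μ, l⟩ ⟨-, hl⟩
    refine ⟨fun s hs => ?_, ?_⟩
    · obtain ⟨h1, h2⟩ := hY s hs
      rw [MonoidHom.mul_apply, MonoidHom.comp_apply, MonoidHom.comp_apply, hmk s h1, h2, map_one,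
        map_one, one_mul]
    · by_contra! hcon
      refine hl (MonoidHom.ext fun x => ?_)
      rw [← hXval μ l x]
      exact hcon _ x.2
  · rintro ⟨μ, l⟩ - ⟨μ', l'⟩ - heq
    have hl : l = l' := MonoidHom.ext fun x => by
      rw [← hXval μ l x, ← hXval μ' l' x]
      exact DFunLike.congr_fun heq _
    subst hl
    refine Prod.ext (MonoidHom.ext fun t => ?_) rfl
    obtain ⟨s, rfl⟩ := QuotientGroup.mk'_surjective Z t
    exact mul_right_cancel (DFunLike.congr_fun heq s)
  · rintro ψ ⟨hψY, s, hs, hs1⟩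
    let l : X →* ℂˣ := ψ.comp (Subgroup.inclusion hXS)
    have hker : Z ≤ (ψ * (l.comp π)⁻¹).ker := by
      intro z hz
      obtain ⟨x, y, hx, hy, rfl⟩ := hZ z hz
      have h1 : Subgroup.inclusion hXS (π x) = x := Subtype.ext (hX x hx).2
      rw [MonoidHom.mem_ker, MonoidHom.mul_apply, MonoidHom.inv_apply, MonoidHom.comp_apply,
        map_mul π, (hY y hy).2, mul_one, map_mul, hψY y hy, mul_one, MonoidHom.comp_apply, h1,
        mul_inv_cancel]
    refine ⟨⟨QuotientGroup.lift Z _ hker, l⟩, ⟨trivial, fun hl => hs1 ?_⟩, ?_⟩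
    · exact DFunLike.congr_fun hl ⟨s, hs⟩
    · refine MonoidHom.ext fun s => ?_
      change ψ s * (l (π s))⁻¹ * l (π s) = ψ s
      rw [inv_mul_cancel_right]

end Split

/-- The degree of a character induced from a linear character is the index. -/
theorem induced_linear_one {G : Type*} [Group G] [Finite G] (S : Subgroup G) (ψ : S →* ℂˣ) :
    induced S (charOfHom ψ) 1 = (Nat.card S : ℂ)⁻¹ * Nat.card G := by
  have : Fintype G := Fintype.ofFinite G
  have h1 : ∀ x : G, x⁻¹ * 1 * x = 1 := fun x => by group
  have h2 : ∀ x : G, ∃ hx : x⁻¹ * 1 * x ∈ S, charOfHom ψ ⟨x⁻¹ * 1 * x, hx⟩ = 1 := by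
    intro x
    rw [h1]
    exact ⟨S.one_mem, by rw [charOfHom]; exact congrArg Units.val (map_one ψ)⟩
  rw [induced, finsum_eq_sum_of_fintype]
  congr 1
  rw [Finset.sum_congr rfl fun x _ => (dif_pos (h2 x).1).trans (h2 x).2, Finset.sum_const,
    Finset.card_univ, nsmul_eq_mul, mul_one, Nat.card_eq_fintype_card]

open Model

variable {F : Type*} [Field F]

/-! ### The quotients of the source group -/

theorem mem_srcTab_and_legKTab_subset : ∀ α : Fin 6, α ∈ srcTab α ∧ α ∉ legKTab α ∧
    legKTab α ⊆ srcTab α := by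
  decide

theorem normal_subgroupOf_of_comm {G : Type*} [Group G] {S Y H : Subgroup G}
    (hc : ∀ s ∈ S, ∀ t ∈ S, s * t * s⁻¹ * t⁻¹ ∈ Y) (hY : Y ≤ H) : (H.subgroupOf S).Normal := by
  refine ⟨fun n hn s => ?_⟩
  rw [Subgroup.mem_subgroupOf] at hn ⊢
  have h1 := H.mul_mem (hY (hc s s.2 n n.2)) hn
  rwa [inv_mul_cancel_right] at h1

/-- Removing the component at `α` from an element of the source group. -/
theorem gen_neg_mul_apply (α i : Fin 6) (hi : i ∉ legKTab α) (m : Model F)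
    (hm : ∀ i, i ∉ srcTab α → m i = 0) :
    (gen α (-m α) * m) i = if i = α then 0 else m i := by
  obtain ⟨h1, -, -⟩ := mem_srcTab_and_legKTab_subset α
  rw [mul_apply_of_notMem_legKTab α i hi _ _ (fun j hj => ?_) hm, gen_apply]
  · split_ifs with h
    · rw [h, neg_add_cancel]
    · rw [zero_add]
  · rw [gen_apply, if_neg]
    rintro rfl
    exact hj h1

theorem kerT_eq (α : Fin 6) :
    kerT F α = (P F (insert α (legKTab α) : Finset (Fin 6))).subgroupOf (S F α) := by
  rw [kerT, insert_leg_union_kSet_eq]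

theorem kerX_eq (α : Fin 6) :
    kerX F α = (P F ((srcTab α).erase α : Finset (Fin 6))).subgroupOf (S F α) := by
  rw [kerX, source_eq, Finset.coe_erase]

theorem P_legKTab_le (α : Fin 6) : P F (legKTab α) ≤ P F (insert α (legKTab α) : Finset (Fin 6)) :=
  P_mono (by exact_mod_cast Finset.subset_insert α (legKTab α))

theorem P_legKTab_le_erase (α : Fin 6) :
    P F (legKTab α) ≤ P F ((srcTab α).erase α : Finset (Fin 6)) := by
  obtain ⟨-, h2, h3⟩ := mem_srcTab_and_legKTab_subset α
  exact P_mono (by exact_mod_cast Finset.subset_erase.2 ⟨h3, h2⟩)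

theorem normal_kerT (h : (6 : F) ≠ 0) (α : Fin 6) : (kerT F α).Normal := by
  rw [kerT_eq]
  exact normal_subgroupOf_of_comm (isReduction_P h α).comm (P_legKTab_le α)

theorem normal_kerX (h : (6 : F) ≠ 0) (α : Fin 6) : (kerX F α).Normal := by
  rw [kerX_eq]
  exact normal_subgroupOf_of_comm (isReduction_P h α).comm (P_legKTab_le_erase α)

theorem mem_S_iff (h : (6 : F) ≠ 0) (α : Fin 6) (m : Model F) :
    modelEquiv F h m ∈ S F α ↔ ∀ i, i ∉ srcTab α → m i = 0 := by
  rw [S, source_eq, mem_P_iff h (closed_srcTab α)]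
  rfl

theorem bijective_toQuot (h : (6 : F) ≠ 0) (α : Fin 6) [(kerX F α).Normal] :
    Function.Bijective (toQuot F α) := by
  constructor
  · refine (injective_iff_map_eq_one _).2 fun x hx => ?_
    replace hx := (QuotientGroup.eq_one_iff _).1 hx
    rw [kerX_eq, Subgroup.mem_subgroupOf] at hx
    obtain ⟨t, ht⟩ := (mem_rootSubgroup h).1 x.2
    have h1 : modelEquiv F h (gen α t) ∈ P F ((srcTab α).erase α : Finset (Fin 6)) := by
      rw [← ht]
      exact hx
    have h2 := (mem_P_iff h (closed_srcTab_erase α) _).1 h1 α (by simp)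
    rw [gen_apply, if_pos rfl] at h2
    rw [h2, gen_zero, map_one] at ht
    exact Subtype.ext ht
  · intro s
    obtain ⟨⟨s, hs⟩, rfl⟩ := QuotientGroup.mk'_surjective _ s
    obtain ⟨m, rfl⟩ := (modelEquiv F h).surjective s
    refine ⟨⟨_, (mem_rootSubgroup h).2 ⟨m α, rfl⟩⟩, (QuotientGroup.eq).2 ?_⟩
    rw [kerX_eq, Subgroup.mem_subgroupOf]
    change (modelEquiv F h (gen α (m α)))⁻¹ * modelEquiv F h m ∈ _
    rw [← map_inv, ← map_mul, inv_gen, mem_P_iff h (closed_srcTab_erase α)]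
    have hm := (mem_S_iff h α m).1 hs
    intro i hi
    have hi' : i ∉ legKTab α := by
      obtain ⟨-, h2, h3⟩ := mem_srcTab_and_legKTab_subset α
      exact fun hl => hi (Finset.mem_coe.2 (Finset.subset_erase.2 ⟨h3, h2⟩ hl))
    rw [gen_neg_mul_apply α i hi' m hm]
    split_ifs with hiα
    · rfl
    · exact hm i fun h' => hi (Finset.mem_coe.2 (Finset.mem_erase.2 ⟨hiα, h'⟩))

/-- The product decomposition `P({α} ∪ ℓ(α) ∪ k(α)) = X_α P(ℓ(α) ∪ k(α))`. -/
theorem exists_mul_of_mem_kerT (h : (6 : F) ≠ 0) (α : Fin 6) (z : S F α) (hz : z ∈ kerT F α) :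
    ∃ x y : S F α, (x : U F) ∈ rootSubgroup F α ∧ (y : U F) ∈ P F (legKTab α) ∧ z = x * y := by
  obtain ⟨z, hzS⟩ := z
  rw [kerT_eq, Subgroup.mem_subgroupOf] at hz
  obtain ⟨m, rfl⟩ := (modelEquiv F h).surjective z
  have hm := (mem_P_iff h (closed_insert_legKTab α) m).1 hz
  have hx : modelEquiv F h (gen α (m α)) ∈ rootSubgroup F α := (mem_rootSubgroup h).2 ⟨m α, rfl⟩
  have hy : (modelEquiv F h (gen α (m α)))⁻¹ * modelEquiv F h m ∈ P F (legKTab α) := by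
    rw [← map_inv, ← map_mul, inv_gen, mem_P_iff h (closed_legKTab α)]
    intro i hi
    rw [gen_neg_mul_apply α i hi m ((mem_S_iff h α m).1 hzS)]
    split_ifs with hiα
    · rfl
    · exact hm i fun h' => (Finset.mem_insert.1 (Finset.mem_coe.1 h')).elim hiα hi
  refine ⟨⟨_, rootSubgroup_le F α hx⟩, ⟨_, (isReduction_P h α).Y_le hy⟩, hx, hy, ?_⟩
  exact Subtype.ext (mul_inv_cancel_left _ _).symm

theorem projX_eq (α : Fin 6) [(kerX F α).Normal] (hX : Function.Bijective (toQuot F α))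
    (s : S F α) (hs : (s : U F) ∈ rootSubgroup F α) : projX F α hX s = ⟨s, hs⟩ :=
  (MulEquiv.symm_apply_eq (MulEquiv.ofBijective (toQuot F α) hX)).2 rfl

theorem projX_eq_one (α : Fin 6) [(kerX F α).Normal] (hX : Function.Bijective (toQuot F α))
    (s : S F α) (hs : s ∈ kerX F α) : projX F α hX s = 1 :=
  (MulEquiv.symm_apply_eq (MulEquiv.ofBijective (toQuot F α) hX)).2
    (((QuotientGroup.eq_one_iff s).2 hs).trans (map_one _).symm)

theorem comm_rootSubgroup (h : (6 : F) ≠ 0) (α : Fin 6) (x y : rootSubgroup F α) :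
    x * y = y * x := by
  obtain ⟨s, hs⟩ := (mem_rootSubgroup h).1 x.2
  obtain ⟨t, ht⟩ := (mem_rootSubgroup h).1 y.2
  refine Subtype.ext ?_
  rw [Subgroup.coe_mul, Subgroup.coe_mul, hs, ht, ← map_mul, ← map_mul, gen_add, gen_add, add_comm]

theorem comm_TBar (h : (6 : F) ≠ 0) (α : Fin 6) [(kerT F α).Normal] (x y : TBar F α) :
    x * y = y * x := by
  obtain ⟨s, rfl⟩ := QuotientGroup.mk'_surjective _ x
  obtain ⟨t, rfl⟩ := QuotientGroup.mk'_surjective _ y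
  rw [← map_mul, ← map_mul]
  refine QuotientGroup.eq.2 ?_
  rw [kerT_eq, Subgroup.mem_subgroupOf]
  have h1 := (isReduction_P h α).comm _ (S F α |>.inv_mem t.2) _ (S F α |>.inv_mem s.2)
  rw [inv_inv, inv_inv] at h1
  have h2 : (((s * t)⁻¹ * (t * s) : S F α) : U F) =
      (t : U F)⁻¹ * (s : U F)⁻¹ * t * s := by
    simp [mul_assoc]
  rw [h2]
  exact P_legKTab_le α h1

/-! ### Single root characters -/

theorem rootSupport_combinatorics (α : Fin 6) (A : Set (Fin 6)) :
    {i | ∀ k, i < k → 1 < k → k ∈ A} \ A = {α} ↔ (∀ k ∈ kTab α, k ∈ A) ∧ α ∉ A := by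
  have key : ∀ (α : Fin 6) (B : Finset (Fin 6)),
      (∀ i, ((∀ k, i < k → 1 < k → k ∈ B) ∧ i ∉ B) ↔ i = α) ↔
        (∀ k ∈ kTab α, k ∈ B) ∧ α ∉ B := by decide +kernel
  classical
  have h1 := key α (Finset.univ.filter (· ∈ A))
  simp only [Finset.mem_filter, Finset.mem_univ, true_and] at h1
  rw [← h1, Set.ext_iff]
  rfl

theorem rootSubgroup_le_ker_iff (h : (6 : F) ≠ 0) {V : Type*} [AddCommGroup V] [Module ℂ V]
    (ρ : Representation ℂ (U F) V) (i : Fin 6) : rootSubgroup F i ≤ ρ.ker ↔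
      ∀ t, gen i t ∈ ρ.ker.comap (modelEquiv F h).toMonoidHom := by
  constructor
  · intro hi t
    exact hi ((mem_rootSubgroup h).2 ⟨t, rfl⟩)
  · intro hi u hu
    obtain ⟨t, rfl⟩ := (mem_rootSubgroup h).1 hu
    exact hi t

theorem mem_rootKernel_iff [Finite (U F)] {n : ℕ} (ρ : Representation ℂ (U F) (Fin n → ℂ))
    (i : Fin 6) : i ∈ rootKernel F ρ.character ↔ rootSubgroup F i ≤ ρ.ker := by
  refine forall₂_congr fun u _ => ?_
  rw [mem_charKer_character_iff, MonoidHom.mem_ker]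

/-- The root center of an irreducible character, in terms of its root kernel. -/
theorem rootCenterChar_eq [Finite (U F)] (h : (6 : F) ≠ 0) {n : ℕ}
    (ρ : Representation ℂ (U F) (Fin n → ℂ)) (hρ : ρ.IsIrreducible) :
    rootCenterChar F ρ.character = {i | ∀ k, i < k → 1 < k → k ∈ rootKernel F ρ.character} := by
  ext i
  simp only [Set.mem_ofPred_eq, mem_rootKernel_iff, rootSubgroup_le_ker_iff h]
  rw [← forall_comm_gen_mem_iff h]
  have h1 : ∀ u : U F, u ∈ charCenter ρ.character ↔ ∀ g, u * g * u⁻¹ * g⁻¹ ∈ ρ.ker := fun u => by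
    rw [mem_charCenter_character_iff, exists_eq_smul_one_iff ρ hρ]
  constructor
  · intro hi t g
    have h2 := (h1 _).1 (hi ((mem_rootSubgroup h).2 ⟨t, rfl⟩)) (modelEquiv F h g)
    simpa using h2
  · intro hi u hu
    obtain ⟨t, rfl⟩ := (mem_rootSubgroup h).1 hu
    refine (h1 _).2 fun g => ?_
    obtain ⟨g, rfl⟩ := (modelEquiv F h).surjective g
    simpa using hi t g

/-- The single root characters over `α` are the irreducible characters that are trivial on
`P(k(α))` and nontrivial on `X_α`. -/
theorem singleRoot_eq [Finite (U F)] (h : (6 : F) ≠ 0) (α : Fin 6) : singleRoot F α =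
    {χ ∈ Irr (U F) | (P F (kTab α) : Set (U F)) ⊆ charKer χ ∧
      ¬(rootSubgroup F α : Set (U F)) ⊆ charKer χ} := by
  ext χ
  refine and_congr_right ?_
  rintro ⟨n, ρ, hρ, rfl⟩
  have h1 : (P F (kTab α) : Set (U F)) ⊆ charKer ρ.character ↔ P F (kTab α) ≤ ρ.ker := by
    refine forall₂_congr fun u _ => ?_
    rw [mem_charKer_character_iff, MonoidHom.mem_ker]
  rw [rootSupport, rootCenterChar_eq h ρ hρ, rootSupport_combinatorics, h1, P, iSup₂_le_iff]
  refine and_congr (forall₂_congr fun i _ => mem_rootKernel_iff ρ i) Iff.rfl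

/-- The domain of `Ψ_α` in terms of linear characters. -/
theorem bijOn_charOfHom {A B : Type*} [Group A] [Group B] [Finite A] [Finite B]
    (hA : ∀ a b : A, a * b = b * a) (hB : ∀ a b : B, a * b = b * a) :
    Set.BijOn (Prod.map (charOfHom (A := A)) (charOfHom (A := B))) (Set.univ ×ˢ {1}ᶜ)
      (Irr A ×ˢ (Irr B \ {1})) := by
  rw [irr_eq_range hA, irr_eq_range hB]
  refine ⟨?_, (charOfHom_injective.prodMap charOfHom_injective).injOn, ?_⟩
  · rintro ⟨μ, l⟩ ⟨-, hl⟩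
    exact ⟨⟨μ, rfl⟩, ⟨l, rfl⟩, fun h1 => hl (charOfHom_injective h1)⟩
  · rintro ⟨-, -⟩ ⟨⟨μ, rfl⟩, ⟨l, rfl⟩, hl⟩
    exact ⟨(μ, l), ⟨trivial, fun h1 => hl (congrArg charOfHom h1)⟩, rfl⟩

theorem bijOn_Psi [Finite (U F)] (h : (6 : F) ≠ 0) (α : Fin 6) [(kerT F α).Normal]
    [(kerX F α).Normal] (hX : Function.Bijective (toQuot F α)) :
    Set.BijOn (Psi F α hX) (Irr (TBar F α) ×ˢ (Irr (rootSubgroup F α) \ {1}))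
      (singleRoot F α) := by
  have hr := isReduction_P h α
  have hlin := bijOn_linearChars (Y := P F (legKTab α)) (projX F α hX) (kerT F α)
    (fun s hs => ⟨by
      rw [kerT_eq, Subgroup.mem_subgroupOf]
      exact le_iSup₂_of_le (f := fun i _ => rootSubgroup F i) α (by simp) le_rfl hs,
      by rw [projX_eq α hX s hs]⟩)
    (fun s hs => ⟨by
      rw [kerT_eq, Subgroup.mem_subgroupOf]
      exact P_legKTab_le α hs,
      projX_eq_one α hX s (by
        rw [kerX_eq, Subgroup.mem_subgroupOf]
        exact P_legKTab_le_erase α hs)⟩)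
    hr.X_le (exists_mul_of_mem_kerT h α)
  have hcomp := hr.bijOn_induced.comp hlin
  rw [← singleRoot_eq h] at hcomp
  have hdom := bijOn_charOfHom (comm_TBar h α) (comm_rootSubgroup h α)
  refine ⟨?_, ?_, ?_⟩
  · intro x hx
    obtain ⟨y, hy, rfl⟩ := hdom.surjOn hx
    exact hcomp.mapsTo hy
  · intro x hx x' hx' heq
    obtain ⟨y, hy, rfl⟩ := hdom.surjOn hx
    obtain ⟨y', hy', rfl⟩ := hdom.surjOn hx'
    rw [hcomp.injOn hy hy' heq]
  · intro χ hχ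
    obtain ⟨y, hy, rfl⟩ := hcomp.surjOn hχ
    exact ⟨_, hdom.mapsTo hy, rfl⟩

theorem card_srcTab : ∀ α : Fin 6, (srcTab α).card =
    (![0, 0, 0, 1, 2, 1] : Fin 6 → ℕ) α + (insert α (legKTab α)).card := by
  decide

theorem card_srcTab_add : ∀ α : Fin 6,
    6 = (srcTab α).card + (![0, 0, 1, 1, 1, 2] : Fin 6 → ℕ) α := by
  decide

theorem card_TBar [Fintype F] (h : (6 : F) ≠ 0) (α : Fin 6) :
    Nat.card (TBar F α) * Fintype.card F ^ (insert α (legKTab α)).card =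
      Fintype.card F ^ (srcTab α).card := by
  have hle : P F (insert α (legKTab α) : Finset (Fin 6)) ≤ S F α := by
    obtain ⟨h1, -, h3⟩ := mem_srcTab_and_legKTab_subset α
    rw [S, source_eq]
    exact P_mono (by exact_mod_cast Finset.insert_subset h1 h3)
  have hk : Nat.card (kerT F α) = Fintype.card F ^ (insert α (legKTab α)).card := by
    rw [kerT_eq, Nat.card_congr (Subgroup.subgroupOfEquivOfLe hle).toEquiv,
      card_P h _ (closed_insert_legKTab α)]
  rw [← card_S h, Subgroup.card_eq_card_quotient_mul_card_subgroup (kerT F α), hk]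

theorem ncard_singleRoot [Fintype F] [Finite (U F)] (h : (6 : F) ≠ 0) (α : Fin 6) :
    (singleRoot F α).ncard = midafiCount (Fintype.card F) α := by
  have := normal_kerT h α
  have := normal_kerX h α
  have hb := bijOn_Psi h α (bijective_toQuot h α)
  have hq : 0 < Fintype.card F := Fintype.card_pos
  rw [← hb.image_eq, hb.injOn.ncard_image, Set.ncard_prod, ncard_irr (comm_TBar h α),
    ncard_irr_diff_one (comm_rootSubgroup h α), card_rootSubgroup h]
  have hc := card_TBar h α
  generalize Nat.card (TBar F α) = c at hc
  have hcc : c = Fintype.card F ^ (![0, 0, 0, 1, 2, 1] : Fin 6 → ℕ) α := by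
    refine Nat.eq_of_mul_eq_mul_right (pow_pos hq (insert α (legKTab α)).card) ?_
    rw [hc, ← pow_add, card_srcTab]
  rw [hcc]
  fin_cases α <;> simp [midafiCount]

/-- Single root characters over `α` have degree `|UG₂ : S_α|`. -/
theorem apply_one_of_mem_singleRoot [Fintype F] [Finite (U F)] (h : (6 : F) ≠ 0) (α : Fin 6)
    {χ : U F → ℂ} (hχ : χ ∈ singleRoot F α) : χ 1 = (midafiDegree (Fintype.card F) α : ℂ) := by
  rw [singleRoot_eq h] at hχ
  obtain ⟨ψ, -, rfl⟩ := (isReduction_P h α).bijOn_induced.surjOn hχ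
  have hq : (Fintype.card F : ℂ) ≠ 0 := Nat.cast_ne_zero.2 Fintype.card_ne_zero
  change induced (S F α) (charOfHom ψ) 1 = _
  rw [induced_linear_one, card_S h, card_U h, inv_mul_eq_iff_eq_mul₀ (by
    push_cast
    exact pow_ne_zero _ hq)]
  have hd : ∀ q : ℕ, midafiDegree q α = q ^ (![0, 0, 1, 1, 1, 2] : Fin 6 → ℕ) α := by
    intro q
    fin_cases α <;> simp [midafiDegree]
  rw [hd]
  push_cast
  rw [← pow_add, ← card_srcTab_add]

theorem midafi_eq_singleRoot [Fintype F] [Finite (U F)] (h : (6 : F) ≠ 0) (α : Fin 6) :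
    midafi F α = singleRoot F α := by
  refine Set.sep_eq_self_iff_mem_true.2 fun χ hχ ψ hψ => ?_
  rw [apply_one_of_mem_singleRoot h α hχ, apply_one_of_mem_singleRoot h α hψ]

end UG2

theorem mainTheorem10 (p : ℕ) (hp : 3 < p) (F : Type*) [Field F] [Fintype F] [CharP F p]
    (α : Fin 6) :
    UG2.IsClosedPattern (UG2.source α) ∧
    UG2.IsNormalPattern ({α} ∪ UG2.leg α ∪ UG2.kSet α) Set.univ ∧
    (∃ (_ : (UG2.kerT F α).Normal) (_ : (UG2.kerX F α).Normal)
        (hX : Function.Bijective (UG2.toQuot F α)),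
      Set.BijOn (UG2.Psi F α hX)
        (UG2.Irr (UG2.TBar F α) ×ˢ (UG2.Irr (UG2.rootSubgroup F α) \ {1}))
        (UG2.singleRoot F α)) ∧
    (UG2.midafi F α).ncard = UG2.midafiCount (Fintype.card F) α ∧
    ∀ χ ∈ UG2.midafi F α, χ 1 = (UG2.midafiDegree (Fintype.card F) α : ℂ) := by
  have hprime : p.Prime := (CharP.char_is_prime_or_zero F p).resolve_right (by omega)
  have h : (6 : F) ≠ 0 := by
    intro h6
    have h1 : p ∣ 6 := (CharP.cast_eq_zero_iff F p 6).1 (by exact_mod_cast h6)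
    have h2 : p ≤ 6 := Nat.le_of_dvd (by norm_num) h1
    interval_cases p <;> revert hprime h1 <;> decide
  have hfin : Finite (UG2.U F) :=
    Nat.finite_of_card_ne_zero (by
      rw [UG2.card_U h]
      exact pow_ne_zero _ Fintype.card_ne_zero)
  refine ⟨?_, ?_, ⟨UG2.normal_kerT h α, UG2.normal_kerX h α, ?_⟩, ?_, ?_⟩
  · rw [UG2.source_eq]
    exact UG2.closed_srcTab α
  · rw [UG2.insert_leg_union_kSet_eq]
    exact UG2.isNormalPattern_insert_legKTab α
  · have := UG2.normal_kerT h α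
    have := UG2.normal_kerX h α
    exact ⟨UG2.bijective_toQuot h α, UG2.bijOn_Psi h α _⟩
  · rw [UG2.midafi_eq_singleRoot h, UG2.ncard_singleRoot h]
  · intro χ hχ
    rw [UG2.midafi_eq_singleRoot h] at hχ
    exact UG2.apply_one_of_mem_singleRoot h α hχ
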